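/- Let $\zeta^{(\ell)}$ denote the $\ell$-th derivative of the Riemann zeta function, and write $\log_2 T=\log\log T$ and $\log_3 T=\log\log\log T$. There is an absolute constant $\widetilde c>0$ such that the following holds for all fixed $\ell\in\mathbb{N}$ and $\beta\in[0,1)$. (A) Let $c$ be a positive number less than $\sqrt{2(1-\beta)}$. If $T$ is sufficiently large (in terms of $\ell$, $\beta$ and $c$), then $$\max_{T^{\beta}\le t\le T}\left|\zeta^{(\ell)}\Big(\frac12+it\Big)\right|\ \ge\ \exp\left\{c\sqrt{\frac{\log T\,\log_3 T}{\log_2 T}}\right\}.$$ (B) Let $\sigma\in(\frac12,1)$ be given and let $\kappa$ be a positive number less than $1-\beta$. Then for sufficiently large $T$ (in terms of $\ell$, $\beta$, $\sigma$ and $\kappa$), $$\max_{T^{\beta}\le t\le T}\left|\zeta^{(\ell)}(\sigma+it)\right|\ \ge\ \exp\left\{\frac{\widetilde c\,\kappa^{1-\sigma}}{1-\sigma}\cdot\frac{(\log T)^{1-\sigma}}{(\log_2 T)^{\sigma}}\right\}.$$ -/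

import Mathlib

/-! ### Linear growth of zeta minus its pole, and of its derivatives, in a right half-plane. -/

section

open Complex Filter Topology Set

/-! The method is resonance, applied to a smoothed form of the `l`-th derivative of zeta. Suppose
that derivative is bounded by `V` on the segment of height `T ^ β` to `T`. Averaging along the
vertical line against a Schwartz kernel whose Fourier transform is a bump keeps the bound, at the
cost of an `O(1)` error, and turns the function into a Dirichlet polynomial with the nonnegative
coefficients `(log k) ^ l * k ^ (-σ)` times a cutoff, of length `exp (2 A)` with `A = (log T) ^
(3/4)`. The pole contributes a truncated Laplace integral that is negligible high up. This is
`vertAvg_riemannZeta₀` and `exists_norm_smoothedSum_le_eventually`.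

Such a polynomial is then integrated against the square of a resonator and a Gaussian
(`exists_resonance_inequality`). The resonator's frequencies are rounded to multiples of `1/τ`, so
no spacing between them is needed: Cauchy–Schwarz inside the bins and Schur's test between them
control the quadratic form. Positivity of all terms gives a lower bound by a sum over edges of a
graph, each edge multiplying an integer by some `k`. With resonator support of size at most `T ^ κ`
and `β + κ < 1`, the error terms vanish in the limit, so `V + 1` dominates a constant times the
normalised edge sum.

The vertices are the products of primes of `P` with exponents 0, 1, 2, weighted by `θ p` off the
central exponent 1. An edge raises some exponents by one. Every sum factors over the primes; with `x
= p ^ (-σ)`, the edge sum exceeds the vertex sum by the factor `1 + 2 x θ / (1 + 2 θ²)` at each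
prime. Using both sides of the centre doubles the first-order gain `x θ` and the quadratic cost in
`θ` compared with exponents 0, 1; by homogeneity this wins a factor `√2` at a given cost. Rankin's
trick discards expensive vertices, which bounds the support size (`le_sum_goodEdges`, `card_le_exp`,
`exists_prime_resonance`).

It remains to choose weights, with Mertens' theorem as the input on primes. To the right of the
critical line, constant weights on all primes up to a multiple of `log T * log log T` suffice. On
the critical line the primes lie between `y` and about `y ^ (1 + η)`, with `θ p = √(y / p) / v p`
and `v p` close to `log (p / y)`. The gain is then about `2 √y * log log y / log y` at cost `2 y *
log log y / log y`; setting the cost equal to `κ * log T` produces the constant `√(2 κ)`, with `κ`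
as close to `1 - β` as desired. -/

/-- The terms of a series that continues `(1 - s) * riemannZeta₀ s` to `0 < s.re`. -/
noncomputable def zetaCorrTerm (n : ℕ) (s : ℂ) : ℂ :=
  (1 - s) * ((n : ℂ) + 1) ^ (-s) - (((n : ℂ) + 2) ^ (1 - s) - ((n : ℂ) + 1) ^ (1 - s))

lemma norm_cpow_sub_cpow_le {a x : ℝ} (ha : 0 < a) (hx : a ≤ x) {s : ℂ} (hs : 0 ≤ s.re) :
    ‖(x : ℂ) ^ (-s) - (a : ℂ) ^ (-s)‖ ≤ ‖s‖ * a ^ (-s.re - 1) * (x - a) := by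
  have key := (convex_Icc a x).norm_image_sub_le_of_norm_hasDerivWithin_le
    (f := fun y : ℝ => (y : ℂ) ^ (-s)) (f' := fun y : ℝ => (-s) * (y : ℂ) ^ (-s - 1))
    (C := ‖s‖ * a ^ (-s.re - 1)) (x := a) (y := x) ?_ ?_ ⟨le_rfl, hx⟩ ⟨hx, le_rfl⟩
  · rwa [Real.norm_of_nonneg (sub_nonneg.2 hx)] at key
  · intro y hy
    have hy0 : 0 < y := ha.trans_le hy.1
    have h := (hasDerivAt_id (y : ℂ)).cpow_const (c := -s) (Or.inl (by simpa using hy0))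
    simpa using (h.comp_ofReal).hasDerivWithinAt
  · intro y hy
    have hy0 : 0 < y := ha.trans_le hy.1
    rw [norm_mul, norm_neg, norm_cpow_eq_rpow_re_of_pos hy0]
    have : (-s - 1).re = -s.re - 1 := by simp
    rw [this]
    exact mul_le_mul_of_nonneg_left (Real.rpow_le_rpow_of_nonpos ha hy.1 (by linarith))
      (norm_nonneg _)

/-- The mean value inequality is used twice: the term is the increment over a unit interval of a
function whose derivative is itself a difference of two values of `y ^ (-s)`. This gains one power
of `n` and gives convergence for `0 < s.re`. -/
lemma norm_zetaCorrTerm_le (n : ℕ) {s : ℂ} (hs : 0 ≤ s.re) :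
    ‖zetaCorrTerm n s‖ ≤ ‖1 - s‖ * ‖s‖ * ((n : ℝ) + 1) ^ (-s.re - 1) := by
  set a : ℝ := (n : ℝ) + 1 with ha
  have ha0 : 0 < a := by positivity
  have key := (convex_Icc a (a + 1)).norm_image_sub_le_of_norm_hasDerivWithin_le
    (f := fun y : ℝ => (1 - s) * (a : ℂ) ^ (-s) * y - (y : ℂ) ^ (1 - s))
    (f' := fun y : ℝ => (1 - s) * (a : ℂ) ^ (-s) - (1 - s) * (y : ℂ) ^ (-s))
    (C := ‖1 - s‖ * ‖s‖ * a ^ (-s.re - 1)) (x := a) (y := a + 1) ?_ ?_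
    ⟨le_rfl, by linarith⟩ ⟨by linarith, le_rfl⟩
  · have e : zetaCorrTerm n s = ((1 - s) * (a : ℂ) ^ (-s) * ((a + 1 : ℝ) : ℂ)
        - ((a + 1 : ℝ) : ℂ) ^ (1 - s)) - ((1 - s) * (a : ℂ) ^ (-s) * a - (a : ℂ) ^ (1 - s)) := by
      have h1 : ((n : ℂ) + 1) = (a : ℂ) := by simp [ha]
      have h2 : ((n : ℂ) + 2) = ((a + 1 : ℝ) : ℂ) := by simp [ha]; ring
      rw [zetaCorrTerm, h1, h2]; push_cast; ring
    rw [e]; simpa using key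
  · intro y hy
    have hy0 : 0 < y := ha0.trans_le hy.1
    have h := (hasDerivAt_id (y : ℂ)).cpow_const (c := 1 - s) (Or.inl (by simpa using hy0))
    have h2 := ((hasDerivAt_id (y : ℂ)).const_mul ((1 - s) * (a : ℂ) ^ (-s))).sub h
    have h3 := h2.comp_ofReal.hasDerivWithinAt (s := Icc a (a + 1))
    simpa using h3
  · intro y hy
    rw [← mul_sub, norm_mul, mul_assoc]
    refine mul_le_mul_of_nonneg_left ?_ (norm_nonneg _)
    rw [norm_sub_rev]
    refine (norm_cpow_sub_cpow_le ha0 hy.1 hs).trans ?_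
    exact mul_le_of_le_one_right (by positivity) (by linarith [hy.2])

lemma summable_zetaCorr_bound {δ : ℝ} (hδ : 0 < δ) :
    Summable fun n : ℕ => ((n : ℝ) + 1) ^ (-δ - 1) := by
  have := (summable_nat_add_iff 1).2 (Real.summable_nat_rpow.2 (show -δ - 1 < -1 by linarith))
  simpa using this

lemma norm_zetaCorrTerm_le' (n : ℕ) {s : ℂ} {δ : ℝ} (hδ : 0 < δ) (hs : δ ≤ s.re) :
    ‖zetaCorrTerm n s‖ ≤ ‖1 - s‖ * ‖s‖ * ((n : ℝ) + 1) ^ (-δ - 1) :=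
  (norm_zetaCorrTerm_le n (hδ.le.trans hs)).trans <| mul_le_mul_of_nonneg_left
    (Real.rpow_le_rpow_of_exponent_le (by linarith [(Nat.cast_nonneg n : (0:ℝ) ≤ n)])
      (by linarith)) (by positivity)

lemma differentiable_zetaCorrTerm (n : ℕ) : Differentiable ℂ (zetaCorrTerm n) := by
  have h1 : ((n : ℂ) + 1) ≠ 0 := by exact_mod_cast Nat.succ_ne_zero n
  have h2 : ((n : ℂ) + 2) ≠ 0 := by exact_mod_cast (by omega : n + 2 ≠ 0)
  intro s
  unfold zetaCorrTerm
  fun_prop (disch := simp [h1, h2])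

/-- The subtracted differences telescope to `-1`, which is exactly the contribution of the pole to
`(1 - s) * riemannZeta s`. -/
lemma tsum_zetaCorrTerm_of_one_lt {s : ℂ} (hs : 1 < s.re) :
    ∑' n, zetaCorrTerm n s = (1 - s) * riemannZeta₀ s := by
  have hs1 : s ≠ 1 := by rintro rfl; simp at hs
  have hsum : Summable fun n : ℕ => 1 / ((n : ℂ) + 1) ^ s := by
    have := (summable_nat_add_iff 1).2 (Complex.summable_one_div_nat_cpow.2 hs)
    simpa using this
  have hz : HasSum (fun n : ℕ => (1 - s) * ((n : ℂ) + 1) ^ (-s)) ((1 - s) * riemannZeta s) := by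
    rw [zeta_eq_tsum_one_div_nat_add_one_cpow hs]
    have := hsum.hasSum.mul_left (1 - s)
    simpa [cpow_neg] using this
  have htel : Tendsto (fun n : ℕ => ∑ i ∈ Finset.range n,
      (((i : ℂ) + 2) ^ (1 - s) - ((i : ℂ) + 1) ^ (1 - s))) atTop (𝓝 (0 - 1)) := by
    have e : ∀ n : ℕ, ∑ i ∈ Finset.range n,
      (((i : ℂ) + 2) ^ (1 - s) - ((i : ℂ) + 1) ^ (1 - s)) = ((n : ℂ) + 1) ^ (1 - s) - 1 := by
      intro n
      have := Finset.sum_range_sub (fun i : ℕ => ((i : ℂ) + 1) ^ (1 - s)) n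
      simp only [Nat.cast_zero, zero_add, one_cpow] at this
      rw [← this]
      refine Finset.sum_congr rfl fun i _ => ?_
      push_cast; ring_nf
    simp_rw [e]
    refine Tendsto.sub_const ?_ 1
    rw [tendsto_zero_iff_norm_tendsto_zero]
    have h1 : ∀ n : ℕ, ‖((n : ℂ) + 1) ^ (1 - s)‖ = ((n : ℝ) + 1) ^ (-(s.re - 1)) := by
      intro n
      have := norm_cpow_eq_rpow_re_of_pos (show (0:ℝ) < (n : ℝ) + 1 by positivity) (1 - s)
      push_cast at this
      rw [this]; congr 1; simp
    simp_rw [h1]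
    exact (tendsto_rpow_neg_atTop (by linarith : 0 < s.re - 1)).comp
      (tendsto_atTop_add_const_right _ _ tendsto_natCast_atTop_atTop)
  have hsm : Summable fun n => zetaCorrTerm n s :=
    Summable.of_norm_bounded ((summable_zetaCorr_bound (δ := s.re) (by linarith)).mul_left
      (‖1 - s‖ * ‖s‖)) fun n => norm_zetaCorrTerm_le n (by linarith)
  refine tendsto_nhds_unique hsm.hasSum.tendsto_sum_nat ?_
  have := hz.tendsto_sum_nat.sub htel
  simp_rw [← Finset.sum_sub_distrib] at this
  have e : (1 - s) * riemannZeta₀ s = (1 - s) * riemannZeta s - (0 - 1) := by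
    rw [riemannZeta_eq_inv_sub_add hs1]
    have : s - 1 ≠ 0 := sub_ne_zero.2 hs1
    field_simp
    ring
  rw [e]
  exact this

/-- Identity theorem on the half-plane `0 < re`, where the series converges locally uniformly. -/
lemma tsum_zetaCorrTerm {s : ℂ} (hs : 0 < s.re) :
    ∑' n, zetaCorrTerm n s = (1 - s) * riemannZeta₀ s := by
  set U : Set ℂ := {z | 0 < z.re} with hU
  have hUo : IsOpen U := isOpen_lt continuous_const continuous_re
  have hdiff : DifferentiableOn ℂ (fun s => ∑' n, zetaCorrTerm n s) U := by
    intro z hz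
    set V : Set ℂ := {w | z.re / 2 < w.re} ∩ Metric.ball 0 (‖z‖ + 1) with hV
    have hVo : IsOpen V := (isOpen_lt continuous_const continuous_re).inter Metric.isOpen_ball
    have hzV : z ∈ V := ⟨by show z.re / 2 < z.re; have : 0 < z.re := hz; linarith, by simp⟩
    have hz0 : 0 < z.re / 2 := by have : 0 < z.re := hz; linarith
    have := differentiableOn_tsum_of_summable_norm (F := zetaCorrTerm) (U := V)
      ((summable_zetaCorr_bound hz0).mul_left ((1 + (‖z‖ + 1)) * (‖z‖ + 1)))
      (fun n => (differentiable_zetaCorrTerm n).differentiableOn) hVo ?_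
    · exact (this.differentiableAt (hVo.mem_nhds hzV)).differentiableWithinAt
    · intro n w hw
      refine (norm_zetaCorrTerm_le' n hz0 (le_of_lt hw.1)).trans ?_
      have hw2 : ‖w‖ ≤ ‖z‖ + 1 := by simpa using (le_of_lt (Metric.mem_ball.1 hw.2))
      have hw3 : ‖1 - w‖ ≤ 1 + (‖z‖ + 1) := (norm_sub_le _ _).trans (by simpa using hw2)
      gcongr
  have hconv : IsPreconnected U := (convex_halfSpace_re_gt 0).isPreconnected
  have heq := (hdiff.analyticOnNhd hUo).eqOn_of_preconnected_of_eventuallyEq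
    (g := fun s => (1 - s) * riemannZeta₀ s)
    ((by fun_prop : Differentiable ℂ fun s => (1 - s) * riemannZeta₀ s).differentiableOn.analyticOnNhd
      hUo) hconv (z₀ := 2) (by simp [hU]) ?_
  · exact heq hs
  · filter_upwards [(isOpen_lt continuous_const continuous_re : IsOpen {z : ℂ | 1 < z.re}).mem_nhds
      (show (2 : ℂ) ∈ {z : ℂ | 1 < z.re} by simp)] with w hw
    exact tsum_zetaCorrTerm_of_one_lt hw

lemma exists_norm_riemannZeta₀_le {δ : ℝ} (hδ : 0 < δ) :
    ∃ C, 0 ≤ C ∧ ∀ s : ℂ, δ ≤ s.re → ‖riemannZeta₀ s‖ ≤ C * (1 + ‖s‖) := by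
  set C := ∑' n : ℕ, ((n : ℝ) + 1) ^ (-δ - 1)
  have hC : 0 ≤ C := tsum_nonneg fun n => by positivity
  refine ⟨max C ‖riemannZeta₀ 1‖, le_max_of_le_left hC, fun s hs => ?_⟩
  -- The factor `1 - s` has to be cancelled; at `s = 1` this fails, so that single value is put into
  -- the constant.
  by_cases h1 : s = 1
  · subst h1
    calc ‖riemannZeta₀ 1‖ ≤ max C ‖riemannZeta₀ 1‖ * 1 := by simp
      _ ≤ _ := by gcongr; simp
  · have hb : ‖(1 - s) * riemannZeta₀ s‖ ≤ ‖1 - s‖ * ‖s‖ * C := by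
      rw [← tsum_zetaCorrTerm (hδ.trans_le hs)]
      exact tsum_of_norm_bounded ((summable_zetaCorr_bound hδ).hasSum.mul_left _)
        fun n => norm_zetaCorrTerm_le' n hδ hs
    have h2 : 0 < ‖1 - s‖ := norm_pos_iff.2 (sub_ne_zero.2 (Ne.symm h1))
    rw [norm_mul, mul_assoc] at hb
    have := le_of_mul_le_mul_left hb h2
    calc ‖riemannZeta₀ s‖ ≤ ‖s‖ * C := this
      _ = C * ‖s‖ := mul_comm _ _
      _ ≤ max C ‖riemannZeta₀ 1‖ * (1 + ‖s‖) := by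
        gcongr
        · exact le_max_left _ _
        · linarith

/-- Cauchy's estimate on circles of radius `1/8`, which remain in `1/8 ≤ re`. Linear growth
suffices, since every later average is against a Schwartz function. -/
lemma exists_norm_iteratedDeriv_riemannZeta₀_le (l : ℕ) :
    ∃ C, 0 ≤ C ∧ ∀ s : ℂ, 1 / 4 ≤ s.re →
      ‖iteratedDeriv l riemannZeta₀ s‖ ≤ C * (1 + ‖s‖) := by
  obtain ⟨C, hC, h⟩ := exists_norm_riemannZeta₀_le (δ := 1 / 8) (by norm_num)
  refine ⟨l.factorial * (C * 2) / (1 / 8) ^ l, by positivity, fun s hs => ?_⟩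
  have := norm_iteratedDeriv_le_of_forall_mem_sphere_norm_le (c := s) (R := 1 / 8)
    (C := C * (2 * (1 + ‖s‖))) (f := riemannZeta₀) l (by norm_num)
    differentiable_riemannZeta₀.diffContOnCl ?_
  · refine this.trans (le_of_eq ?_); ring
  · intro z hz
    have hz' : ‖z - s‖ = 1 / 8 := by simpa [dist_eq_norm] using hz
    have hre : |(z - s).re| ≤ 1 / 8 := hz' ▸ abs_re_le_norm _
    have hn : ‖z‖ ≤ ‖s‖ + 1 / 8 := by
      have := norm_add_le (z - s) s
      rw [sub_add_cancel, hz'] at this; linarith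
    refine (h z ?_).trans ?_
    · have := (abs_le.1 hre).1
      simp at this; linarith
    · gcongr; linarith [norm_nonneg s]

end

/-! ### The pole as a Laplace transform, the Dirichlet series, and the cutoff. -/

section

open Complex Filter Topology Set MeasureTheory SchwartzMap FourierTransform
open scoped Nat

lemma norm_exp_neg_mul_ofReal (z : ℂ) (x : ℝ) : ‖cexp (-z * x)‖ = Real.exp (-z.re * x) := by
  rw [norm_exp]; simp

lemma integrableOn_pow_mul_cexp (l : ℕ) {z : ℂ} (hz : 0 < z.re) :
    IntegrableOn (fun x : ℝ => (x : ℂ) ^ l * cexp (-z * x)) (Ioi 0) := by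
  have h := integrableOn_rpow_mul_exp_neg_mul_rpow (s := (l : ℝ)) (p := 1) (b := z.re)
    (by have : (0:ℝ) ≤ l := Nat.cast_nonneg l
        linarith) one_pos hz
  refine Integrable.mono' h (Continuous.aestronglyMeasurable (by fun_prop)) ?_
  refine (ae_restrict_iff' measurableSet_Ioi).2 (ae_of_all _ fun x hx => ?_)
  have hx' : (0 : ℝ) < x := hx
  rw [norm_mul, norm_pow, norm_exp_neg_mul_ofReal, norm_real, Real.norm_of_nonneg hx'.le]
  simp

/-- The pole of the `l`-th derivative becomes a continuous analogue of the Dirichlet series, with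
`x` in the role of `log k`; averaging then truncates both in the same way. -/
lemma integral_pow_mul_cexp (l : ℕ) {z : ℂ} (hz : 0 < z.re) :
    ∫ x : ℝ in Ioi 0, (x : ℂ) ^ l * cexp (-z * x) = l ! / z ^ (l + 1) := by
  have hz0 : z ≠ 0 := by rintro rfl; simp at hz
  have hlim : ∀ n : ℕ, Tendsto (fun x : ℝ => (x : ℂ) ^ n * cexp (-z * x)) atTop (𝓝 0) := by
    intro n
    rw [tendsto_zero_iff_norm_tendsto_zero]
    have := tendsto_rpow_mul_exp_neg_mul_atTop_nhds_zero n z.re hz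
    refine this.congr' ?_
    filter_upwards [eventually_ge_atTop (0 : ℝ)] with x hx
    rw [norm_mul, norm_pow, norm_exp_neg_mul_ofReal, norm_real, Real.norm_of_nonneg hx]
    simp
  have hexp : ∀ x : ℝ, HasDerivAt (fun x : ℝ => cexp (-z * x)) (cexp (-z * x) * (-z)) x := by
    intro x
    have := ((hasDerivAt_id (x : ℂ)).const_mul (-z)).cexp.comp_ofReal
    simpa using this
  induction l with
  | zero =>
    have key := integral_Ioi_of_hasDerivAt_of_tendsto' (a := (0 : ℝ))
      (f := fun x : ℝ => cexp (-z * x) * (-z)⁻¹) (f' := fun x : ℝ => cexp (-z * x)) (m := 0)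
      (fun x _ => ?_) (by simpa using integrableOn_pow_mul_cexp 0 hz) ?_
    · simpa [key] using key
    · have := (hexp x).mul_const (-z)⁻¹
      rwa [mul_assoc, mul_inv_cancel₀ (neg_ne_zero.2 hz0), mul_one] at this
    · simpa using (hlim 0).mul_const (-z)⁻¹
  | succ l ih =>
    have key := integral_Ioi_of_hasDerivAt_of_tendsto' (a := (0 : ℝ))
      (f := fun x : ℝ => (x : ℂ) ^ (l + 1) * cexp (-z * x))
      (f' := fun x : ℝ => (l + 1) * ((x : ℂ) ^ l * cexp (-z * x)) -
        z * ((x : ℂ) ^ (l + 1) * cexp (-z * x))) (m := 0)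
      (fun x _ => ?_) ?_ (hlim _)
    · rw [integral_sub ((integrableOn_pow_mul_cexp l hz).const_mul _)
        ((integrableOn_pow_mul_cexp (l + 1) hz).const_mul _), integral_const_mul,
        integral_const_mul, ih] at key
      simp only [ofReal_zero, ne_eq, Nat.add_eq_zero_iff, one_ne_zero, and_false,
        not_false_eq_true, zero_pow, zero_mul, sub_zero] at key
      have h2 := sub_eq_zero.1 key
      rw [eq_div_iff (pow_ne_zero _ hz0), Nat.factorial_succ]
      have h3 : z * (∫ x : ℝ in Ioi 0, (x : ℂ) ^ (l + 1) * cexp (-z * x)) * z ^ (l + 1)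
        = (l + 1) * (l ! : ℂ) := by
        rw [← h2]; field_simp
      push_cast
      rw [← h3]; ring
    · have h1 : HasDerivAt (fun x : ℝ => (x : ℂ) ^ (l + 1)) ((l + 1) * (x : ℂ) ^ l) x := by
        have := (hasDerivAt_pow (l + 1) (x : ℂ)).comp_ofReal
        simpa using this
      refine (h1.mul (hexp x)).congr_deriv ?_
      ring
    · exact ((integrableOn_pow_mul_cexp l hz).const_mul _).sub
        ((integrableOn_pow_mul_cexp (l + 1) hz).const_mul _)

lemma iteratedDeriv_inv_sub_one (l : ℕ) (s : ℂ) :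
    iteratedDeriv l (fun s : ℂ => (s - 1)⁻¹) s = (-1) ^ l * (l ! / (s - 1) ^ (l + 1)) := by
  have := congrFun (iter_deriv_inv_linear_sub l (1 : ℂ) 1) s
  simp only [one_mul, one_pow, mul_one] at this
  rw [iteratedDeriv_eq_iterate, this, div_eq_mul_inv, mul_assoc]
  congr 3
  rw [show (-1 - (l : ℤ)) = -((l + 1 : ℕ) : ℤ) by push_cast; ring, zpow_neg, zpow_natCast]

lemma iteratedDeriv_riemannZeta (l : ℕ) {s : ℂ} (hs : s ≠ 1) :
    iteratedDeriv l riemannZeta s =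
      iteratedDeriv l riemannZeta₀ s + (-1) ^ l * (l ! / (s - 1) ^ (l + 1)) := by
  have h : riemannZeta =ᶠ[𝓝 s] fun z => riemannZeta₀ z + (z - 1)⁻¹ := by
    filter_upwards [isOpen_ne.mem_nhds hs] with z hz
    rw [riemannZeta_eq_inv_sub_add hz, add_comm]
  rw [h.iteratedDeriv_eq, iteratedDeriv_fun_add, iteratedDeriv_inv_sub_one]
  · exact differentiable_riemannZeta₀.contDiff.contDiffAt
  · have : s - 1 ≠ 0 := sub_ne_zero.2 hs
    exact ContDiffAt.inv (by fun_prop) this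

/-- A term of the Dirichlet series of `(-1) ^ l * iteratedDeriv l riemannZeta`. -/
noncomputable def logPowTerm (l k : ℕ) (s : ℂ) : ℂ := (Real.log k : ℂ) ^ l * (k : ℂ) ^ (-s)

lemma logMul_iterate_one (l n : ℕ) : (LSeries.logMul^[l] 1) n = (Real.log n : ℂ) ^ l := by
  induction l with
  | zero => simp
  | succ l ih =>
    rw [Function.iterate_succ', Function.comp_apply]
    simp only [LSeries.logMul, ih, natCast_log, pow_succ]
    ring

lemma hasSum_logPowTerm (l : ℕ) {s : ℂ} (hs : 1 < s.re) :
    HasSum (fun k => logPowTerm l (k + 1) s) ((-1) ^ l * iteratedDeriv l riemannZeta s) := by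
  have hab : LSeries.abscissaOfAbsConv 1 < s.re := by
    rw [LSeries.abscissaOfAbsConv_one]; exact_mod_cast hs
  have hsum : LSeriesSummable (LSeries.logMul^[l] 1) s := by
    apply LSeriesSummable_of_abscissaOfAbsConv_lt_re
    rwa [LSeries.absicssaOfAbsConv_logPowMul]
  have hev : riemannZeta =ᶠ[𝓝 s] LSeries 1 := by
    filter_upwards [(isOpen_lt continuous_const continuous_re : IsOpen {z : ℂ | 1 < z.re}).mem_nhds
      hs] with w hw
    exact (LSeries_one_eq_riemannZeta hw).symm
  rw [hev.iteratedDeriv_eq, LSeries_iteratedDeriv l hab, ← mul_assoc, ← mul_pow]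
  simp only [mul_neg, mul_one, neg_neg, one_pow, one_mul]
  have := (hasSum_nat_add_iff' 1).2 hsum.hasSum
  simp only [Finset.range_one, Finset.sum_singleton, LSeries.term_zero, sub_zero] at this
  have e : (fun k => logPowTerm l (k + 1) s) =
      fun k => LSeries.term (LSeries.logMul^[l] 1) s (k + 1) := by
    funext k
    rw [LSeries.term_of_ne_zero (Nat.succ_ne_zero k), logMul_iterate_one, logPowTerm, cpow_neg,
      div_eq_mul_inv]
  rw [e]
  exact this

/-- A smooth even cutoff, equal to `1` on `[-1, 1]` and supported in `[-2, 2]`. -/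
noncomputable def cutoff : ContDiffBump (0 : ℝ) := ⟨1, 2, one_pos, one_lt_two⟩

lemma cutoff_eq_one {x : ℝ} (hx : |x| ≤ 1) : cutoff x = 1 :=
  cutoff.one_of_mem_closedBall (by simpa [cutoff] using hx)

lemma cutoff_eq_zero {x : ℝ} (hx : 2 ≤ |x|) : cutoff x = 0 :=
  cutoff.zero_of_le_dist (by simpa [cutoff] using hx)

lemma contDiff_cutoff_ofReal : ContDiff ℝ ((⊤ : ℕ∞) : WithTop ℕ∞) fun x : ℝ => (cutoff x : ℂ) :=
  ofRealCLM.contDiff.comp cutoff.contDiff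

lemma hasCompactSupport_cutoff_ofReal : HasCompactSupport fun x : ℝ => (cutoff x : ℂ) :=
  cutoff.hasCompactSupport.comp_left ofReal_zero

/-- The Fourier transform of the cutoff. -/
noncomputable def cutoffHat : 𝓢(ℝ, ℂ) :=
  𝓕 (hasCompactSupport_cutoff_ofReal.toSchwartzMap contDiff_cutoff_ofReal)

/-- Fourier inversion at `-ξ`; evenness of the cutoff removes the sign. -/
lemma integral_cutoffHat (ξ : ℝ) :
    ∫ w : ℝ, cutoffHat w * cexp (-(2 * Real.pi * w * ξ : ℝ) * I) = cutoff ξ := by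
  set f := hasCompactSupport_cutoff_ofReal.toSchwartzMap contDiff_cutoff_ofReal
  have h : (𝓕⁻ (𝓕 f)) (-ξ) = f (-ξ) := by rw [fourierInv_fourier_eq f]
  have h2 : f (-ξ) = cutoff ξ := by
    show ((cutoff (-ξ) : ℝ) : ℂ) = cutoff ξ
    rw [cutoff.neg]
  rw [h2, SchwartzMap.fourierInv_coe, Real.fourierInv_eq'] at h
  rw [← h]
  refine integral_congr_ae (ae_of_all _ fun w => ?_)
  simp only [smul_eq_mul]
  rw [mul_comm]
  congr 2
  simp
  ring

end

/-! ### Vertical averages: from zeta to a smoothed Dirichlet polynomial. -/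

section

open Complex Filter Topology Set MeasureTheory SchwartzMap FourierTransform
open scoped Nat

/-- The average of `F` along the vertical line through `s`, at scale `c`, against `cutoffHat`. -/
noncomputable def vertAvg (F : ℂ → ℂ) (c : ℝ) (s : ℂ) : ℂ :=
  ∫ w : ℝ, cutoffHat w * F (s + (c * w : ℝ) * I)

lemma integrable_norm_cutoffHat_mul (a c : ℝ) :
    Integrable fun w : ℝ => ‖cutoffHat w‖ * (a + |c| * |w|) := by
  have h0 := (cutoffHat.integrable_pow_mul volume 0).mul_const a
  have h1 := (cutoffHat.integrable_pow_mul volume 1).mul_const |c|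
  refine (h0.add h1).congr (ae_of_all _ fun w => ?_)
  simp only [pow_zero, one_mul, pow_one, Real.norm_eq_abs, Pi.add_apply]
  ring

lemma norm_add_mul_I_le (s : ℂ) (c w : ℝ) : ‖s + (c * w : ℝ) * I‖ ≤ ‖s‖ + |c| * |w| := by
  refine (norm_add_le _ _).trans ?_
  rw [norm_mul, norm_I, mul_one, norm_real, Real.norm_eq_abs, abs_mul]

lemma norm_le_of_linear_growth {F : ℂ → ℂ} {C : ℝ} (hC : 0 ≤ C)
    (hb : ∀ s : ℂ, 1 / 4 ≤ s.re → ‖F s‖ ≤ C * (1 + ‖s‖)) {s : ℂ} (hs : 1 / 4 ≤ s.re) (c w : ℝ)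
    {R : ℝ} (hR : ‖s‖ ≤ R) :
    ‖cutoffHat w * F (s + (c * w : ℝ) * I)‖ ≤ C * (‖cutoffHat w‖ * ((1 + R) + |c| * |w|)) := by
  rw [norm_mul]
  have h1 : ‖F (s + (c * w : ℝ) * I)‖ ≤ C * ((1 + R) + |c| * |w|) := by
    refine (hb _ (by simpa using hs)).trans ?_
    exact mul_le_mul_of_nonneg_left (by linarith [norm_add_mul_I_le s c w]) hC
  calc _ ≤ ‖cutoffHat w‖ * (C * ((1 + R) + |c| * |w|)) := by gcongr
    _ = _ := by ring

lemma integrable_vertAvg {F : ℂ → ℂ} (hF : Continuous F) {C : ℝ} (hC : 0 ≤ C)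
    (hb : ∀ s : ℂ, 1 / 4 ≤ s.re → ‖F s‖ ≤ C * (1 + ‖s‖)) (c : ℝ) {s : ℂ} (hs : 1 / 4 ≤ s.re) :
    Integrable fun w : ℝ => cutoffHat w * F (s + (c * w : ℝ) * I) := by
  refine ((integrable_norm_cutoffHat_mul (1 + ‖s‖) c).const_mul C).mono' ?_ (ae_of_all _ fun w =>
    norm_le_of_linear_growth hC hb hs c w le_rfl)
  have := cutoffHat.continuous
  exact Continuous.aestronglyMeasurable (by fun_prop)

/-- Linear growth of `F` and of its derivative against Schwartz decay allows differentiation under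
the integral. Holomorphy is what lets the averaging identity be continued into the strip. -/
lemma differentiableOn_vertAvg {F : ℂ → ℂ} (hF : Differentiable ℂ F) {C C' : ℝ} (hC : 0 ≤ C)
    (hC' : 0 ≤ C') (hb : ∀ s : ℂ, 1 / 4 ≤ s.re → ‖F s‖ ≤ C * (1 + ‖s‖))
    (hb' : ∀ s : ℂ, 1 / 4 ≤ s.re → ‖deriv F s‖ ≤ C' * (1 + ‖s‖)) (c : ℝ) :
    DifferentiableOn ℂ (vertAvg F c) {s | 1 / 4 < s.re} := by
  intro s hs
  set V : Set ℂ := {w | 1 / 4 < w.re} ∩ Metric.ball 0 (‖s‖ + 1)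
  have hVo : IsOpen V := (isOpen_lt continuous_const continuous_re).inter Metric.isOpen_ball
  have hsV : s ∈ V := ⟨hs, by simp⟩
  have hK := cutoffHat.continuous
  have hc := hF.continuous
  have hc' : Continuous (deriv F) := (hF.contDiff (n := 1)).continuous_deriv le_rfl
  have key := hasDerivAt_integral_of_dominated_loc_of_deriv_le (μ := (volume : Measure ℝ))
    (F := fun (z : ℂ) (w : ℝ) => cutoffHat w * F (z + (c * w : ℝ) * I))
    (F' := fun (z : ℂ) (w : ℝ) => cutoffHat w * deriv F (z + (c * w : ℝ) * I)) (x₀ := s)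
    (bound := fun w => C' * (‖cutoffHat w‖ * ((1 + (‖s‖ + 1)) + |c| * |w|)))
    (hVo.mem_nhds hsV) (Eventually.of_forall fun z =>
      Continuous.aestronglyMeasurable (by fun_prop))
    (integrable_vertAvg hc hC hb c (le_of_lt hs))
    (Continuous.aestronglyMeasurable (by fun_prop))
    (ae_of_all _ fun w z hz => norm_le_of_linear_growth hC' hb' (le_of_lt hz.1) c w
      (by simpa using (Metric.mem_ball.1 hz.2).le))
    ((integrable_norm_cutoffHat_mul _ c).const_mul C')
    (ae_of_all _ fun w z hz => ?_)
  · exact key.2.differentiableAt.differentiableWithinAt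
  · have h1 : HasDerivAt (fun z : ℂ => z + (c * w : ℝ) * I) 1 z := (hasDerivAt_id z).add_const _
    have := ((hF (z + (c * w : ℝ) * I)).hasDerivAt.comp z h1).const_mul (cutoffHat w)
    simpa using this

/-- The smoothed polar part. -/
noncomputable def polarPart (l : ℕ) (A : ℝ) (s : ℂ) : ℂ :=
  ∫ x in Ioc 0 (2 * A), (cutoff (x / A) : ℂ) * ((x : ℂ) ^ l * cexp (-(s - 1) * x))

lemma differentiable_polarPart (l : ℕ) (A : ℝ) : Differentiable ℂ (polarPart l A) := by
  intro s
  have hK : Continuous fun x : ℝ => (cutoff (x / A) : ℂ) :=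
    contDiff_cutoff_ofReal.continuous.comp (continuous_id.div_const A)
  have hint : ∀ f : ℝ → ℂ, Continuous f → IntegrableOn f (Ioc 0 (2 * A)) := fun f hf =>
    (hf.continuousOn.integrableOn_compact isCompact_Icc).mono_set Ioc_subset_Icc_self
  have hb : Continuous fun p : ℂ × ℝ =>
      (cutoff (p.2 / A) : ℂ) * ((p.2 : ℂ) ^ l * (cexp (-(p.1 - 1) * p.2) * (-p.2))) := by
    have : Continuous fun p : ℂ × ℝ => (cutoff (p.2 / A) : ℂ) := hK.comp continuous_snd
    fun_prop
  obtain ⟨M, hM⟩ := ((isCompact_closedBall s 1).prod (isCompact_Icc (a := (0:ℝ)) (b := 2 * A))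
    ).exists_bound_of_continuousOn hb.continuousOn
  have key := hasDerivAt_integral_of_dominated_loc_of_deriv_le
    (μ := (volume : Measure ℝ).restrict (Ioc 0 (2 * A)))
    (F := fun (z : ℂ) (x : ℝ) => (cutoff (x / A) : ℂ) * ((x : ℂ) ^ l * cexp (-(z - 1) * x)))
    (F' := fun (z : ℂ) (x : ℝ) =>
      (cutoff (x / A) : ℂ) * ((x : ℂ) ^ l * (cexp (-(z - 1) * x) * (-x)))) (x₀ := s)
    (bound := fun _ => M)
    (Metric.ball_mem_nhds s one_pos) (Eventually.of_forall fun z =>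
      Continuous.aestronglyMeasurable (by fun_prop))
    (hint _ (by fun_prop))
    (Continuous.aestronglyMeasurable (by fun_prop))
    ((ae_restrict_iff' measurableSet_Ioc).2 (ae_of_all _ fun x hx z hz =>
      hM (z, x) ⟨Metric.ball_subset_closedBall hz, Ioc_subset_Icc_self hx⟩))
    (integrable_const M)
    (ae_of_all _ fun x z _ => ?_)
  · exact key.2.differentiableAt
  · have h1 : HasDerivAt (fun z : ℂ => -(z - 1) * x) (-x) z := by
      simpa using (((hasDerivAt_id z).sub_const 1).neg.mul_const (x : ℂ))
    exact (h1.cexp.const_mul _).const_mul _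

/-- The smoothed Dirichlet polynomial of the `l`-th derivative of zeta. -/
noncomputable def smoothedSum (l : ℕ) (A : ℝ) (s : ℂ) : ℂ :=
  ∑ k ∈ Finset.range ⌈Real.exp (2 * A)⌉₊,
    (cutoff (Real.log ((k + 1 : ℕ) : ℝ) / A) : ℂ) * logPowTerm l (k + 1) s

lemma differentiable_smoothedSum (l : ℕ) (A : ℝ) : Differentiable ℂ (smoothedSum l A) := by
  unfold smoothedSum logPowTerm
  refine Differentiable.fun_sum fun k _ => ?_
  have : ((k + 1 : ℕ) : ℂ) ≠ 0 := Nat.cast_ne_zero.2 (Nat.succ_ne_zero k)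
  intro s
  fun_prop (disch := simp [this])

lemma cutoff_log_eq_zero {A : ℝ} (hA : 0 < A) {k : ℕ} (hk : k ∉ Finset.range ⌈Real.exp (2 * A)⌉₊) :
    cutoff (Real.log ((k + 1 : ℕ) : ℝ) / A) = 0 := by
  apply cutoff_eq_zero
  rw [Finset.mem_range, not_lt] at hk
  have h1 : Real.exp (2 * A) ≤ ((k + 1 : ℕ) : ℝ) := by
    push_cast
    linarith [Nat.le_ceil (Real.exp (2 * A)), (Nat.cast_le (α := ℝ)).2 hk]
  have h2 : 2 * A ≤ Real.log ((k + 1 : ℕ) : ℝ) := by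
    rw [Real.le_log_iff_exp_le (by positivity)]; exact h1
  exact le_trans ((le_div_iff₀ hA).2 h2) (le_abs_self _)

/-- With the scale `2π / A`, a vertical shift produces precisely the phase whose integral against
`cutoffHat` is the cutoff at `log (k + 1) / A`. -/
lemma logPowTerm_add_mul_I (l k : ℕ) (s : ℂ) {A : ℝ} (w : ℝ) :
    logPowTerm l (k + 1) (s + (2 * Real.pi / A * w : ℝ) * I) = logPowTerm l (k + 1) s *
      cexp (-(2 * Real.pi * w * (Real.log ((k + 1 : ℕ) : ℝ) / A) : ℝ) * I) := by
  have hk : ((k + 1 : ℕ) : ℂ) ≠ 0 := Nat.cast_ne_zero.2 (Nat.succ_ne_zero k)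
  rw [logPowTerm, logPowTerm, neg_add, cpow_add _ _ hk, mul_assoc]
  congr 2
  rw [cpow_def_of_ne_zero hk, ← natCast_log]
  congr 1
  push_cast
  ring

lemma norm_logPowTerm (l k : ℕ) (s : ℂ) :
    ‖logPowTerm l (k + 1) s‖ = Real.log ((k + 1 : ℕ) : ℝ) ^ l * ((k + 1 : ℕ) : ℝ) ^ (-s.re) := by
  rw [logPowTerm, norm_mul, norm_pow, norm_real, Real.norm_of_nonneg (Real.log_natCast_nonneg _),
    norm_natCast_cpow_of_pos (Nat.succ_pos k), neg_re]

/-- Absolute convergence allows termwise integration, and each term picks up its cutoff factor. -/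
lemma vertAvg_dirichletSeries (l : ℕ) {A : ℝ} (hA : 0 < A) {s : ℂ} (hs : 1 < s.re) :
    vertAvg (fun z => (-1) ^ l * iteratedDeriv l riemannZeta z) (2 * Real.pi / A) s =
      smoothedSum l A s := by
  have hK := cutoffHat.continuous
  have hKi : Integrable fun w => ‖cutoffHat w‖ := by
    simpa using cutoffHat.integrable_pow_mul volume 0
  have hterm : ∀ k : ℕ, Integrable fun w : ℝ =>
      cutoffHat w * logPowTerm l (k + 1) (s + (2 * Real.pi / A * w : ℝ) * I) := by
    intro k
    have hk : ((k + 1 : ℕ) : ℂ) ≠ 0 := Nat.cast_ne_zero.2 (Nat.succ_ne_zero k)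
    refine (hKi.mul_const ‖logPowTerm l (k + 1) s‖).mono'
      (Continuous.aestronglyMeasurable ?_) (ae_of_all _ fun w => ?_)
    · simp_rw [logPowTerm_add_mul_I]; fun_prop
    · rw [norm_mul, norm_logPowTerm, norm_logPowTerm]; simp
  have hsum : Summable fun k : ℕ => ‖logPowTerm l (k + 1) s‖ := (hasSum_logPowTerm l hs).summable.norm
  have hnorm : ∀ k : ℕ, ∫ w : ℝ,
      ‖cutoffHat w * logPowTerm l (k + 1) (s + (2 * Real.pi / A * w : ℝ) * I)‖ =
      (∫ w : ℝ, ‖cutoffHat w‖) * ‖logPowTerm l (k + 1) s‖ := by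
    intro k
    rw [← integral_mul_const]
    refine integral_congr_ae (ae_of_all _ fun w => ?_)
    simp only
    rw [norm_mul, norm_logPowTerm, norm_logPowTerm]; simp
  have key := hasSum_integral_of_summable_integral_norm hterm
    (by simp_rw [hnorm]; exact hsum.mul_left _)
  have e1 : ∀ w : ℝ, ∑' k : ℕ, cutoffHat w * logPowTerm l (k + 1) (s + (2 * Real.pi / A * w : ℝ) * I)
      = cutoffHat w * ((-1) ^ l * iteratedDeriv l riemannZeta (s + (2 * Real.pi / A * w : ℝ) * I)) := by
    intro w
    exact ((hasSum_logPowTerm l (by simpa using hs)).mul_left _).tsum_eq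
  simp_rw [e1] at key
  have e2 : ∀ k : ℕ, ∫ w : ℝ, cutoffHat w * logPowTerm l (k + 1) (s + (2 * Real.pi / A * w : ℝ) * I)
      = (cutoff (Real.log ((k + 1 : ℕ) : ℝ) / A) : ℂ) * logPowTerm l (k + 1) s := by
    intro k
    rw [← integral_cutoffHat, ← integral_mul_const]
    refine integral_congr_ae (ae_of_all _ fun w => ?_)
    simp only
    rw [logPowTerm_add_mul_I]; ring
  simp_rw [e2] at key
  refine key.unique (hasSum_sum_of_ne_finset_zero fun k hk => ?_)
  rw [cutoff_log_eq_zero hA hk]; simp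

lemma vertAvg_pole (l : ℕ) {A : ℝ} (hA : 0 < A) {s : ℂ} (hs : 1 < s.re) :
    vertAvg (fun z => l ! / (z - 1) ^ (l + 1)) (2 * Real.pi / A) s = polarPart l A s := by
  have hre : 0 < (s - 1).re := by simpa using hs
  have hK := cutoffHat.continuous
  have h1 : ∀ w : ℝ, cutoffHat w * (l ! / ((s + (2 * Real.pi / A * w : ℝ) * I) - 1) ^ (l + 1)) =
      ∫ x : ℝ in Ioi 0, cutoffHat w * ((x : ℂ) ^ l * cexp (-(s - 1) * x) *
        cexp (-(2 * Real.pi * w * (x / A) : ℝ) * I)) := by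
    intro w
    rw [integral_const_mul, ← integral_pow_mul_cexp l (by simpa using hs)]
    congr 1
    refine setIntegral_congr_fun measurableSet_Ioi fun x _ => ?_
    rw [mul_assoc, ← Complex.exp_add]
    congr 2
    push_cast
    ring
  unfold vertAvg
  simp_rw [h1]
  rw [integral_integral_swap]
  · have h2 : ∀ x : ℝ, ∫ w : ℝ, cutoffHat w * ((x : ℂ) ^ l * cexp (-(s - 1) * x) *
        cexp (-(2 * Real.pi * w * (x / A) : ℝ) * I)) =
        (cutoff (x / A) : ℂ) * ((x : ℂ) ^ l * cexp (-(s - 1) * x)) := by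
      intro x
      rw [← integral_cutoffHat, ← integral_mul_const]
      refine integral_congr_ae (ae_of_all _ fun w => ?_)
      simp only
      ring
    simp_rw [h2]
    rw [polarPart]
    refine setIntegral_eq_of_subset_of_forall_sdiff_eq_zero measurableSet_Ioi
      Ioc_subset_Ioi_self fun x hx => ?_
    have hx1 : 0 < x := hx.1
    have hx2 : 2 * A < x := by
      by_contra h
      exact hx.2 ⟨hx1, not_lt.1 h⟩
    rw [cutoff_eq_zero ((le_div_iff₀ hA).2 hx2.le |>.trans (le_abs_self _))]
    simp
  · have hKi : Integrable fun w => cutoffHat w := cutoffHat.integrable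
    have h3 := hKi.mul_prod (integrableOn_pow_mul_cexp l hre)
    refine h3.norm.mono' (Continuous.aestronglyMeasurable ?_) (ae_of_all _ fun p => ?_)
    · unfold Function.uncurry; fun_prop
    · rw [Function.uncurry, norm_mul, norm_mul, norm_mul]
      rw [show (-(2 * Real.pi * p.1 * (p.2 / A) : ℝ) * I : ℂ) =
        ((-(2 * Real.pi * p.1 * (p.2 / A)) : ℝ) : ℂ) * I by push_cast; ring, norm_exp_ofReal_mul_I]
      simp

lemma norm_pole_le (l : ℕ) {s : ℂ} (hs : s.re ≠ 1) :
    ‖(l ! : ℂ) / (s - 1) ^ (l + 1)‖ ≤ l ! / |s.re - 1| ^ (l + 1) := by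
  have h : |s.re - 1| ≤ ‖s - 1‖ := by simpa using abs_re_le_norm (s - 1)
  have h0 : 0 < |s.re - 1| := abs_pos.2 (sub_ne_zero.2 hs)
  rw [norm_div, norm_pow, norm_natCast]
  gcongr

lemma integrable_vertAvg_pole (l : ℕ) (c : ℝ) {s : ℂ} (hs : s.re ≠ 1) :
    Integrable fun w : ℝ => cutoffHat w * (l ! / (s + (c * w : ℝ) * I - 1) ^ (l + 1)) := by
  have hK := cutoffHat.continuous
  refine (cutoffHat.integrable.norm.mul_const (l ! / |s.re - 1| ^ (l + 1))).mono'
    (Continuous.aestronglyMeasurable (hK.mul (continuous_const.div (by fun_prop) fun w => ?_)))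
    (ae_of_all _ fun w => ?_)
  · refine pow_ne_zero _ fun h => hs ?_
    have := congrArg re h
    simp at this
    linarith
  · rw [norm_mul]
    gcongr
    have := norm_pole_le l (s := s + (c * w : ℝ) * I) (by simpa using hs)
    simpa using this

/-- For `1 < re` this is the difference of `vertAvg_dirichletSeries` and `vertAvg_pole`. The
truncated sum and integral are entire and the left side is holomorphic for `1/4 < re`, so the
identity survives where the untruncated series no longer converges. -/
lemma vertAvg_riemannZeta₀ (l : ℕ) {A : ℝ} (hA : 0 < A) {s : ℂ} (hs : 1 / 4 < s.re) :
    (-1) ^ l * vertAvg (iteratedDeriv l riemannZeta₀) (2 * Real.pi / A) s =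
      smoothedSum l A s - polarPart l A s := by
  set U : Set ℂ := {z | 1 / 4 < z.re}
  have hUo : IsOpen U := isOpen_lt continuous_const continuous_re
  obtain ⟨C, hC, hb⟩ := exists_norm_iteratedDeriv_riemannZeta₀_le l
  obtain ⟨C', hC', hb'⟩ := exists_norm_iteratedDeriv_riemannZeta₀_le (l + 1)
  have hd : Differentiable ℂ (iteratedDeriv l riemannZeta₀) :=
    (differentiable_riemannZeta₀.contDiff (n := ⊤)).differentiable_iteratedDeriv l
      (by exact_mod_cast WithTop.coe_lt_top _)
  have hL := (differentiableOn_vertAvg hd hC hC' hb (by simpa [iteratedDeriv_succ] using hb')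
    (2 * Real.pi / A)).const_mul ((-1) ^ l)
  have hR := ((differentiable_smoothedSum l A).sub (differentiable_polarPart l A)).differentiableOn
    (s := U)
  have heq := (hL.analyticOnNhd hUo).eqOn_of_preconnected_of_eventuallyEq (hR.analyticOnNhd hUo)
    (convex_halfSpace_re_gt _).isPreconnected (z₀ := 2) (by simp; norm_num) ?_
  · exact heq hs
  · filter_upwards [(isOpen_lt continuous_const continuous_re : IsOpen {z : ℂ | 1 < z.re}).mem_nhds
      (show (2 : ℂ) ∈ {z : ℂ | 1 < z.re} by simp)] with z hz
    have hz' : 1 < z.re := hz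
    simp only [Pi.sub_apply]
    rw [← vertAvg_dirichletSeries l hA hz, ← vertAvg_pole l hA hz]
    obtain ⟨C, hC, hb⟩ := exists_norm_iteratedDeriv_riemannZeta₀_le l
    rw [vertAvg, vertAvg, vertAvg, ← integral_const_mul]
    have e : ∀ w : ℝ, cutoffHat w * ((-1) ^ l * iteratedDeriv l riemannZeta
          (z + (2 * Real.pi / A * w : ℝ) * I)) =
        (-1) ^ l * (cutoffHat w * iteratedDeriv l riemannZeta₀ (z + (2 * Real.pi / A * w : ℝ) * I))
        + cutoffHat w * (l ! / (z + (2 * Real.pi / A * w : ℝ) * I - 1) ^ (l + 1)) := by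
      intro w
      have hne : z + (2 * Real.pi / A * w : ℝ) * I ≠ 1 := by
        intro h
        have := congrArg re h
        simp at this
        linarith
      have hsq : ((-1 : ℂ) ^ l) * (-1) ^ l = 1 := by rw [← mul_pow]; simp
      rw [iteratedDeriv_riemannZeta l hne]
      linear_combination (cutoffHat w * (l ! / (z + (2 * Real.pi / A * w : ℝ) * I - 1) ^ (l + 1))) * hsq
    simp_rw [e]
    rw [integral_add ((integrable_vertAvg hd.continuous hC hb _ (by linarith)).const_mul _)
      (integrable_vertAvg_pole l _ (by linarith)), add_sub_cancel_right]

end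

/-! ### An upper bound for the smoothed polynomial in terms of a bound for zeta. -/

section

open Complex Filter Topology Set MeasureTheory SchwartzMap FourierTransform
open scoped Nat

lemma exists_abs_deriv_cutoff_le : ∃ M, 0 ≤ M ∧ ∀ x, |deriv cutoff x| ≤ M := by
  have hc : Continuous (deriv cutoff) := (cutoff.contDiff (n := 1)).continuous_deriv le_rfl
  obtain ⟨M, hM⟩ := hc.bounded_above_of_compact_support cutoff.hasCompactSupport.deriv
  exact ⟨M, (norm_nonneg _).trans (hM 0), hM⟩

/-- One integration by parts gains `1 / |s.im|`; the remaining factors are polynomial in `A` times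
`exp A`. -/
lemma exists_norm_polarPart_le (l : ℕ) : ∃ C, 0 ≤ C ∧ ∀ A : ℝ, 1 ≤ A → ∀ s : ℂ, 1 / 2 ≤ s.re →
    s.im ≠ 0 → ‖polarPart l A s‖ ≤ C * ((1 + 2 * A) ^ (l + 1) * Real.exp A) / |s.im| := by
  obtain ⟨M, hM0, hM⟩ := exists_abs_deriv_cutoff_le
  refine ⟨1 + M + l, by positivity, fun A hA s hs ht => ?_⟩
  set z := s - 1 with hz
  have hzim : |s.im| ≤ ‖z‖ := by simpa [hz] using abs_im_le_norm z
  have ht0 : 0 < |s.im| := abs_pos.2 ht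
  have hz0 : 0 < ‖z‖ := ht0.trans_le hzim
  have hzne : z ≠ 0 := norm_pos_iff.1 hz0
  have hA0 : 0 < A := by linarith
  have hu : ∀ x : ℝ, HasDerivAt (fun x : ℝ => (cutoff (x / A) : ℂ) * (x : ℂ) ^ l)
      ((deriv cutoff (x / A) / A : ℝ) * (x : ℂ) ^ l + cutoff (x / A) * (l * (x : ℂ) ^ (l - 1))) x := by
    intro x
    have h1 : HasDerivAt cutoff (deriv cutoff (x / A)) (x / A) :=
      ((cutoff.contDiff (n := 1)).differentiable one_ne_zero _).hasDerivAt
    have h2 := (h1.comp x ((hasDerivAt_id x).div_const A)).ofReal_comp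
    have h3 := (hasDerivAt_pow l (x : ℂ)).comp_ofReal
    refine (h2.mul h3).congr_deriv ?_
    simp only [Function.comp_apply, id_eq]
    push_cast
    ring
  have hv : ∀ x : ℝ, HasDerivAt (fun x : ℝ => cexp (-z * x) * (-z)⁻¹) (cexp (-z * x)) x := by
    intro x
    have h := (((hasDerivAt_id (x : ℂ)).const_mul (-z)).cexp.comp_ofReal).mul_const (-z)⁻¹
    simp only [id_eq, mul_one] at h
    rwa [mul_assoc, mul_inv_cancel₀ (neg_ne_zero.2 hzne), mul_one] at h
  have hdc : Continuous (deriv cutoff) := (cutoff.contDiff (n := 1)).continuous_deriv le_rfl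
  have hcc : Continuous cutoff := cutoff.continuous
  have key := intervalIntegral.integral_mul_deriv_eq_deriv_mul (a := 0) (b := 2 * A)
    (fun x _ => hu x) (fun x _ => hv x) (Continuous.intervalIntegrable (by fun_prop) _ _)
    (Continuous.intervalIntegrable (by fun_prop) _ _)
  have hP : polarPart l A s = ∫ x in (0:ℝ)..(2 * A), (cutoff (x / A) : ℂ) * (x : ℂ) ^ l *
      cexp (-z * x) := by
    rw [polarPart, intervalIntegral.integral_of_le (by linarith)]
    simp_rw [mul_assoc]
    rfl
  have hend : cutoff (2 * A / A) = 0 := by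
    rw [mul_div_assoc, div_self hA0.ne', mul_one]
    exact cutoff_eq_zero (by norm_num)
  -- The real part of `z = s - 1` is at least `-1/2` and `x ≤ 2 A`, whence `exp A`.
  have hexp : ∀ x ∈ Icc 0 (2 * A), ‖cexp (-z * x) * (-z)⁻¹‖ ≤ Real.exp A / |s.im| := by
    intro x hx
    rw [norm_mul, norm_exp_neg_mul_ofReal, norm_inv, norm_neg, ← div_eq_mul_inv]
    have hzre : -z.re ≤ 1 / 2 := by simp [hz]; linarith
    have : -z.re * x ≤ A := by nlinarith [hx.1, hx.2]
    gcongr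
  have h0 : ‖(cutoff (0 / A) : ℂ) * ((0 : ℝ) : ℂ) ^ l‖ ≤ 1 := by
    rw [norm_mul, norm_real, norm_pow, Real.norm_of_nonneg cutoff.nonneg]
    have h1 : ‖((0 : ℝ) : ℂ)‖ ^ l ≤ 1 := pow_le_one₀ (norm_nonneg _) (by simp)
    exact mul_le_one₀ cutoff.le_one (by positivity) h1
  have hu' : ∀ x ∈ Icc 0 (2 * A), ‖((deriv cutoff (x / A) / A : ℝ) * (x : ℂ) ^ l +
      cutoff (x / A) * (l * (x : ℂ) ^ (l - 1)) : ℂ)‖ ≤ (M + l) * (1 + 2 * A) ^ l := by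
    intro x hx
    have hxn : ‖(x : ℂ)‖ ≤ 1 + 2 * A := by
      rw [norm_real, Real.norm_of_nonneg hx.1]; linarith [hx.2]
    have hB : 1 ≤ 1 + 2 * A := by linarith
    rw [add_mul]
    refine (norm_add_le _ _).trans (add_le_add ?_ ?_)
    · rw [norm_mul, norm_real, norm_pow, Real.norm_eq_abs, abs_div, abs_of_pos hA0]
      have : |deriv cutoff (x / A)| / A ≤ M :=
        (div_le_self (abs_nonneg _) hA).trans (hM _)
      gcongr
    · rw [norm_mul, norm_mul, norm_real, Complex.norm_natCast, norm_pow, Real.norm_of_nonneg cutoff.nonneg]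
      have h1 : ‖(x : ℂ)‖ ^ (l - 1) ≤ (1 + 2 * A) ^ l :=
        (pow_le_pow_left₀ (norm_nonneg _) hxn _).trans (pow_le_pow_right₀ hB (Nat.sub_le _ _))
      calc cutoff (x / A) * (l * ‖(x : ℂ)‖ ^ (l - 1)) ≤ 1 * (l * (1 + 2 * A) ^ l) := by
            gcongr; exact cutoff.le_one
        _ = _ := one_mul _
  rw [hP, key, hend]
  have hint : ‖∫ x in (0:ℝ)..(2 * A), ((deriv cutoff (x / A) / A : ℝ) * (x : ℂ) ^ l +
      cutoff (x / A) * (l * (x : ℂ) ^ (l - 1)) : ℂ) * (cexp (-z * x) * (-z)⁻¹)‖ ≤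
      ((M + l) * (1 + 2 * A) ^ l * (Real.exp A / |s.im|)) * |2 * A - 0| := by
    refine intervalIntegral.norm_integral_le_of_norm_le_const fun x hx => ?_
    rw [uIoc_of_le (by linarith)] at hx
    have hx' := Ioc_subset_Icc_self hx
    rw [norm_mul]
    have h1 := hu' x hx'
    have h2 := hexp x hx'
    gcongr
  have hbd : ‖(cutoff (0 / A) : ℂ) * ((0 : ℝ) : ℂ) ^ l * (cexp (-z * (0 : ℝ)) * (-z)⁻¹)‖ ≤
      1 * (Real.exp A / |s.im|) := by
    rw [norm_mul]
    have := hexp 0 ⟨le_rfl, by linarith⟩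
    gcongr
  rw [sub_zero, abs_of_pos (show 0 < 2 * A by linarith)] at hint
  refine (norm_sub_le _ _).trans ?_
  simp only [ofReal_zero, zero_mul, zero_sub, norm_neg] at hbd hint ⊢
  refine (add_le_add hbd hint).trans ?_
  rw [mul_div_assoc, mul_div_assoc]
  set E := Real.exp A / |s.im|
  have hE : 0 ≤ E := by positivity
  have hB : 1 ≤ (1 + 2 * A) ^ (l + 1) := one_le_pow₀ (by linarith)
  have hBl : 0 ≤ (1 + 2 * A) ^ l := by positivity
  have h3 : (M + l) * (1 + 2 * A) ^ l * (2 * A) ≤ (M + l) * (1 + 2 * A) ^ (l + 1) := by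
    calc _ ≤ (M + l) * (1 + 2 * A) ^ l * (1 + 2 * A) :=
          mul_le_mul_of_nonneg_left (by linarith) (by positivity)
      _ = _ := by rw [pow_succ]; ring
  calc 1 * E + (M + l) * (1 + 2 * A) ^ l * E * (2 * A)
      = (1 + (M + l) * (1 + 2 * A) ^ l * (2 * A)) * E := by ring
    _ ≤ ((1 + 2 * A) ^ (l + 1) + (M + l) * (1 + 2 * A) ^ (l + 1)) * E := by gcongr
    _ = (1 + M + l) * ((1 + 2 * A) ^ (l + 1) * E) := by ring

lemma norm_iteratedDeriv_riemannZeta₀_le_of_zeta (l : ℕ) {s : ℂ} (hs : s.re ≠ 1) {V : ℝ}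
    (hV : ‖iteratedDeriv l riemannZeta s‖ ≤ V) :
    ‖iteratedDeriv l riemannZeta₀ s‖ ≤ V + l ! / |s.re - 1| ^ (l + 1) := by
  have hne : s ≠ 1 := by rintro rfl; simp at hs
  have h := iteratedDeriv_riemannZeta l hne
  have h2 : iteratedDeriv l riemannZeta₀ s =
      iteratedDeriv l riemannZeta s - (-1) ^ l * (l ! / (s - 1) ^ (l + 1)) := by rw [h]; ring
  rw [h2]
  refine (norm_sub_le _ _).trans (add_le_add hV ?_)
  rw [norm_mul]
  simpa using norm_pole_le l hs

/-- A bound on `ζ⁽ˡ⁾` on a segment of a vertical line in the critical strip bounds the smoothed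
Dirichlet polynomial inside it. -/
lemma exists_norm_smoothedSum_le (l m : ℕ) {σ : ℝ} (hσ : 1 / 2 ≤ σ) (hσ1 : σ < 1) :
    ∃ C, 0 ≤ C ∧ ∀ A : ℝ, 1 ≤ A → ∀ a b V δ t : ℝ, 0 ≤ V → 0 < δ → 0 < t →
      (∀ u ∈ Icc a b, ‖iteratedDeriv l riemannZeta (σ + u * I)‖ ≤ V) →
      a + δ ≤ t → t + δ ≤ b →
      ‖smoothedSum l A (σ + t * I)‖ ≤
        C * (V + 1 + (1 + t) / δ ^ m + (1 + 2 * A) ^ (l + 1) * Real.exp A / t) := by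
  obtain ⟨C₁, hC₁, hP⟩ := exists_norm_polarPart_le l
  obtain ⟨C₂, hC₂, hZ⟩ := exists_norm_iteratedDeriv_riemannZeta₀_le l
  set L : ℝ := l ! / |σ - 1| ^ (l + 1) with hL
  have hL0 : 0 ≤ L := by positivity
  set k : ℕ → ℝ := fun n => ∫ w : ℝ, ‖w‖ ^ n * ‖cutoffHat w‖ with hk
  have hk0 : ∀ n, 0 ≤ k n := fun n => integral_nonneg fun w => by positivity
  refine ⟨C₁ + (1 + L) * k 0 + C₂ * (2 * (2 * Real.pi) ^ m * k m + (2 * Real.pi) ^ (m + 1) * k (m + 1)),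
    by have := hk0 0; have := hk0 m; have := hk0 (m + 1); positivity,
    fun A hA a b V δ t hV hδ ht hbd hat htb => ?_⟩
  have hA0 : 0 < A := by linarith
  set c := 2 * Real.pi / A with hc
  have hc0 : 0 < c := by positivity
  have hc1 : c ≤ 2 * Real.pi := div_le_self (by positivity) hA
  set s : ℂ := σ + t * I with hs
  have hsre : s.re = σ := by simp [hs]
  have hsim : s.im = t := by simp [hs]
  have hsn : ‖s‖ ≤ 1 + t := by
    refine (norm_add_le _ _).trans ?_
    rw [norm_mul, norm_I, norm_real, norm_real, Real.norm_of_nonneg (by linarith),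
      Real.norm_of_nonneg ht.le]; linarith
  have hid := vertAvg_riemannZeta₀ l hA0 (s := s) (by rw [hsre]; linarith)
  have hpt : ∀ w : ℝ, ‖cutoffHat w * iteratedDeriv l riemannZeta₀ (s + (c * w : ℝ) * I)‖ ≤
      (V + L) * (‖w‖ ^ 0 * ‖cutoffHat w‖) + C₂ / δ ^ m * (2 + t) * c ^ m * (‖w‖ ^ m * ‖cutoffHat w‖)
        + C₂ / δ ^ m * c ^ (m + 1) * (‖w‖ ^ (m + 1) * ‖cutoffHat w‖) := by
    intro w
    have hre : (s + (c * w : ℝ) * I).re = σ := by rw [← hsre]; simp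
    rw [norm_mul]
    -- Inside the segment the hypothesis applies. Outside, `c * ‖w‖ ≥ δ`, so the factor `(c * ‖w‖ /
    -- δ) ^ m ≥ 1` may be inserted, and the finite moments of the kernel absorb it.
    by_cases hin : t + c * w ∈ Icc a b
    · have h1 := norm_iteratedDeriv_riemannZeta₀_le_of_zeta l (s := s + (c * w : ℝ) * I)
        (by rw [hre]; exact hσ1.ne) (V := V) (by
          have := hbd _ hin
          convert this using 3
          simp [hs]; ring)
      rw [hre] at h1
      have h2 : ‖cutoffHat w‖ * ‖iteratedDeriv l riemannZeta₀ (s + (c * w : ℝ) * I)‖ ≤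
        (V + L) * (‖w‖ ^ 0 * ‖cutoffHat w‖) := by
        rw [pow_zero, one_mul, mul_comm]; gcongr
      have h3 : 0 ≤ C₂ / δ ^ m * (2 + t) * c ^ m * (‖w‖ ^ m * ‖cutoffHat w‖) := by positivity
      have h4 : 0 ≤ C₂ / δ ^ m * c ^ (m + 1) * (‖w‖ ^ (m + 1) * ‖cutoffHat w‖) := by positivity
      linarith
    · have hfar : δ ≤ c * ‖w‖ := by
        rw [Real.norm_eq_abs, ← abs_of_pos hc0, ← abs_mul]
        by_contra hlt
        have := abs_lt.1 (not_le.1 hlt)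
        exact hin ⟨by linarith, by linarith⟩
      have h1 := hZ (s + (c * w : ℝ) * I) (by rw [hre]; linarith)
      have h2 := norm_add_mul_I_le s c w
      rw [abs_of_pos hc0, ← Real.norm_eq_abs w] at h2
      have h5 : 1 ≤ (c * ‖w‖) ^ m / δ ^ m := by
        rw [le_div_iff₀ (by positivity), one_mul]; gcongr
      have h6 : ‖iteratedDeriv l riemannZeta₀ (s + (c * w : ℝ) * I)‖ ≤
          C₂ * (2 + t + c * ‖w‖) * ((c * ‖w‖) ^ m / δ ^ m) := by
        refine (h1.trans ?_).trans (le_mul_of_one_le_right (by positivity) h5)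
        exact mul_le_mul_of_nonneg_left (by linarith) hC₂
      have h7 : 0 ≤ (V + L) * (‖w‖ ^ 0 * ‖cutoffHat w‖) := by positivity
      calc _ ≤ ‖cutoffHat w‖ * (C₂ * (2 + t + c * ‖w‖) * ((c * ‖w‖) ^ m / δ ^ m)) := by gcongr
        _ = C₂ / δ ^ m * (2 + t) * c ^ m * (‖w‖ ^ m * ‖cutoffHat w‖)
        + C₂ / δ ^ m * c ^ (m + 1) * (‖w‖ ^ (m + 1) * ‖cutoffHat w‖) := by
            rw [mul_pow, pow_succ, pow_succ]; ring
        _ ≤ _ := by linarith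
  have hi := fun n => cutoffHat.integrable_pow_mul volume n
  have hint : ‖vertAvg (iteratedDeriv l riemannZeta₀) c s‖ ≤
      (V + L) * k 0 + C₂ / δ ^ m * (2 + t) * c ^ m * k m + C₂ / δ ^ m * c ^ (m + 1) * k (m + 1) := by
    refine (norm_integral_le_of_norm_le ((((hi 0).const_mul _).add ((hi m).const_mul _)).add
      ((hi (m + 1)).const_mul _)) (ae_of_all _ hpt)).trans (le_of_eq ?_)
    rw [integral_add' (((hi 0).const_mul _).add ((hi m).const_mul _)) ((hi (m + 1)).const_mul _),
      integral_add' ((hi 0).const_mul _) ((hi m).const_mul _), integral_const_mul,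
      integral_const_mul, integral_const_mul]
  have hPs := hP A hA s (by rw [hsre]; linarith) (by rw [hsim]; exact ht.ne')
  rw [hsim, abs_of_pos ht] at hPs
  have hsm : smoothedSum l A s = (-1) ^ l * vertAvg (iteratedDeriv l riemannZeta₀) c s +
    polarPart l A s := by rw [hid]; ring
  rw [hsm]
  have hn : ‖(-1 : ℂ) ^ l * vertAvg (iteratedDeriv l riemannZeta₀) c s‖ =
    ‖vertAvg (iteratedDeriv l riemannZeta₀) c s‖ := by simp
  refine (norm_add_le _ _).trans ?_
  rw [hn]
  refine (add_le_add hint hPs).trans ?_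
  have hcm : ∀ n : ℕ, c ^ n ≤ (2 * Real.pi) ^ n := fun n => pow_le_pow_left₀ hc0.le hc1 n
  set X := (1 + t) / δ ^ m with hX
  have hX0 : 0 ≤ X := by positivity
  set Y := (1 + 2 * A) ^ (l + 1) * Real.exp A / t with hY
  have hY0 : 0 ≤ Y := by positivity
  have e1 : C₂ / δ ^ m * (2 + t) * c ^ m * k m ≤ C₂ * (2 * (2 * Real.pi) ^ m * k m) * X := by
    have : C₂ / δ ^ m * (2 + t) * c ^ m * k m ≤
        C₂ / δ ^ m * (2 * (1 + t)) * (2 * Real.pi) ^ m * k m := by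
      have := hk0 m
      gcongr
      · linarith
    refine this.trans (le_of_eq ?_)
    rw [hX]; ring
  have e2 : C₂ / δ ^ m * c ^ (m + 1) * k (m + 1) ≤
      C₂ * ((2 * Real.pi) ^ (m + 1) * k (m + 1)) * X := by
    have : C₂ / δ ^ m * c ^ (m + 1) * k (m + 1) ≤
        C₂ / δ ^ m * (2 * Real.pi) ^ (m + 1) * k (m + 1) * (1 + t) := by
      have := hk0 (m + 1)
      refine le_trans ?_ (le_mul_of_one_le_right (by positivity) (by linarith))
      gcongr
    refine this.trans (le_of_eq ?_)
    rw [hX]; ring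
  have e3 : (V + L) * k 0 ≤ (1 + L) * k 0 * (V + 1) := by
    have : V + L ≤ (1 + L) * (V + 1) := by nlinarith
    have := hk0 0
    calc _ ≤ ((1 + L) * (V + 1)) * k 0 := by gcongr
      _ = _ := by ring
  have e4 : C₁ * ((1 + 2 * A) ^ (l + 1) * Real.exp A) / t = C₁ * Y := by rw [hY]; ring
  rw [e4]
  have k0 := hk0 0
  have km := hk0 m
  have km1 := hk0 (m + 1)
  set a1 := (1 + L) * k 0
  set a2 := C₂ * (2 * (2 * Real.pi) ^ m * k m)
  set a3 := C₂ * ((2 * Real.pi) ^ (m + 1) * k (m + 1))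
  have p1 : 0 ≤ a1 := by positivity
  have p2 : 0 ≤ a2 := by positivity
  have p3 : 0 ≤ a3 := by positivity
  have : (C₁ + a1 + (C₂ * (2 * (2 * Real.pi) ^ m * k m + (2 * Real.pi) ^ (m + 1) * k (m + 1))))
    = C₁ + a1 + a2 + a3 := by ring
  rw [this]
  have q : ∀ x y : ℝ, 0 ≤ x → 0 ≤ y → 0 ≤ x * y := fun x y => mul_nonneg
  have expand : (C₁ + a1 + a2 + a3) * (V + 1 + X + Y) = C₁ * (V + 1) + C₁ * X + C₁ * Y +
    a1 * (V + 1) + a1 * X + a1 * Y + a2 * (V + 1) + a2 * X + a2 * Y + a3 * (V + 1) + a3 * X +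
    a3 * Y := by ring
  rw [expand]
  linarith [q C₁ (V+1) hC₁ (by linarith), q C₁ X hC₁ hX0, q a1 X p1 hX0, q a1 Y p1 hY0,
    q a2 (V+1) p2 (by linarith), q a2 Y p2 hY0, q a3 (V+1) p3 (by linarith), q a3 Y p3 hY0]

-- Three choices make the errors bounded: `A = (log T) ^ (3/4)` keeps the polar part below `T ^ β₂`;
-- `m > 1 / β₂` makes the kernel's tail `(1 + t) / T ^ (β₂ m)` harmless; and `β₁ < β₂` leaves a
-- margin `T ^ β₂ / 2` around each `t`.
open Asymptotics in
lemma exists_norm_smoothedSum_le_eventually (l : ℕ) {σ β₁ β₂ : ℝ} (hσ : 1 / 2 ≤ σ) (hσ1 : σ < 1)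
    (hβ : β₁ < β₂) (hβ0 : 0 < β₂) :
    ∃ C, 0 ≤ C ∧ ∀ᶠ T : ℝ in atTop, ∀ V : ℝ, 0 ≤ V →
      (∀ u ∈ Icc (T ^ β₁) T, ‖iteratedDeriv l riemannZeta (σ + u * I)‖ ≤ V) →
      ∀ t ∈ Icc (T ^ β₂) (T / 2),
        ‖smoothedSum l (Real.log T ^ (3 / 4 : ℝ)) (σ + t * I)‖ ≤ C * (V + 1) := by
  obtain ⟨m, hm⟩ := exists_nat_gt (1 / β₂)
  obtain ⟨C, hC, h⟩ := exists_norm_smoothedSum_le l m hσ hσ1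
  refine ⟨C * (2 + 2 ^ m * 2), by positivity, ?_⟩
  have hA1 : Tendsto (fun T => Real.log T ^ (3 / 4 : ℝ)) atTop atTop :=
    (tendsto_rpow_atTop (by norm_num)).comp Real.tendsto_log_atTop
  have hA2 : Tendsto (fun T => Real.log T ^ (1 / 4 : ℝ)) atTop atTop :=
    (tendsto_rpow_atTop (by norm_num)).comp Real.tendsto_log_atTop
  have hpow : Tendsto (fun T : ℝ => T ^ (β₂ - β₁)) atTop atTop := tendsto_rpow_atTop (by linarith)
  filter_upwards [hA1.eventually_ge_atTop 1, hA2.eventually_ge_atTop ((2 * (l + 1) + 1) / β₂),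
    hpow.eventually_ge_atTop 2, eventually_ge_atTop 1] with T hT1 hT2 hT3 hT4 V hV hb t ht
  have hT0 : 0 < T := by linarith
  set A := Real.log T ^ (3 / 4 : ℝ)
  have hlog : 0 < Real.log T := by
    rcases (Real.log_nonneg hT4).lt_or_eq with h | h
    · exact h
    · exfalso; simp only [A, ← h] at hT1
      rw [Real.zero_rpow (by norm_num)] at hT1; linarith
  have hsplit : T ^ β₂ = T ^ β₁ * T ^ (β₂ - β₁) := by rw [← Real.rpow_add hT0]; congr 1; ring
  have hTb : T ^ β₁ ≤ T ^ β₂ / 2 := by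
    rw [hsplit]; nlinarith [Real.rpow_pos_of_pos hT0 β₁]
  have hTp : 0 < T ^ β₂ := Real.rpow_pos_of_pos hT0 _
  have htpos : 0 < t := hTp.trans_le ht.1
  have key := h A hT1 (T ^ β₁) T V (T ^ β₂ / 2) t hV (by positivity) htpos hb
    (by linarith [ht.1]) (by linarith [ht.1, ht.2])
  refine key.trans ?_
  have h1 : (1 + t) / (T ^ β₂ / 2) ^ m ≤ 2 ^ m * 2 := by
    rw [div_pow, div_div_eq_mul_div, div_le_iff₀ (by positivity), ← Real.rpow_mul_natCast hT0.le]
    have : T ≤ T ^ (β₂ * m) := by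
      conv_lhs => rw [← Real.rpow_one T]
      apply Real.rpow_le_rpow_of_exponent_le hT4
      have := (div_lt_iff₀ hβ0).1 hm
      linarith [mul_comm β₂ (m : ℝ)]
    calc (1 + t) * 2 ^ m ≤ (2 * T ^ (β₂ * m)) * 2 ^ m := by gcongr; linarith [ht.2]
      _ = _ := by ring
  have h2 : (1 + 2 * A) ^ (l + 1) * Real.exp A / t ≤ 1 := by
    rw [div_le_one htpos]
    refine le_trans ?_ ht.1
    have e1 : 1 + 2 * A ≤ Real.exp (2 * A) := by linarith [Real.add_one_le_exp (2 * A)]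
    have e2 : (1 + 2 * A) ^ (l + 1) ≤ Real.exp ((l + 1) * (2 * A)) := by
      have := pow_le_pow_left₀ (by linarith) e1 (l + 1)
      rwa [← Real.exp_nat_mul, Nat.cast_add_one] at this
    have e3 : Real.log T = A * Real.log T ^ (1 / 4 : ℝ) := by
      rw [← Real.rpow_add hlog]; norm_num
    calc _ ≤ Real.exp ((l + 1) * (2 * A)) * Real.exp A := by gcongr
      _ = Real.exp (A * (2 * (l + 1) + 1)) := by rw [← Real.exp_add]; ring_nf
      _ ≤ Real.exp (Real.log T * β₂) := by
        apply Real.exp_le_exp.2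
        rw [e3, mul_assoc]
        exact mul_le_mul_of_nonneg_left ((div_le_iff₀ hβ0).1 hT2) (by linarith)
      _ = T ^ β₂ := by rw [Real.rpow_def_of_pos hT0]
  have h3 : V + 1 + (1 + t) / (T ^ β₂ / 2) ^ m + (1 + 2 * A) ^ (l + 1) * Real.exp A / t ≤
      (2 + 2 ^ m * 2) * (V + 1) := by
    have : 0 ≤ (2:ℝ) ^ m * 2 * V := by positivity
    linarith
  calc _ ≤ C * ((2 + 2 ^ m * 2) * (V + 1)) := mul_le_mul_of_nonneg_left h3 hC
    _ = _ := by ring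

end

/-! ### The resonance inequality with Gaussian weight and rounded frequencies. -/

section

open Complex Set MeasureTheory

lemma integrable_cexp_mul_gaussian (y : ℝ) :
    Integrable fun v : ℝ => cexp (y * v * I) * cexp (-(v : ℂ) ^ 2 / 2) := by
  have h := (integrable_exp_neg_mul_sq (b := 1 / 2) (by norm_num)).ofReal (𝕜 := ℂ)
  refine h.norm.mono' (Continuous.aestronglyMeasurable (by fun_prop)) (ae_of_all _ fun v => ?_)
  rw [norm_mul, show (y * v * I : ℂ) = ((y * v : ℝ) : ℂ) * I by push_cast; ring,
    norm_exp_ofReal_mul_I, one_mul]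
  apply le_of_eq
  congr 1
  simp only [coe_algebraMap, ofReal_exp]
  congr 1
  push_cast; ring

lemma integral_cexp_mul_gaussian (y : ℝ) :
    ∫ v : ℝ, cexp (y * v * I) * cexp (-(v : ℂ) ^ 2 / 2) =
      ((Real.sqrt (2 * Real.pi) * Real.exp (-y ^ 2 / 2) : ℝ) : ℂ) := by
  have h := fourierIntegral_gaussian (b := 1 / 2) (by simp) (y : ℂ)
  have e : ∀ v : ℝ, cexp (y * v * I) * cexp (-(v : ℂ) ^ 2 / 2) =
      cexp (I * y * v) * cexp (-(1 / 2) * (v : ℂ) ^ 2) := by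
    intro v; congr 2 <;> ring
  simp_rw [e]
  rw [h, ofReal_mul, Real.sqrt_eq_rpow, ofReal_cpow (by positivity)]
  congr 1
  · congr 1 <;> push_cast <;> ring
  · push_cast; congr 1; ring

lemma integral_sum_cexp_mul_gaussian {ι : Type*} (s : Finset ι) (c y : ι → ℝ) :
    ∫ v : ℝ, (∑ i ∈ s, (c i : ℂ) * cexp (y i * v * I)) * cexp (-(v : ℂ) ^ 2 / 2) =
      ((Real.sqrt (2 * Real.pi) * ∑ i ∈ s, c i * Real.exp (-y i ^ 2 / 2) : ℝ) : ℂ) := by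
  have e : ∀ v : ℝ, (∑ i ∈ s, (c i : ℂ) * cexp (y i * v * I)) * cexp (-(v : ℂ) ^ 2 / 2) =
      ∑ i ∈ s, (c i : ℂ) * (cexp (y i * v * I) * cexp (-(v : ℂ) ^ 2 / 2)) := by
    intro v
    rw [Finset.sum_mul]
    exact Finset.sum_congr rfl fun i _ => by ring
  simp_rw [e]
  rw [integral_finsetSum _ fun i _ => (integrable_cexp_mul_gaussian (y i)).const_mul (c i : ℂ)]
  simp_rw [integral_const_mul, integral_cexp_mul_gaussian]
  push_cast
  rw [Finset.mul_sum]
  exact Finset.sum_congr rfl fun i _ => by ring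

lemma summable_exp_neg_int_sq : Summable fun n : ℤ => Real.exp (-(n : ℝ) ^ 2 / 2) := by
  have h : Summable fun n : ℕ => Real.exp (-(n : ℝ) ^ 2 / 2) := by
    refine Summable.of_nonneg_of_le (fun n => (Real.exp_pos _).le) (fun n => ?_)
      (Real.summable_exp_neg_nat.mul_left (Real.exp (1 / 2)))
    rw [← Real.exp_add]
    exact Real.exp_le_exp.2 (by nlinarith [sq_nonneg ((n : ℝ) - 1)])
  exact Summable.of_nat_of_neg (by simpa using h) (by simpa using h)

/-- Schur's test: split `r m * r n` by the arithmetic–geometric mean inequality and bound each row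
sum of the Gaussian matrix by the full theta-type series. -/
lemma sum_gaussian_mul_le (J : Finset ℤ) (r : ℤ → ℝ) :
    ∑ p ∈ J ×ˢ J, r p.1 * r p.2 * Real.exp (-((p.2 : ℝ) - p.1) ^ 2 / 2) ≤
      (∑' n : ℤ, Real.exp (-(n : ℝ) ^ 2 / 2)) * ∑ n ∈ J, r n ^ 2 := by
  set C := ∑' n : ℤ, Real.exp (-(n : ℝ) ^ 2 / 2)
  have hrow : ∀ m : ℤ, ∑ n ∈ J, Real.exp (-((n : ℝ) - m) ^ 2 / 2) ≤ C := by
    intro m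
    have hs : Summable fun n : ℤ => Real.exp (-((n : ℝ) - m) ^ 2 / 2) := by
      have := (Equiv.subRight m).summable_iff.2 summable_exp_neg_int_sq
      simpa [Function.comp_def] using this
    have e : ∑' n : ℤ, Real.exp (-((n : ℝ) - m) ^ 2 / 2) = C := by
      have := (Equiv.subRight m).tsum_eq fun n : ℤ => Real.exp (-(n : ℝ) ^ 2 / 2)
      simpa using this
    rw [← e]
    exact hs.sum_le_tsum J fun n _ => (Real.exp_pos _).le
  have h1 : ∀ p ∈ J ×ˢ J, r p.1 * r p.2 * Real.exp (-((p.2 : ℝ) - p.1) ^ 2 / 2) ≤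
      r p.1 ^ 2 / 2 * Real.exp (-((p.2 : ℝ) - p.1) ^ 2 / 2) +
      r p.2 ^ 2 / 2 * Real.exp (-((p.1 : ℝ) - p.2) ^ 2 / 2) := by
    intro p _
    rw [← neg_sub (p.2 : ℝ) p.1, neg_sq (_ - _), ← add_mul]
    have : r p.1 * r p.2 ≤ r p.1 ^ 2 / 2 + r p.2 ^ 2 / 2 := by nlinarith [sq_nonneg (r p.1 - r p.2)]
    gcongr
  refine (Finset.sum_le_sum h1).trans ?_
  rw [Finset.sum_add_distrib, Finset.sum_product, Finset.sum_product_right]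
  simp_rw [← Finset.mul_sum]
  have h2 : ∑ m ∈ J, r m ^ 2 / 2 * ∑ n ∈ J, Real.exp (-((n : ℝ) - m) ^ 2 / 2) ≤
      ∑ m ∈ J, r m ^ 2 / 2 * C := by gcongr with m _; exact hrow m
  refine (add_le_add h2 h2).trans (le_of_eq ?_)
  rw [← Finset.sum_mul, ← Finset.sum_div]; ring

section

variable {ι ε : Type*} (M : Finset ι) (E : Finset ε) (src tgt : ε → ι) (lam f : ι → ℝ)

/-- The `ℓ²` mass of `f` on the points of `M` whose frequency rounds to `n / τ`. -/
noncomputable def binMass (τ : ℝ) (n : ℤ) : ℝ :=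
  Real.sqrt (∑ i ∈ M with ⌊τ * lam i⌋ = n, f i ^ 2)

variable {M E src tgt lam f}

lemma sum_binMass_sq (τ : ℝ) :
    ∑ n ∈ M.image (fun i => ⌊τ * lam i⌋), binMass M lam f τ n ^ 2 = ∑ i ∈ M, f i ^ 2 := by
  have : ∀ n, binMass M lam f τ n ^ 2 = ∑ i ∈ M with ⌊τ * lam i⌋ = n, f i ^ 2 := fun n => by
    rw [binMass, Real.sq_sqrt]
    exact Finset.sum_nonneg fun i _ => sq_nonneg (f i)
  simp_rw [this]
  exact Finset.sum_fiberwise_of_maps_to (fun i hi => Finset.mem_image_of_mem _ hi) _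

lemma sqrt_sum_sq_le_binMass (τ : ℝ) (n : ℤ) (E : Finset ε) (g : ε → ι)
    (hg : ∀ e ∈ E, g e ∈ M ∧ ⌊τ * lam (g e)⌋ = n) (hinj : ∀ e ∈ E, ∀ e' ∈ E, g e = g e' → e = e') :
    Real.sqrt (∑ e ∈ E, f (g e) ^ 2) ≤ binMass M lam f τ n := by
  classical
  refine Real.sqrt_le_sqrt ?_
  rw [← Finset.sum_image (f := fun i => f i ^ 2) (s := E) (g := g) fun e he e' he' h =>
    hinj e he e' he' h]
  refine Finset.sum_le_sum_of_subset_of_nonneg (fun i hi => ?_) fun i _ _ => sq_nonneg _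
  obtain ⟨e, he, rfl⟩ := Finset.mem_image.1 hi
  exact Finset.mem_filter.2 (hg e he)

/-- For a fixed pair of bins, Cauchy–Schwarz and the injectivity of `src` and `tgt` bound the edges
by the product of the two `ℓ²` masses. Rounding changes a frequency difference by at most one unit,
so the Gaussian is at least `exp (-1/2)` whenever the pair of bins carries an edge. -/
lemma sum_edges_le_gaussian (hf : ∀ i, 0 ≤ f i) {τ x : ℝ} (E : Finset ε)
    (hsrc : ∀ e ∈ E, src e ∈ M) (htgt : ∀ e ∈ E, tgt e ∈ M)
    (hlam : ∀ e ∈ E, lam (tgt e) = lam (src e) + x)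
    (hinj : ∀ e ∈ E, ∀ e' ∈ E, src e = src e' → e = e')
    (hinj' : ∀ e ∈ E, ∀ e' ∈ E, tgt e = tgt e' → e = e') :
    Real.exp (-1 / 2) * ∑ e ∈ E, f (src e) * f (tgt e) ≤
      ∑ p ∈ M.image (fun i => ⌊τ * lam i⌋) ×ˢ M.image (fun i => ⌊τ * lam i⌋),
        binMass M lam f τ p.1 * binMass M lam f τ p.2 *
          Real.exp (-((p.2 : ℝ) - p.1 - τ * x) ^ 2 / 2) := by
  classical
  have hmaps : ∀ e ∈ E, ((⌊τ * lam (src e)⌋, ⌊τ * lam (tgt e)⌋) : ℤ × ℤ) ∈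
      M.image (fun i => ⌊τ * lam i⌋) ×ˢ M.image (fun i => ⌊τ * lam i⌋) := fun e he =>
    Finset.mem_product.2 ⟨Finset.mem_image_of_mem _ (hsrc e he),
      Finset.mem_image_of_mem _ (htgt e he)⟩
  rw [← Finset.sum_fiberwise_of_maps_to hmaps, Finset.mul_sum]
  refine Finset.sum_le_sum fun p _ => ?_
  set E' := E.filter fun e => ((⌊τ * lam (src e)⌋, ⌊τ * lam (tgt e)⌋) : ℤ × ℤ) = p with hE'
  have hr : ∀ n, 0 ≤ binMass M lam f τ n := fun n => Real.sqrt_nonneg _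
  rcases E'.eq_empty_or_nonempty with h | ⟨e, he⟩
  · rw [h]
    simp only [Finset.sum_empty, mul_zero]
    have := hr p.1
    have := hr p.2
    positivity
  · have hmem : ∀ e ∈ E', e ∈ E ∧ ⌊τ * lam (src e)⌋ = p.1 ∧ ⌊τ * lam (tgt e)⌋ = p.2 := by
      intro e he
      obtain ⟨h1, h2⟩ := Finset.mem_filter.1 he
      exact ⟨h1, congrArg Prod.fst h2, congrArg Prod.snd h2⟩
    have hcs : ∑ e ∈ E', f (src e) * f (tgt e) ≤ binMass M lam f τ p.1 * binMass M lam f τ p.2 := by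
      refine (Real.sum_mul_le_sqrt_mul_sqrt _ _ _).trans (mul_le_mul ?_ ?_ (Real.sqrt_nonneg _)
        (hr _))
      · exact sqrt_sum_sq_le_binMass τ p.1 E' src
          (fun e he => ⟨hsrc e (hmem e he).1, (hmem e he).2.1⟩)
          fun e he e' he' => hinj e (hmem e he).1 e' (hmem e' he').1
      · exact sqrt_sum_sq_le_binMass τ p.2 E' tgt
          (fun e he => ⟨htgt e (hmem e he).1, (hmem e he).2.2⟩)
          fun e he e' he' => hinj' e (hmem e he).1 e' (hmem e' he').1
    have hexp : Real.exp (-1 / 2) ≤ Real.exp (-((p.2 : ℝ) - p.1 - τ * x) ^ 2 / 2) := by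
      apply Real.exp_le_exp.2
      obtain ⟨h1, h2, h3⟩ := hmem e he
      have hl := hlam e h1
      have a1 := Int.floor_le (τ * lam (src e))
      have a2 := Int.lt_floor_add_one (τ * lam (src e))
      have b1 := Int.floor_le (τ * lam (tgt e))
      have b2 := Int.lt_floor_add_one (τ * lam (tgt e))
      rw [h2] at a1 a2
      rw [h3] at b1 b2
      rw [hl, mul_add] at b1 b2
      have : ((p.2 : ℝ) - p.1 - τ * x) ^ 2 ≤ 1 := by
        rw [sq_le_one_iff_abs_le_one, abs_le]
        constructor <;> linarith
      linarith
    have h0 : 0 ≤ ∑ e ∈ E', f (src e) * f (tgt e) :=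
      Finset.sum_nonneg fun e _ => mul_nonneg (hf _) (hf _)
    calc Real.exp (-1 / 2) * ∑ e ∈ E', f (src e) * f (tgt e)
        ≤ Real.exp (-((p.2 : ℝ) - p.1 - τ * x) ^ 2 / 2) *
          (binMass M lam f τ p.1 * binMass M lam f τ p.2) := by gcongr
      _ = _ := mul_comm _ _

end

set_option maxHeartbeats 1000000 in
/-- The resonance inequality: if the Dirichlet polynomial with nonnegative coefficients `d` and
frequencies `x` is bounded by `V` on `[a, b]`, then so is, up to error terms and an absolute
constant, the quadratic form attached to a graph whose edges raise frequencies by some `x k`. -/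
theorem exists_resonance_inequality : ∃ C : ℝ, 0 < C ∧ ∀ {ι ε : Type} (M : Finset ι) (E : Finset ε)
    (src tgt : ε → ι) (kap : ε → ℕ) (lam f : ι → ℝ) (x d : ℕ → ℝ) (S : Finset ℕ)
    (_ : ∀ i, 0 ≤ f i) (_ : ∀ k, 0 ≤ d k) (_ : ∀ e ∈ E, src e ∈ M) (_ : ∀ e ∈ E, tgt e ∈ M)
    (_ : ∀ e ∈ E, kap e ∈ S) (_ : ∀ e ∈ E, lam (tgt e) = lam (src e) + x (kap e))
    (_ : ∀ e ∈ E, ∀ e' ∈ E, kap e = kap e' → src e = src e' → e = e')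
    (_ : ∀ e ∈ E, ∀ e' ∈ E, kap e = kap e' → tgt e = tgt e' → e = e')
    (τ a b V : ℝ) (_ : 0 < τ) (_ : 0 ≤ a) (_ : 0 ≤ b) (_ : 0 ≤ V)
    (_ : ∀ t ∈ Icc a b, ‖∑ k ∈ S, (d k : ℂ) * cexp (-(t * x k : ℝ) * I)‖ ≤ V),
    ∑ e ∈ E, d (kap e) * (f (src e) * f (tgt e)) ≤
      C * (V + (∑ k ∈ S, d k) * M.card * (a / τ + Real.exp (-(b / τ) ^ 2 / 4))) *
        ∑ i ∈ M, f i ^ 2 := by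
  set C₀ := ∑' n : ℤ, Real.exp (-(n : ℝ) ^ 2 / 2)
  have hC₀ : 0 ≤ C₀ := tsum_nonneg fun n => (Real.exp_pos _).le
  have hs4 : 0 ≤ Real.sqrt (4 * Real.pi) := Real.sqrt_nonneg _
  refine ⟨Real.exp (1 / 2) * (C₀ + 2 + Real.sqrt (4 * Real.pi)), by positivity, ?_⟩
  intro ι ε M E src tgt kap lam f x d S hf hd hsrc htgt hkap hlam hinj hinj' τ a b V hτ ha hb hV hbd
  classical
  set J := M.image fun i => ⌊τ * lam i⌋ with hJ
  set r := binMass M lam f τ with hr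
  have hr0 : ∀ n, 0 ≤ r n := fun n => Real.sqrt_nonneg _
  set F := ∑ i ∈ M, f i ^ 2 with hF
  have hF0 : 0 ≤ F := Finset.sum_nonneg fun i _ => sq_nonneg _
  have hrF : ∑ n ∈ J, r n ^ 2 = F := sum_binMass_sq τ
  set D0 := ∑ k ∈ S, d k with hD0
  have hD00 : 0 ≤ D0 := Finset.sum_nonneg fun k _ => hd k
  set D : ℝ → ℂ := fun t => ∑ k ∈ S, (d k : ℂ) * cexp (-(t * x k : ℝ) * I) with hD
  -- The resonator has integer frequencies after rounding; frequencies that nearly coincide merge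
  -- into one coefficient `r n`.
  set Q : ℝ → ℂ := fun v => ∑ n ∈ J, (r n : ℂ) * cexp ((n : ℝ) * v * I) with hQ
  have hDn : ∀ t, ‖D t‖ ≤ D0 := by
    intro t
    refine (norm_sum_le _ _).trans (Finset.sum_le_sum fun k _ => ?_)
    rw [norm_mul, norm_real, Real.norm_of_nonneg (hd k), ← ofReal_neg, norm_exp_ofReal_mul_I,
      mul_one]
  -- The coefficients are real, so the bound on `[a, b]` also holds on `[-b, -a]`.
  have hDneg : ∀ t, ‖D (-t)‖ = ‖D t‖ := by
    intro t
    have : D (-t) = (starRingEnd ℂ) (D t) := by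
      simp only [hD, map_sum, map_mul, conj_ofReal, ← exp_conj, map_neg, conj_I]
      refine Finset.sum_congr rfl fun k _ => ?_
      congr 2; push_cast; ring
    rw [this, norm_conj]
  have hQn : ∀ v, ‖Q v‖ ^ 2 ≤ M.card * F := by
    intro v
    have h1 : ‖Q v‖ ≤ ∑ n ∈ J, r n := by
      refine (norm_sum_le _ _).trans (Finset.sum_le_sum fun n _ => ?_)
      rw [norm_mul, norm_real, Real.norm_of_nonneg (hr0 n), ← ofReal_mul, norm_exp_ofReal_mul_I,
        mul_one]
    calc ‖Q v‖ ^ 2 ≤ (∑ n ∈ J, r n) ^ 2 := by gcongr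
      _ ≤ J.card * ∑ n ∈ J, r n ^ 2 := sq_sum_le_card_mul_sum_sq
      _ ≤ M.card * F := by
        rw [hrF]; gcongr; exact Finset.card_image_le
  have hQsq : ∀ v, ((‖Q v‖ ^ 2 : ℝ) : ℂ) =
      ∑ p ∈ J ×ˢ J, ((r p.1 * r p.2 : ℝ) : ℂ) * cexp (((p.2 : ℝ) - p.1 : ℝ) * v * I) := by
    intro v
    have : ((‖Q v‖ ^ 2 : ℝ) : ℂ) = (starRingEnd ℂ) (Q v) * Q v := by
      rw [mul_comm, mul_conj, normSq_eq_norm_sq]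
    rw [this]
    simp only [hQ, map_sum, map_mul, conj_ofReal, ← exp_conj, conj_I]
    rw [Finset.sum_mul_sum, ← Finset.sum_product']
    refine Finset.sum_congr rfl fun p _ => ?_
    push_cast
    rw [mul_mul_mul_comm, ← Complex.exp_add]
    congr 2; ring
  have hQint := integral_sum_cexp_mul_gaussian (J ×ˢ J) (fun p => r p.1 * r p.2)
    (fun p => (p.2 : ℝ) - p.1)
  -- Each Gaussian integral here is positive, so this triple sum has nonnegative terms and can be
  -- bounded below by those that come from edges.
  have hmain := integral_sum_cexp_mul_gaussian (S ×ˢ (J ×ˢ J))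
    (fun q => d q.1 * (r q.2.1 * r q.2.2)) (fun q => (q.2.2 : ℝ) - q.2.1 - τ * x q.1)
  set g : ℝ → ℝ := fun v => Real.exp (-v ^ 2 / 2) with hg
  have hgc : ∀ v : ℝ, cexp (-(v : ℂ) ^ 2 / 2) = (g v : ℂ) := by
    intro v; simp only [hg]; push_cast; rfl
  have hQintR : ∫ v, ‖Q v‖ ^ 2 * g v = Real.sqrt (2 * Real.pi) *
      ∑ p ∈ J ×ˢ J, r p.1 * r p.2 * Real.exp (-((p.2 : ℝ) - p.1) ^ 2 / 2) := by
    have h1 : ∀ v : ℝ, (∑ p ∈ J ×ˢ J, ((r p.1 * r p.2 : ℝ) : ℂ) *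
        cexp (((p.2 : ℝ) - p.1 : ℝ) * v * I)) * cexp (-(v : ℂ) ^ 2 / 2) =
        ((‖Q v‖ ^ 2 * g v : ℝ) : ℂ) := by
      intro v; rw [← hQsq, hgc, ← ofReal_mul]
    simp_rw [h1] at hQint
    rw [integral_complex_ofReal] at hQint
    exact_mod_cast hQint
  have hDQ : ∀ v : ℝ, (∑ q ∈ S ×ˢ (J ×ˢ J), ((d q.1 * (r q.2.1 * r q.2.2) : ℝ) : ℂ) *
      cexp (((q.2.2 : ℝ) - q.2.1 - τ * x q.1 : ℝ) * v * I)) * cexp (-(v : ℂ) ^ 2 / 2) =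
      D (τ * v) * ((‖Q v‖ ^ 2 * g v : ℝ) : ℂ) := by
    intro v
    rw [ofReal_mul, hQsq, hgc, ← mul_assoc]
    congr 1
    rw [hD, Finset.sum_mul_sum, ← Finset.sum_product']
    refine Finset.sum_congr rfl fun q _ => ?_
    rw [mul_mul_mul_comm, ← Complex.exp_add]
    push_cast
    congr 2; ring
  simp_rw [hDQ] at hmain
  have hDc : Continuous D := by simp only [hD]; fun_prop
  have hQc : Continuous Q := by simp only [hQ]; fun_prop
  have hgint : Integrable g := by
    have := integrable_exp_neg_mul_sq (b := 1 / 2) (by norm_num)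
    refine this.congr (ae_of_all _ fun v => ?_)
    simp only [hg]; congr 1; ring
  have hg4int : Integrable fun v : ℝ => Real.exp (-v ^ 2 / 4) := by
    have := integrable_exp_neg_mul_sq (b := 1 / 4) (by norm_num)
    refine this.congr (ae_of_all _ fun v => ?_)
    simp only; congr 1; ring
  have hg4 : ∫ v : ℝ, Real.exp (-v ^ 2 / 4) = Real.sqrt (4 * Real.pi) := by
    have := integral_gaussian (1 / 4)
    rw [show Real.pi / (1 / 4) = 4 * Real.pi by ring] at this
    rw [← this]
    congr 1; funext v; congr 1; ring
  have hQgint : Integrable fun v => ‖Q v‖ ^ 2 * g v := by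
    refine (hgint.const_mul (M.card * F)).mono' (Continuous.aestronglyMeasurable (by
      simp only [hg]; fun_prop)) (ae_of_all _ fun v => ?_)
    rw [Real.norm_of_nonneg (by positivity)]
    exact mul_le_mul_of_nonneg_right (hQn v) (Real.exp_pos _).le
  set B := D0 * (M.card * F) with hB
  have hB0 : 0 ≤ B := by positivity
  -- Three ranges of `|v|`: the trivial bound `D0` up to `a / τ`, the hypothesis up to `b / τ`, and
  -- beyond that half of the Gaussian exponent supplies the factor `exp (-(b / τ) ^ 2 / 4)` while
  -- the other half keeps integrability.
  have hpt : ∀ v : ℝ, ‖D (τ * v) * ((‖Q v‖ ^ 2 * g v : ℝ) : ℂ)‖ ≤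
      V * (‖Q v‖ ^ 2 * g v) + (B * (Icc (-(a / τ)) (a / τ)).indicator (fun _ => (1:ℝ)) v +
        B * Real.exp (-(b / τ) ^ 2 / 4) * Real.exp (-v ^ 2 / 4)) := by
    intro v
    have hg0 : 0 < g v := Real.exp_pos _
    have hqg : 0 ≤ ‖Q v‖ ^ 2 * g v := by positivity
    rw [norm_mul, norm_real, Real.norm_of_nonneg hqg]
    have hDabs : ‖D (τ * v)‖ = ‖D (τ * |v|)‖ := by
      rcases le_total 0 v with h | h
      · rw [abs_of_nonneg h]
      · rw [abs_of_nonpos h, mul_neg, hDneg]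
    have t1 : 0 ≤ V * (‖Q v‖ ^ 2 * g v) := by positivity
    have t2 : 0 ≤ B * (Icc (-(a / τ)) (a / τ)).indicator (fun _ => (1:ℝ)) v :=
      mul_nonneg hB0 (indicator_nonneg (fun _ _ => zero_le_one) _)
    have t3 : 0 ≤ B * Real.exp (-(b / τ) ^ 2 / 4) * Real.exp (-v ^ 2 / 4) := by positivity
    have hDB : ‖D (τ * v)‖ * (‖Q v‖ ^ 2 * g v) ≤ B * g v := by
      calc _ ≤ D0 * ((M.card * F) * g v) := by
            gcongr
            · exact hDn _
            · exact hQn v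
        _ = _ := by rw [hB]; ring
    by_cases h1 : |v| ≤ a / τ
    · have hg1 : g v ≤ 1 := Real.exp_le_one_iff.2 (by nlinarith [sq_nonneg v])
      rw [indicator_of_mem (show v ∈ Icc (-(a / τ)) (a / τ) from abs_le.1 h1)] at t2 ⊢
      nlinarith
    · by_cases h2 : |v| ≤ b / τ
      · have : ‖D (τ * v)‖ ≤ V := by
          rw [hDabs]
          refine hbd _ ⟨?_, ?_⟩
          · rw [not_le, div_lt_iff₀ hτ] at h1; linarith
          · rw [le_div_iff₀ hτ] at h2; linarith
        have := mul_le_mul_of_nonneg_right this hqg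
        linarith
      · have hb' : (b / τ) ^ 2 ≤ v ^ 2 := by
          rw [← sq_abs v]
          exact pow_le_pow_left₀ (by positivity) (not_le.1 h2).le 2
        have : g v ≤ Real.exp (-(b / τ) ^ 2 / 4) * Real.exp (-v ^ 2 / 4) := by
          rw [← Real.exp_add]
          apply Real.exp_le_exp.2
          linarith
        have := mul_le_mul_of_nonneg_left this hB0
        linarith
  have hind : Integrable ((Icc (-(a / τ)) (a / τ)).indicator fun _ : ℝ => (1 : ℝ)) :=
    (integrable_indicator_iff measurableSet_Icc).2 (integrableOn_const (by simp))
  have hupper := norm_integral_le_of_norm_le ((hQgint.const_mul V).add ((hind.const_mul B).add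
    (hg4int.const_mul (B * Real.exp (-(b / τ) ^ 2 / 4))))) (ae_of_all _ hpt)
  rw [integral_add' (hQgint.const_mul V) ((hind.const_mul B).add
    (hg4int.const_mul (B * Real.exp (-(b / τ) ^ 2 / 4)))), integral_add' (hind.const_mul B)
    (hg4int.const_mul (B * Real.exp (-(b / τ) ^ 2 / 4))), integral_const_mul, integral_const_mul,
    integral_const_mul, hg4, hQintR, hmain, integral_indicator_const (1 : ℝ) measurableSet_Icc,
    norm_real, smul_eq_mul, mul_one] at hupper
  have hvol : volume.real (Icc (-(a / τ)) (a / τ)) = 2 * (a / τ) := by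
    rw [Real.volume_real_Icc_of_le (by have : 0 ≤ a / τ := by positivity
                                       linarith)]; ring
  rw [hvol] at hupper
  have hs2 : 1 ≤ Real.sqrt (2 * Real.pi) := by
    rw [Real.one_le_sqrt]; linarith [Real.pi_gt_three]
  set s2 := Real.sqrt (2 * Real.pi) with hs2def
  have hlow : Real.exp (-1 / 2) * ∑ e ∈ E, d (kap e) * (f (src e) * f (tgt e)) ≤
      ∑ q ∈ S ×ˢ (J ×ˢ J), d q.1 * (r q.2.1 * r q.2.2) *
        Real.exp (-((q.2.2 : ℝ) - q.2.1 - τ * x q.1) ^ 2 / 2) := by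
    rw [← Finset.sum_fiberwise_of_maps_to hkap, Finset.mul_sum, Finset.sum_product]
    refine Finset.sum_le_sum fun k _ => ?_
    have := sum_edges_le_gaussian (M := M) (src := src) (tgt := tgt) (lam := lam) hf (τ := τ)
      (x := x k) (E.filter fun e => kap e = k)
      (fun e he => hsrc e (Finset.mem_filter.1 he).1) (fun e he => htgt e (Finset.mem_filter.1 he).1)
      (fun e he => by
        obtain ⟨h1, h2⟩ := Finset.mem_filter.1 he
        rw [hlam e h1, h2])
      (fun e he e' he' h => hinj e (Finset.mem_filter.1 he).1 e' (Finset.mem_filter.1 he').1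
        ((Finset.mem_filter.1 he).2.trans (Finset.mem_filter.1 he').2.symm) h)
      (fun e he e' he' h => hinj' e (Finset.mem_filter.1 he).1 e' (Finset.mem_filter.1 he').1
        ((Finset.mem_filter.1 he).2.trans (Finset.mem_filter.1 he').2.symm) h)
    have h2 := mul_le_mul_of_nonneg_left this (hd k)
    calc _ = d k * (Real.exp (-1 / 2) * ∑ e ∈ E with kap e = k, f (src e) * f (tgt e)) := by
          rw [← mul_assoc, mul_comm (d k), mul_assoc, Finset.mul_sum (a := d k)]
          congr 1
          refine Finset.sum_congr rfl fun e he => ?_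
          rw [(Finset.mem_filter.1 he).2]
      _ ≤ _ := h2
      _ = _ := by
          rw [Finset.mul_sum]
          refine Finset.sum_congr rfl fun p _ => ?_
          simp only [hr]; ring
  set X := ∑ q ∈ S ×ˢ (J ×ˢ J), d q.1 * (r q.2.1 * r q.2.2) *
        Real.exp (-((q.2.2 : ℝ) - q.2.1 - τ * x q.1) ^ 2 / 2)
  set L := ∑ e ∈ E, d (kap e) * (f (src e) * f (tgt e))
  have hG := sum_gaussian_mul_le J r
  rw [hrF] at hG
  set Y := ∑ p ∈ J ×ˢ J, r p.1 * r p.2 * Real.exp (-((p.2 : ℝ) - p.1) ^ 2 / 2)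
  set η := Real.exp (-(b / τ) ^ 2 / 4) with hη
  have hη0 : 0 < η := Real.exp_pos _
  have haτ : 0 ≤ a / τ := by positivity
  have hup2 : X ≤ V * (C₀ * F) + B * (2 * (a / τ)) + B * η * Real.sqrt (4 * Real.pi) := by
    have h1 : s2 * X ≤ V * (s2 * Y) + (B * (2 * (a / τ)) + B * η * Real.sqrt (4 * Real.pi)) :=
      (le_abs_self _).trans hupper
    have h2 : B * (2 * (a / τ)) + B * η * Real.sqrt (4 * Real.pi) ≤
        s2 * (B * (2 * (a / τ)) + B * η * Real.sqrt (4 * Real.pi)) :=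
      le_mul_of_one_le_left (by positivity) hs2
    have h3 : V * (s2 * Y) ≤ s2 * (V * (C₀ * F)) := by
      calc V * (s2 * Y) ≤ V * (s2 * (C₀ * F)) := by gcongr
        _ = _ := by ring
    have h4 : s2 * X ≤ s2 * (V * (C₀ * F) + B * (2 * (a / τ)) + B * η * Real.sqrt (4 * Real.pi)) := by
      linarith
    exact le_of_mul_le_mul_left h4 (by linarith)
  have hL : L ≤ Real.exp (1 / 2) * X := by
    have := mul_le_mul_of_nonneg_left hlow (Real.exp_pos (1 / 2)).le
    rwa [← mul_assoc, ← Real.exp_add, show (1 / 2 + -1 / 2 : ℝ) = 0 by norm_num, Real.exp_zero,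
      one_mul] at this
  refine hL.trans ?_
  rw [mul_assoc, mul_assoc]
  refine mul_le_mul_of_nonneg_left (hup2.trans ?_) (Real.exp_pos _).le
  set s4 := Real.sqrt (4 * Real.pi)
  have hBe : B = D0 * M.card * F := by rw [hB]; ring
  have hK : 0 ≤ D0 * M.card * F := by positivity
  have p1 : 0 ≤ V * F := by positivity
  have p2 : 0 ≤ D0 * M.card * F * (a / τ) := by positivity
  have p3 : 0 ≤ D0 * M.card * F * η := by positivity
  have expand : (C₀ + 2 + s4) * ((V + D0 * M.card * (a / τ + η)) * F) =
      (C₀ + 2 + s4) * (V * F) + (C₀ + 2 + s4) * (D0 * M.card * F * (a / τ)) +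
      (C₀ + 2 + s4) * (D0 * M.card * F * η) := by ring
  rw [expand, hBe]
  have q1 : C₀ * (V * F) ≤ (C₀ + 2 + s4) * (V * F) := mul_le_mul_of_nonneg_right (by linarith) p1
  have q2 : 2 * (D0 * M.card * F * (a / τ)) ≤ (C₀ + 2 + s4) * (D0 * M.card * F * (a / τ)) :=
    mul_le_mul_of_nonneg_right (by linarith) p2
  have q3 : s4 * (D0 * M.card * F * η) ≤ (C₀ + 2 + s4) * (D0 * M.card * F * η) :=
    mul_le_mul_of_nonneg_right (by linarith) p3
  linarith

end

/-! ### Mertens' first theorem. -/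

section

open Finset
open scoped Nat

lemma log_factorial_eq_sum (n : ℕ) :
    Real.log n ! = ∑ p ∈ Nat.primesLE n, ((n !).factorization p : ℝ) * Real.log p := by
  rw [Real.log_nat_eq_sum_factorization, Finsupp.sum]
  refine Finset.sum_subset (fun p hp => ?_) fun p _ hp => ?_
  · have h := Nat.support_factorization (n !) ▸ hp
    have hpp := Nat.prime_of_mem_primeFactors h
    exact Nat.mem_primesLE.2 ⟨(hpp.dvd_factorial).1 (Nat.dvd_of_mem_primeFactors h), hpp⟩
  · rw [Finsupp.notMem_support_iff.1 hp]; simp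

lemma div_le_factorization_factorial {n p : ℕ} (hp : p.Prime) (hpn : p ≤ n) :
    n / p ≤ (n !).factorization p := by
  rw [Nat.factorization_factorial hp (Nat.lt_succ_self (Nat.log p n))]
  have h1 : 1 ∈ Finset.Ico 1 (Nat.log p n + 1) := by
    rw [Finset.mem_Ico]
    exact ⟨le_rfl, Nat.lt_succ_of_le (Nat.log_pos hp.one_lt hpn)⟩
  calc n / p = n / p ^ 1 := by rw [pow_one]
    _ ≤ _ := Finset.single_le_sum (f := fun i => n / p ^ i) (fun i _ => Nat.zero_le _) h1

lemma factorization_factorial_le {n p : ℕ} (hp : p.Prime) :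
    ((n !).factorization p : ℝ) ≤ n / ((p : ℝ) - 1) := by
  have hp1 : (1 : ℝ) < p := by exact_mod_cast hp.one_lt
  have h := Nat.sub_one_mul_factorization_factorial (n := n) hp
  rw [le_div_iff₀ (by linarith)]
  have h2 : (p - 1) * (n !).factorization p ≤ n := h ▸ Nat.sub_le _ _
  have h3 : (((p - 1) * (n !).factorization p : ℕ) : ℝ) ≤ n := by exact_mod_cast h2
  rw [Nat.cast_mul, Nat.cast_sub hp.one_le, Nat.cast_one] at h3
  linarith

/-- In `log n!` the prime `p` occurs at least `n / p - 1` times; the total loss from the `-1` is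
Chebyshev's theta, at most `n * log 4`. -/
lemma sum_log_div_primesLE_le {n : ℕ} (hn : n ≠ 0) :
    ∑ p ∈ Nat.primesLE n, Real.log p / p ≤ Real.log n + Real.log 4 := by
  have hn0 : (0 : ℝ) < n := by positivity
  have h1 : ∑ p ∈ Nat.primesLE n, ((n : ℝ) / p - 1) * Real.log p ≤ Real.log n ! := by
    rw [log_factorial_eq_sum]
    refine Finset.sum_le_sum fun p hp => ?_
    obtain ⟨hpn, hpp⟩ := Nat.mem_primesLE.1 hp
    refine mul_le_mul_of_nonneg_right ?_ (Real.log_natCast_nonneg p)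
    have h2 : ((n / p : ℕ) : ℝ) ≤ (n !).factorization p := by
      exact_mod_cast div_le_factorization_factorial hpp hpn
    have h3 := Nat.lt_floor_add_one ((n : ℝ) / p)
    rw [Nat.floor_div_eq_div] at h3
    linarith
  have h2 : ∑ p ∈ Nat.primesLE n, ((n : ℝ) / p - 1) * Real.log p =
      n * ∑ p ∈ Nat.primesLE n, Real.log p / p - Chebyshev.theta n := by
    rw [Chebyshev.theta_eq_sum_primesLE_log, Finset.mul_sum, ← Finset.sum_sub_distrib]
    exact Finset.sum_congr rfl fun p _ => by ring
  have h3 := Chebyshev.theta_le_log4_mul_x hn0.le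
  have h4 : Real.log n ! ≤ n * Real.log n := by
    rw [← Real.log_pow]
    refine Real.log_le_log (by positivity) ?_
    exact_mod_cast Nat.factorial_le_pow n
  rw [h2] at h1
  have h5 : n * ∑ p ∈ Nat.primesLE n, Real.log p / p ≤ n * (Real.log n + Real.log 4) := by linarith
  exact le_of_mul_le_mul_left h5 hn0

/-- Legendre's bound `n / (p - 1)` on the exponent of `p` in `n!`, against `n! ≥ (n / e) ^ n`.
Replacing `1 / (p - 1)` by `1 / p` costs a convergent sum, majorised through `log p ≤ 2 √p`. -/
lemma exists_le_sum_log_div_primesLE : ∃ C, ∀ n : ℕ, n ≠ 0 →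
    Real.log n - C ≤ ∑ p ∈ Nat.primesLE n, Real.log p / p := by
  have hsum : Summable fun n : ℕ => 4 * (n : ℝ) ^ (-(3 / 2) : ℝ) :=
    (Real.summable_nat_rpow.2 (by norm_num)).mul_left 4
  refine ⟨1 + ∑' n : ℕ, 4 * (n : ℝ) ^ (-(3 / 2) : ℝ), fun n hn => ?_⟩
  have hn0 : (0 : ℝ) < n := by positivity
  have h1 : n * Real.log n - n ≤ Real.log n ! := by
    have := Real.pow_div_factorial_le_exp (n : ℝ) hn0.le n
    have h2 := Real.log_le_log (by positivity) this
    rw [Real.log_div (by positivity) (by positivity), Real.log_pow, Real.log_exp] at h2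
    linarith
  have h2 : Real.log n ! ≤ n * (∑ p ∈ Nat.primesLE n, Real.log p / p +
      ∑ p ∈ Nat.primesLE n, 4 * (p : ℝ) ^ (-(3 / 2) : ℝ)) := by
    rw [log_factorial_eq_sum, ← Finset.sum_add_distrib, Finset.mul_sum]
    refine Finset.sum_le_sum fun p hp => ?_
    have hpp := (Nat.mem_primesLE.1 hp).2
    have hp2 : (2 : ℝ) ≤ p := by exact_mod_cast hpp.two_le
    have hlog : Real.log p ≤ 2 * (p : ℝ) ^ (1 / 2 : ℝ) := by
      have := Real.log_le_rpow_div (x := p) (by positivity) (show (0:ℝ) < 1 / 2 by norm_num)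
      linarith
    have hlog0 := Real.log_natCast_nonneg p
    have e1 : (p : ℝ) ^ (-(3 / 2) : ℝ) = (p : ℝ) ^ (1 / 2 : ℝ) / (p : ℝ) ^ 2 := by
      rw [← Real.rpow_natCast, ← Real.rpow_sub (by positivity)]; norm_num
    have e2 : 1 / ((p : ℝ) - 1) ≤ 1 / p + 2 / (p : ℝ) ^ 2 := by
      have : (0:ℝ) < p - 1 := by linarith
      rw [div_add_div _ _ (by positivity) (by positivity), div_le_div_iff₀ this (by positivity)]
      nlinarith
    calc ((n !).factorization p : ℝ) * Real.log p ≤ n / ((p : ℝ) - 1) * Real.log p := by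
          gcongr; exact factorization_factorial_le hpp
      _ = n * (1 / ((p : ℝ) - 1) * Real.log p) := by ring
      _ ≤ n * ((1 / p + 2 / (p : ℝ) ^ 2) * Real.log p) := by gcongr
      _ = n * (Real.log p / p + 2 * Real.log p / (p : ℝ) ^ 2) := by ring
      _ ≤ n * (Real.log p / p + 2 * (2 * (p : ℝ) ^ (1 / 2 : ℝ)) / (p : ℝ) ^ 2) := by gcongr
      _ = _ := by rw [e1]; ring
  have h3 : ∑ p ∈ Nat.primesLE n, 4 * (p : ℝ) ^ (-(3 / 2) : ℝ) ≤
      ∑' n : ℕ, 4 * (n : ℝ) ^ (-(3 / 2) : ℝ) := hsum.sum_le_tsum _ fun i _ => by positivity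
  have h4 : n * (Real.log n - 1) ≤ n * (∑ p ∈ Nat.primesLE n, Real.log p / p +
      ∑ p ∈ Nat.primesLE n, 4 * (p : ℝ) ^ (-(3 / 2) : ℝ)) := by linarith
  have := le_of_mul_le_mul_left h4 hn0
  linarith

/-- The primes in the real interval `(u, v]`. -/
noncomputable def primesIoc (u v : ℝ) : Finset ℕ := {p ∈ Nat.primesLE ⌊v⌋₊ | u < (p : ℝ)}

lemma mem_primesIoc {u v : ℝ} (hv : 0 ≤ v) {p : ℕ} :
    p ∈ primesIoc u v ↔ p.Prime ∧ u < p ∧ (p : ℝ) ≤ v := by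
  rw [primesIoc, Finset.mem_filter, Nat.mem_primesLE, Nat.le_floor_iff hv]
  tauto

/-- Mertens' first theorem, for the primes in an interval. -/
theorem exists_abs_sum_log_div_primesIoc_sub_le : ∃ C, 0 < C ∧ ∀ u v : ℝ, 1 ≤ u → u ≤ v →
    |∑ p ∈ primesIoc u v, Real.log p / p - (Real.log v - Real.log u)| ≤ C := by
  obtain ⟨C, hC⟩ := exists_le_sum_log_div_primesLE
  have key : ∀ x : ℝ, 1 ≤ x →
      |∑ p ∈ Nat.primesLE ⌊x⌋₊, Real.log p / p - Real.log x| ≤ |C| + 2 := by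
    intro x hx
    have hf : ⌊x⌋₊ ≠ 0 := (Nat.floor_pos.2 hx).ne'
    have hf1 : (1 : ℝ) ≤ ⌊x⌋₊ := by exact_mod_cast Nat.floor_pos.2 hx
    have h1 := sum_log_div_primesLE_le hf
    have h2 := hC _ hf
    have h3 : Real.log ⌊x⌋₊ ≤ Real.log x :=
      Real.log_le_log (by positivity) (Nat.floor_le (by linarith))
    have h4 : Real.log x ≤ Real.log ⌊x⌋₊ + Real.log 2 := by
      rw [← Real.log_mul (by positivity) (by norm_num)]
      exact Real.log_le_log (by linarith) (by linarith [Nat.lt_floor_add_one x])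
    have h5 : Real.log 4 ≤ 2 := by
      rw [show (4 : ℝ) = 2 ^ 2 by norm_num, Real.log_pow]
      have := Real.log_two_lt_d9
      push_cast; linarith
    have h6 := Real.log_two_lt_d9
    rw [abs_le]
    have := le_abs_self C
    have := abs_nonneg C
    constructor <;> linarith
  refine ⟨2 * (|C| + 2), by positivity, fun u v hu huv => ?_⟩
  have hsplit : ∑ p ∈ primesIoc u v, Real.log p / p =
      ∑ p ∈ Nat.primesLE ⌊v⌋₊, Real.log p / p - ∑ p ∈ Nat.primesLE ⌊u⌋₊, Real.log p / p := by
    have hsub : Nat.primesLE ⌊u⌋₊ ⊆ Nat.primesLE ⌊v⌋₊ := Nat.primesLE_mono (Nat.floor_mono huv)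
    rw [eq_sub_iff_add_eq, ← Finset.sum_sdiff hsub]
    congr 1
    refine Finset.sum_congr ?_ fun _ _ => rfl
    ext p
    rw [mem_primesIoc (by linarith), Finset.mem_sdiff, Nat.mem_primesLE, Nat.mem_primesLE,
      Nat.le_floor_iff (by linarith), Nat.le_floor_iff (by linarith), ← not_le]
    tauto
  rw [hsplit]
  have h1 := abs_le.1 (key u hu)
  have h2 := abs_le.1 (key v (hu.trans huv))
  rw [abs_le]
  constructor <;> linarith [h1.1, h1.2, h2.1, h2.2]

end

/-! ### Product-type resonators over a set of primes. -/

section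

open Complex Finset

section Digits

/-- The exponent of a prime (in `{0, 1, 2}`) at the source of an edge. -/
def srcDigit : Fin 5 → Fin 3 := ![0, 1, 2, 0, 1]

/-- The exponent of a prime (in `{0, 1, 2}`) at the target of an edge. -/
def tgtDigit : Fin 5 → Fin 3 := ![0, 1, 2, 1, 2]

/-- The increment of the exponent of a prime along an edge. -/
def stepDigit : Fin 5 → ℕ := ![0, 0, 0, 1, 1]

/-- The weight `t` off the central exponent. -/
noncomputable def vertexWeight (t : ℝ) : Fin 3 → ℝ := ![t, 1, t]

/-- The cost `c` off the central exponent. -/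
noncomputable def vertexCost (c : ℝ) : Fin 3 → ℝ := ![c, 0, c]

/-- The weight of an edge at a prime. -/
noncomputable def edgeWeight (x t : ℝ) : Fin 5 → ℝ := ![t ^ 2, 1, t ^ 2, x * t, x * t]

lemma eq_of_src_step {a b : Fin 5} (h : srcDigit a = srcDigit b) (h' : stepDigit a = stepDigit b) :
    a = b := by
  revert a b; decide

lemma eq_of_tgt_step {a b : Fin 5} (h : tgtDigit a = tgtDigit b) (h' : stepDigit a = stepDigit b) :
    a = b := by
  revert a b; decide

lemma tgt_eq_src_add_step (a : Fin 5) :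
    (tgtDigit a : ℕ) = (srcDigit a : ℕ) + stepDigit a := by
  revert a; decide

lemma stepDigit_eq (a : Fin 5) : stepDigit a = 0 ∨ stepDigit a = 1 := by
  revert a; decide

lemma edgeWeight_eq (x t : ℝ) (a : Fin 5) :
    edgeWeight x t a =
      x ^ stepDigit a * (vertexWeight t (srcDigit a) * vertexWeight t (tgtDigit a)) := by
  fin_cases a <;> simp [edgeWeight, vertexWeight, srcDigit, tgtDigit, stepDigit] <;> ring

lemma edgeWeight_nonneg {x t : ℝ} (hx : 0 ≤ x) (ht : 0 ≤ t) (a : Fin 5) : 0 ≤ edgeWeight x t a := by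
  fin_cases a <;> simp [edgeWeight] <;> positivity

lemma vertexWeight_nonneg {t : ℝ} (ht : 0 ≤ t) (a : Fin 3) : 0 ≤ vertexWeight t a := by
  fin_cases a <;> simp [vertexWeight, ht]

end Digits

section ProductSums

variable {α : Type} [Fintype α]

variable [DecidableEq α] in
/-- Rankin's trick for sums over a product space. -/
lemma sum_filter_prod_le {n : ℕ} (w g : α → Fin n → ℝ) (hw : ∀ p a, 0 ≤ w p a) (b : ℝ)
    (s : Finset (α → Fin n)) (hs : ∀ e ∈ s, b ≤ ∑ p, g p (e p)) :
    ∑ e ∈ s, ∏ p, w p (e p) ≤ Real.exp (-b) * ∏ p, ∑ a, w p a * Real.exp (g p a) := by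
  rw [Finset.prod_univ_sum, Fintype.piFinset_univ, Finset.mul_sum]
  have h0 : ∀ e : α → Fin n, 0 ≤ ∏ p, w p (e p) := fun e => Finset.prod_nonneg fun p _ => hw p _
  refine (Finset.sum_le_sum fun e he => ?_).trans (Finset.sum_le_univ_sum_of_nonneg fun e => ?_)
  · rw [Finset.prod_mul_distrib, ← Real.exp_sum, mul_left_comm, ← Real.exp_add]
    exact le_mul_of_one_le_right (h0 e) (Real.one_le_exp (by linarith [hs e he]))
  · exact mul_nonneg (Real.exp_pos _).le
      (Finset.prod_nonneg fun p _ => mul_nonneg (hw p _) (Real.exp_pos _).le)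

/-- Since `z ≥ 1`, `z + y ≤ z * (1 + y) ≤ z * exp y`. It converts the tilts from Rankin's trick,
prime by prime, into one exponential factor. -/
lemma prod_le_exp_sum_mul_prod {u z y : α → ℝ} (hz : ∀ p, 1 ≤ z p) (hy : ∀ p, 0 ≤ y p)
    (hu0 : ∀ p, 0 ≤ u p) (hu : ∀ p, u p ≤ z p + y p) :
    ∏ p, u p ≤ Real.exp (∑ p, y p) * ∏ p, z p := by
  rw [Real.exp_sum, ← Finset.prod_mul_distrib]
  refine Finset.prod_le_prod (fun p _ => hu0 p) fun p _ => (hu p).trans ?_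
  have h1 := Real.add_one_le_exp (y p)
  nlinarith [hz p, hy p]

variable (x θ c : α → ℝ) [DecidableEq α]

/-- Rankin's trick with unit weights: the local factor is `1 + 2 exp (-c p)`, at most `exp (2 exp
(-c p))`. -/
lemma card_le_exp (B : ℝ) (s : Finset (α → Fin 3))
    (hs : ∀ e ∈ s, ∑ p, vertexCost (c p) (e p) ≤ B) :
    (s.card : ℝ) ≤ Real.exp (B + 2 * ∑ p, Real.exp (-c p)) := by
  have h := sum_filter_prod_le (fun _ _ => 1) (fun p a => -vertexCost (c p) a)
    (fun _ _ => zero_le_one) (-B) s (fun e he => by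
      rw [Finset.sum_neg_distrib]; exact neg_le_neg (hs e he))
  simp only [Finset.prod_const_one, Finset.sum_const, nsmul_eq_mul, mul_one, neg_neg, one_mul] at h
  refine h.trans ?_
  rw [Real.exp_add]
  gcongr
  have h2 := prod_le_exp_sum_mul_prod (α := α)
    (u := fun p => ∑ a, Real.exp (-vertexCost (c p) a)) (z := fun _ => 1)
    (y := fun p => 2 * Real.exp (-c p)) (fun _ => le_rfl) (fun p => by positivity)
    (fun p => by positivity) (fun p => by
      simp [Fin.sum_univ_three, vertexCost]; linarith)
  simpa [Finset.mul_sum] using h2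

lemma sum_sq_le_prod (s : Finset (α → Fin 3)) :
    ∑ i ∈ s, (∏ p, vertexWeight (θ p) (i p)) ^ 2 ≤ ∏ p, (1 + 2 * θ p ^ 2) := by
  have h := sum_filter_prod_le (fun p a => vertexWeight (θ p) a ^ 2) (fun _ _ => 0)
    (fun _ _ => sq_nonneg _) 0 s (fun e he => by simp)
  simp only [Finset.prod_pow] at h
  refine h.trans (le_of_eq ?_)
  simp only [neg_zero, Real.exp_zero, mul_one, one_mul]
  refine Finset.prod_congr rfl fun p _ => ?_
  simp [Fin.sum_univ_three, vertexWeight]; ring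

/-- The edges that are kept: both ends are cheap, and the number of primes moved is positive and
at most `j`. -/
noncomputable def goodEdges (B : ℝ) (j : ℕ) : Finset (α → Fin 5) :=
  {e | ∑ p, vertexCost (c p) (srcDigit (e p)) ≤ B ∧ ∑ p, vertexCost (c p) (tgtDigit (e p)) ≤ B ∧
    1 ≤ ∑ p, stepDigit (e p) ∧ ∑ p, stepDigit (e p) ≤ j}

variable {x θ c}

/-- The total weight of all edges is a product `Z`. Edges with an expensive source, an expensive
target or too many steps weigh at most `exp (-3) * Z ≤ Z / 6` each, and edges with no step weigh at
most `Q`. What is left is at least `Z / 2 - Q`. -/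
lemma le_sum_goodEdges (hx : ∀ p, 0 ≤ x p) (hθ : ∀ p, 0 ≤ θ p) (hc : ∀ p, 0 ≤ c p) {B δ : ℝ} {j : ℕ}
    (hδ : 0 ≤ δ)
    (hB : ∑ p, (2 * θ p ^ 2 + x p * θ p) * (Real.exp (δ * c p) - 1) + 3 ≤ δ * B)
    (hj : 2 * ∑ p, 2 * (x p * θ p) + 3 ≤ j) :
    (∏ p, (1 + 2 * θ p ^ 2)) *
        (Real.exp (∑ p, 2 * (x p * θ p) / (1 + 2 * θ p ^ 2 + 2 * (x p * θ p))) / 2 - 1) ≤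
      ∑ e ∈ goodEdges c B j, ∏ p, edgeWeight (x p) (θ p) (e p) := by
  classical
  set W : (α → Fin 5) → ℝ := fun e => ∏ p, edgeWeight (x p) (θ p) (e p) with hW
  set Z := ∏ p, (1 + 2 * θ p ^ 2 + 2 * (x p * θ p)) with hZ
  set Q := ∏ p, (1 + 2 * θ p ^ 2) with hQ
  have hxt : ∀ p, 0 ≤ x p * θ p := fun p => mul_nonneg (hx p) (hθ p)
  have hZ1 : ∀ p, 1 ≤ 1 + 2 * θ p ^ 2 + 2 * (x p * θ p) := fun p => by
    nlinarith [hxt p, sq_nonneg (θ p)]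
  have hZ0 : 0 ≤ Z := Finset.prod_nonneg fun p _ => zero_le_one.trans (hZ1 p)
  have hQ0 : 0 ≤ Q := Finset.prod_nonneg fun p _ => by positivity
  have hw : ∀ p a, 0 ≤ edgeWeight (x p) (θ p) a := fun p a => edgeWeight_nonneg (hx p) (hθ p) a
  have hW0 : ∀ e, 0 ≤ W e := fun e => Finset.prod_nonneg fun p _ => hw p _
  have htot : ∑ e, W e = Z := by
    rw [hW, ← Fintype.piFinset_univ, ← Finset.prod_univ_sum]
    refine Finset.prod_congr rfl fun p _ => ?_
    simp [Fin.sum_univ_five, edgeWeight]; ring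
  have hE : ∀ p, 1 ≤ Real.exp (δ * c p) := fun p => Real.one_le_exp (mul_nonneg hδ (hc p))
  have hy : ∀ p, 0 ≤ (2 * θ p ^ 2 + x p * θ p) * (Real.exp (δ * c p) - 1) := fun p =>
    mul_nonneg (add_nonneg (by positivity) (hxt p)) (sub_nonneg.2 (hE p))
  set bs : Finset (α → Fin 5) := {e | B < ∑ p, vertexCost (c p) (srcDigit (e p))}
  set bt : Finset (α → Fin 5) := {e | B < ∑ p, vertexCost (c p) (tgtDigit (e p))}
  set bz : Finset (α → Fin 5) := {e | ∑ p, stepDigit (e p) = 0}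
  set bj : Finset (α → Fin 5) := {e | j < ∑ p, stepDigit (e p)}
  have hbs : ∑ e ∈ bs, W e ≤ Real.exp (-3) * Z := by
    -- The tilt by `exp (δ * cost)` raises the local factor by exactly `(2 θ² + x θ) * (exp (δ c) -
    -- 1)`: among the two raising edges only the one from exponent 0 has an off-centre source. For
    -- targets it is the one into exponent 2, with the same result.
    refine (sum_filter_prod_le _ (fun p a => δ * vertexCost (c p) (srcDigit a)) hw (δ * B) bs
      (fun e he => ?_)).trans ?_
    · rw [← Finset.mul_sum]
      exact mul_le_mul_of_nonneg_left (Finset.mem_filter.1 he).2.le hδ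
    · refine (mul_le_mul_of_nonneg_left (prod_le_exp_sum_mul_prod hZ1 hy (fun p =>
        Finset.sum_nonneg fun a _ => mul_nonneg (hw p a) (Real.exp_pos _).le) fun p => ?_)
        (Real.exp_pos _).le).trans ?_
      · simp [Fin.sum_univ_five, edgeWeight, vertexCost, srcDigit]
        linarith
      · rw [← mul_assoc, ← Real.exp_add]
        gcongr
        linarith
  have hbt : ∑ e ∈ bt, W e ≤ Real.exp (-3) * Z := by
    refine (sum_filter_prod_le _ (fun p a => δ * vertexCost (c p) (tgtDigit a)) hw (δ * B) bt
      (fun e he => ?_)).trans ?_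
    · rw [← Finset.mul_sum]
      exact mul_le_mul_of_nonneg_left (Finset.mem_filter.1 he).2.le hδ
    · refine (mul_le_mul_of_nonneg_left (prod_le_exp_sum_mul_prod hZ1 hy (fun p =>
        Finset.sum_nonneg fun a _ => mul_nonneg (hw p a) (Real.exp_pos _).le) fun p => ?_)
        (Real.exp_pos _).le).trans ?_
      · simp [Fin.sum_univ_five, edgeWeight, vertexCost, tgtDigit]
        linarith
      · rw [← mul_assoc, ← Real.exp_add]
        gcongr
        linarith
  -- The tilt is `exp` of the number of steps; `e ≤ 3` lets `2 x θ * e` be bounded by `2 x θ` plus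
  -- the perturbation `2 * (2 x θ)`.
  have hbj : ∑ e ∈ bj, W e ≤ Real.exp (-3) * Z := by
    refine (sum_filter_prod_le _ (fun p a => (stepDigit a : ℝ)) hw j bj
      (fun e he => ?_)).trans ?_
    · exact_mod_cast (Finset.mem_filter.1 he).2.le
    · refine (mul_le_mul_of_nonneg_left (prod_le_exp_sum_mul_prod hZ1
        (y := fun p => 2 * (2 * (x p * θ p))) (fun p => by linarith [hxt p]) (fun p =>
        Finset.sum_nonneg fun a _ => mul_nonneg (hw p a) (Real.exp_pos _).le) fun p => ?_)
        (Real.exp_pos _).le).trans ?_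
      · simp [Fin.sum_univ_five, edgeWeight, stepDigit]
        nlinarith [hxt p, Real.exp_one_lt_d9]
      · rw [← mul_assoc, ← Real.exp_add, ← Finset.mul_sum]
        gcongr
        linarith
  have hbz : ∑ e ∈ bz, W e ≤ Q := by
    have h1 : ∀ e ∈ bz, W e ≤
        ∏ p, (if stepDigit (e p) = 0 then edgeWeight (x p) (θ p) (e p) else 0) := by
      intro e he
      refine le_of_eq (Finset.prod_congr rfl fun p _ => ?_)
      have := (Finset.sum_eq_zero_iff.1 (Finset.mem_filter.1 he).2) p (Finset.mem_univ p)
      rw [if_pos this]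
    refine (Finset.sum_le_sum h1).trans ?_
    have h2 := sum_filter_prod_le
      (fun p a => if stepDigit a = 0 then edgeWeight (x p) (θ p) a else 0) (fun _ _ => 0)
      (fun p a => by split_ifs; exacts [hw p a, le_rfl]) 0 bz (fun e he => by simp)
    refine h2.trans (le_of_eq ?_)
    simp only [neg_zero, Real.exp_zero, mul_one, one_mul]
    refine Finset.prod_congr rfl fun p _ => ?_
    simp [Fin.sum_univ_five, edgeWeight, stepDigit]; ring
  have hcover : (Finset.univ : Finset (α → Fin 5)) ⊆ goodEdges c B j ∪ (bs ∪ (bt ∪ (bz ∪ bj))) := by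
    intro e _
    simp only [goodEdges, bs, bt, bz, bj, Finset.mem_union, Finset.mem_filter, Finset.mem_univ,
      true_and]
    by_contra hcon
    push Not at hcon
    obtain ⟨h1, h2, h3, h4, h5⟩ := hcon
    have := h1 h2 h3 (Nat.one_le_iff_ne_zero.2 h4)
    omega
  have hsum : Z ≤ ∑ e ∈ goodEdges c B j, W e + (∑ e ∈ bs, W e + (∑ e ∈ bt, W e +
      (∑ e ∈ bz, W e + ∑ e ∈ bj, W e))) := by
    have hun : ∀ s t : Finset (α → Fin 5), ∑ e ∈ s ∪ t, W e ≤ ∑ e ∈ s, W e + ∑ e ∈ t, W e := by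
      intro s t
      rw [← Finset.sum_union_inter]
      exact le_add_of_nonneg_right (Finset.sum_nonneg fun e _ => hW0 e)
    rw [← htot]
    refine (Finset.sum_le_sum_of_subset_of_nonneg hcover fun e _ _ => hW0 e).trans ?_
    linarith [hun (goodEdges c B j) (bs ∪ (bt ∪ (bz ∪ bj))), hun bs (bt ∪ (bz ∪ bj)),
      hun bt (bz ∪ bj), hun bz bj]
  -- Factor by factor this is `1 - a ≤ exp (-a)` with `a = 2 x θ / (1 + 2 θ² + 2 x θ)`, because `1 -
  -- a` is the quotient of the local factors of `Q` and `Z`.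
  have hZQ : Q * Real.exp (∑ p, 2 * (x p * θ p) / (1 + 2 * θ p ^ 2 + 2 * (x p * θ p))) ≤ Z := by
    rw [Real.exp_sum, hQ, hZ, ← Finset.prod_mul_distrib]
    refine Finset.prod_le_prod (fun p _ => by positivity) fun p _ => ?_
    have hZp : 0 < 1 + 2 * θ p ^ 2 + 2 * (x p * θ p) := zero_lt_one.trans_le (hZ1 p)
    have hQp : 0 < 1 + 2 * θ p ^ 2 := by positivity
    rw [← neg_neg (2 * (x p * θ p) / _), Real.exp_neg, ← div_eq_mul_inv, div_le_iff₀ (Real.exp_pos _)]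
    have h1 := Real.add_one_le_exp (-(2 * (x p * θ p) / (1 + 2 * θ p ^ 2 + 2 * (x p * θ p))))
    have h2 : -(2 * (x p * θ p) / (1 + 2 * θ p ^ 2 + 2 * (x p * θ p))) + 1 =
        (1 + 2 * θ p ^ 2) / (1 + 2 * θ p ^ 2 + 2 * (x p * θ p)) := by
      rw [eq_div_iff hZp.ne', add_mul, neg_mul, div_mul_cancel₀ _ hZp.ne']; ring
    rw [h2, div_le_iff₀ hZp] at h1
    linarith
  have h3 : Real.exp (-3) ≤ 1 / 6 := by
    have h4 : (6 : ℝ) ≤ Real.exp 3 := by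
      have := Real.exp_one_gt_d9
      have h5 : Real.exp 3 = Real.exp 1 ^ 3 := by rw [← Real.exp_nat_mul]; norm_num
      rw [h5]
      have : (2 : ℝ) ^ 3 ≤ Real.exp 1 ^ 3 := pow_le_pow_left₀ (by norm_num) (by linarith) 3
      linarith
    rw [Real.exp_neg, ← one_div]
    exact one_div_le_one_div_of_le (by norm_num) h4
  have h4 : Real.exp (-3) * Z ≤ 1 / 6 * Z := mul_le_mul_of_nonneg_right h3 hZ0
  linarith

end ProductSums

set_option maxHeartbeats 800000 in
/-- Resonance with a product-type resonator supported on the primes of `P`. -/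
theorem exists_prime_resonance : ∃ C : ℝ, 0 < C ∧ ∀ (P : Finset ℕ) (_ : ∀ p ∈ P, p.Prime)
    (σ : ℝ) (θ c : ℕ → ℝ) (_ : ∀ p ∈ P, 0 ≤ θ p) (_ : ∀ p ∈ P, 0 ≤ c p) (B δ : ℝ) (j : ℕ) (_ : 0 ≤ δ)
    (_ : ∑ p ∈ P, (2 * θ p ^ 2 + (p : ℝ) ^ (-σ) * θ p) * (Real.exp (δ * c p) - 1) + 3 ≤ δ * B)
    (_ : 2 * ∑ p ∈ P, 2 * ((p : ℝ) ^ (-σ) * θ p) + 3 ≤ j)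
    (X : ℝ) (_ : 1 ≤ X) (_ : ∀ p ∈ P, (p : ℝ) ≤ X) (S : Finset ℕ) (d : ℕ → ℝ) (d₁ : ℝ)
    (_ : ∀ k, 0 ≤ d k) (_ : 0 ≤ d₁)
    (_ : ∀ k : ℕ, 2 ≤ k → (k : ℝ) ≤ X ^ j → k ∈ S ∧ d₁ * (k : ℝ) ^ (-σ) ≤ d k)
    (τ a b V : ℝ) (_ : 0 < τ) (_ : 0 ≤ a) (_ : 0 ≤ b) (_ : 0 ≤ V)
    (_ : ∀ t ∈ Set.Icc a b, ‖∑ k ∈ S, (d k : ℂ) * cexp (-(t * Real.log k : ℝ) * I)‖ ≤ V),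
    d₁ * (Real.exp (∑ p ∈ P, 2 * ((p : ℝ) ^ (-σ) * θ p) /
      (1 + 2 * θ p ^ 2 + 2 * ((p : ℝ) ^ (-σ) * θ p))) / 2 - 1) ≤
      C * (V + (∑ k ∈ S, d k) * Real.exp (B + 2 * ∑ p ∈ P, Real.exp (-c p)) *
        (a / τ + Real.exp (-(b / τ) ^ 2 / 4))) := by
  obtain ⟨C, hC, hres⟩ := exists_resonance_inequality
  refine ⟨C, hC, ?_⟩
  intro P hP σ θ c hθ hc B δ j hδ hB hj X hX hPX S d d₁ hd hd₁ hS τ a b V hτ ha hb hV hbd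
  classical
  set M : Finset (P → Fin 3) := {i | ∑ p : P, vertexCost (c p) (i p) ≤ B} with hM
  set E : Finset (P → Fin 5) := goodEdges (fun p : P => c p) B j with hE
  set kap : (P → Fin 5) → ℕ := fun e => ∏ p : P, (p : ℕ) ^ stepDigit (e p) with hkap
  set lam : (P → Fin 3) → ℝ := fun i => ∑ p : P, ((i p : ℕ) : ℝ) * Real.log p with hlam
  set f : (P → Fin 3) → ℝ := fun i => ∏ p : P, vertexWeight (θ p) (i p) with hf
  have hPp : ∀ p : P, (p : ℕ).Prime := fun p => hP p p.2
  have hP0 : ∀ p : P, (0 : ℝ) < (p : ℕ) := fun p => by exact_mod_cast (hPp p).pos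
  have hmemE : ∀ e, e ∈ E ↔ ∑ p : P, vertexCost (c p) (srcDigit (e p)) ≤ B ∧
      ∑ p : P, vertexCost (c p) (tgtDigit (e p)) ≤ B ∧
      1 ≤ ∑ p : P, stepDigit (e p) ∧ ∑ p : P, stepDigit (e p) ≤ j := fun e => by
    rw [hE, goodEdges, Finset.mem_filter]; simp only [Finset.mem_univ, true_and]
  -- At least one step forces `kap e ≥ 2`: no lower bound is assumed on the coefficient at `1`, and
  -- it vanishes for derivatives of positive order.
  have hkapX : ∀ e ∈ E, 2 ≤ kap e ∧ (kap e : ℝ) ≤ X ^ j := by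
    intro e he
    obtain ⟨-, -, h1, h2⟩ := (hmemE e).1 he
    constructor
    · have : 2 ^ (∑ p : P, stepDigit (e p)) ≤ kap e := by
        rw [hkap, ← Finset.prod_pow_eq_pow_sum]
        exact Finset.prod_le_prod' fun p _ => Nat.pow_le_pow_left (hPp p).two_le _
      exact (Nat.pow_le_pow_right (by norm_num) h1).trans this
    · have : (kap e : ℝ) ≤ X ^ (∑ p : P, stepDigit (e p)) := by
        rw [hkap, ← Finset.prod_pow_eq_pow_sum]
        push_cast
        exact Finset.prod_le_prod (fun p _ => by positivity) fun p _ =>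
          pow_le_pow_left₀ (Nat.cast_nonneg _) (hPX p p.2) _
      exact this.trans (pow_le_pow_right₀ hX h2)
  -- The multiplier of an edge is squarefree, so divisibility recovers which primes were moved.
  -- Together with the source or the target this determines the edge, as the resonance inequality
  -- requires.
  have hstep : ∀ e e', kap e = kap e' → ∀ p, stepDigit (e p) = stepDigit (e' p) := by
    have hdvd : ∀ e (p : P), (p : ℕ) ∣ kap e ↔ stepDigit (e p) = 1 := by
      intro e p
      rw [hkap, Prime.dvd_finsetProd_iff (hPp p).prime]
      constructor
      · rintro ⟨q, -, hq⟩
        have h1 := (Nat.prime_dvd_prime_iff_eq (hPp p) (hPp q)).1 ((hPp p).dvd_of_dvd_pow hq)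
        rcases stepDigit_eq (e q) with h | h
        · rw [h, pow_zero] at hq
          exact absurd (Nat.dvd_one.1 hq) (hPp p).ne_one
        · rwa [Subtype.ext h1]
      · intro h
        exact ⟨p, Finset.mem_univ _, by rw [h, pow_one]⟩
    intro e e' h p
    have h1 := hdvd e p
    rw [h, hdvd e' p] at h1
    have h2 := stepDigit_eq (e p)
    have h3 := stepDigit_eq (e' p)
    omega
  have hf0 : ∀ i, 0 ≤ f i := fun i => Finset.prod_nonneg fun p _ => vertexWeight_nonneg (hθ p p.2) _
  have key := hres M E (fun e p => srcDigit (e p)) (fun e p => tgtDigit (e p)) kap lam f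
    (fun k => Real.log k) d S hf0 hd
    (fun e he => Finset.mem_filter.2 ⟨Finset.mem_univ _, ((hmemE e).1 he).1⟩)
    (fun e he => Finset.mem_filter.2 ⟨Finset.mem_univ _, ((hmemE e).1 he).2.1⟩)
    (fun e he => (hS _ (hkapX e he).1 (hkapX e he).2).1)
    (fun e he => by
      simp only [hlam, hkap]
      push_cast
      rw [Real.log_prod (fun p _ => pow_ne_zero _ (hP0 p).ne'), ← Finset.sum_add_distrib]
      refine Finset.sum_congr rfl fun p _ => ?_
      rw [Real.log_pow, tgt_eq_src_add_step]
      push_cast; ring)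
    (fun e _ e' _ h h' => funext fun p => eq_of_src_step (congrFun h' p) (hstep e e' h p))
    (fun e _ e' _ h h' => funext fun p => eq_of_tgt_step (congrFun h' p) (hstep e e' h p))
    τ a b V hτ ha hb hV hbd
  have hx0 : ∀ p : P, 0 ≤ ((p : ℕ) : ℝ) ^ (-σ) := fun p => by positivity
  have hgood := le_sum_goodEdges (α := P) (x := fun p => ((p : ℕ) : ℝ) ^ (-σ)) (θ := fun p => θ p)
    (c := fun p => c p) hx0 (fun p => hθ p p.2) (fun p => hc p p.2) (B := B) (δ := δ) (j := j) hδ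
    (by rwa [Finset.sum_coe_sort P
      (fun p => (2 * θ p ^ 2 + (p : ℝ) ^ (-σ) * θ p) * (Real.exp (δ * c p) - 1))])
    (by rwa [Finset.sum_coe_sort P (fun p => 2 * ((p : ℝ) ^ (-σ) * θ p))])
  rw [Finset.sum_coe_sort P (fun p => 2 * ((p : ℝ) ^ (-σ) * θ p) /
      (1 + 2 * θ p ^ 2 + 2 * ((p : ℝ) ^ (-σ) * θ p)))] at hgood
  have hcard := card_le_exp (fun p : P => c p) B M (fun e he => (Finset.mem_filter.1 he).2)
  rw [Finset.sum_coe_sort P (fun p => Real.exp (-c p))] at hcard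
  have hsq := sum_sq_le_prod (fun p : P => θ p) M
  set Q := ∏ p : P, (1 + 2 * θ p ^ 2) with hQ
  have hQ0 : 0 < Q := Finset.prod_pos fun p _ => by positivity
  have hlow : d₁ * ∑ e ∈ E, ∏ p : P, edgeWeight (((p : ℕ) : ℝ) ^ (-σ)) (θ p) (e p) ≤
      ∑ e ∈ E, d (kap e) * (f (fun p => srcDigit (e p)) * f (fun p => tgtDigit (e p))) := by
    rw [Finset.mul_sum]
    refine Finset.sum_le_sum fun e he => ?_
    have h1 : ∏ p : P, edgeWeight (((p : ℕ) : ℝ) ^ (-σ)) (θ p) (e p) =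
        (kap e : ℝ) ^ (-σ) * (f (fun p => srcDigit (e p)) * f (fun p => tgtDigit (e p))) := by
      simp only [edgeWeight_eq, Finset.prod_mul_distrib, hf]
      congr 1
      rw [hkap]
      push_cast
      rw [← Real.finsetProd_rpow _ _ (fun p _ => by positivity)]
      refine Finset.prod_congr rfl fun p _ => ?_
      rw [← Real.rpow_natCast, ← Real.rpow_natCast, ← Real.rpow_mul (by positivity),
        ← Real.rpow_mul (by positivity), mul_comm]
    rw [h1, ← mul_assoc]
    exact mul_le_mul_of_nonneg_right (hS _ (hkapX e he).1 (hkapX e he).2).2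
      (mul_nonneg (hf0 _) (hf0 _))
  have hD0 : 0 ≤ ∑ k ∈ S, d k := Finset.sum_nonneg fun k _ => hd k
  have herr : 0 ≤ a / τ + Real.exp (-(b / τ) ^ 2 / 4) := by positivity
  set R := C * (V + (∑ k ∈ S, d k) * Real.exp (B + 2 * ∑ p ∈ P, Real.exp (-c p)) *
        (a / τ + Real.exp (-(b / τ) ^ 2 / 4))) with hR
  have hR0 : 0 ≤ R := by positivity
  have hup : ∑ e ∈ E, d (kap e) * (f (fun p => srcDigit (e p)) * f (fun p => tgtDigit (e p))) ≤
      R * Q := by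
    refine key.trans ?_
    refine mul_le_mul ?_ hsq (Finset.sum_nonneg fun i _ => sq_nonneg _) hR0
    rw [hR]
    gcongr
  have hfin := (mul_le_mul_of_nonneg_left hgood hd₁).trans (hlow.trans hup)
  rw [mul_left_comm, mul_comm Q] at hfin
  exact le_of_mul_le_mul_right hfin hQ0

end

/-! ### Resonators applied to the smoothed polynomial. -/

section

open Complex Filter Topology Set MeasureTheory

/-- The coefficients of `smoothedSum` at the abscissa `σ`. -/
noncomputable def smoothedCoeff (l : ℕ) (A σ : ℝ) (k : ℕ) : ℝ :=
  cutoff (Real.log k / A) * (Real.log k ^ l * (k : ℝ) ^ (-σ))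

lemma smoothedCoeff_nonneg (l : ℕ) (A σ : ℝ) (k : ℕ) : 0 ≤ smoothedCoeff l A σ k :=
  mul_nonneg cutoff.nonneg (mul_nonneg (pow_nonneg (Real.log_natCast_nonneg k) _) (by positivity))

lemma smoothedSum_eq (l : ℕ) (A σ t : ℝ) :
    smoothedSum l A (σ + t * I) = ∑ k ∈ Finset.Ico 1 (⌈Real.exp (2 * A)⌉₊ + 1),
      (smoothedCoeff l A σ k : ℂ) * cexp (-(t * Real.log k : ℝ) * I) := by
  rw [Finset.sum_Ico_eq_sum_range, Nat.add_sub_cancel, smoothedSum]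
  refine Finset.sum_congr rfl fun k _ => ?_
  rw [add_comm 1 k, smoothedCoeff, logPowTerm]
  have hk : ((k + 1 : ℕ) : ℂ) ≠ 0 := Nat.cast_ne_zero.2 (Nat.succ_ne_zero k)
  have h1 : ((k + 1 : ℕ) : ℂ) ^ (-((σ : ℂ) + t * I)) =
      (((k + 1 : ℕ) : ℝ) ^ (-σ) : ℝ) * cexp (-(t * Real.log (k + 1 : ℕ) : ℝ) * I) := by
    rw [neg_add, cpow_add _ _ hk, ofReal_cpow (Nat.cast_nonneg _), ofReal_neg, ofReal_natCast]
    congr 1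
    rw [cpow_def_of_ne_zero hk, ← natCast_log]
    congr 1
    push_cast; ring
  rw [h1]
  push_cast; ring

lemma sum_smoothedCoeff_le (l : ℕ) {A σ : ℝ} (hA : 0 ≤ A) (hσ : 0 ≤ σ) :
    ∑ k ∈ Finset.Ico 1 (⌈Real.exp (2 * A)⌉₊ + 1), smoothedCoeff l A σ k ≤
      Real.exp ((2 * A + 1) * (l + 1)) := by
  set N := ⌈Real.exp (2 * A)⌉₊ with hN
  have hNle : (N : ℝ) ≤ Real.exp (2 * A + 1) := by
    have h1 := (Nat.ceil_lt_add_one (Real.exp_pos (2 * A)).le).le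
    have h2 := Real.one_le_exp (show 0 ≤ 2 * A by positivity)
    have h3 := Real.exp_one_gt_d9
    rw [Real.exp_add]
    nlinarith
  have hterm : ∀ k ∈ Finset.Ico 1 (N + 1), smoothedCoeff l A σ k ≤ (N : ℝ) ^ l := by
    intro k hk
    obtain ⟨hk1, hk2⟩ := Finset.mem_Ico.1 hk
    have hk1' : (1 : ℝ) ≤ k := by exact_mod_cast hk1
    have hlog : Real.log k ≤ N := (Real.log_le_self (by positivity)).trans (by
      exact_mod_cast Nat.lt_succ_iff.1 hk2)
    have h1 : (k : ℝ) ^ (-σ) ≤ 1 := Real.rpow_le_one_of_one_le_of_nonpos hk1' (by linarith)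
    have h2 : Real.log k ^ l ≤ (N : ℝ) ^ l := pow_le_pow_left₀ (Real.log_natCast_nonneg k) hlog l
    have h3 : 0 ≤ Real.log k ^ l := pow_nonneg (Real.log_natCast_nonneg k) l
    calc smoothedCoeff l A σ k ≤ 1 * ((N : ℝ) ^ l * 1) := by
          rw [smoothedCoeff]
          exact mul_le_mul cutoff.le_one (mul_le_mul h2 h1 (by positivity) (by positivity))
            (mul_nonneg h3 (by positivity)) zero_le_one
      _ = _ := by ring
  refine (Finset.sum_le_card_nsmul _ _ _ hterm).trans ?_
  rw [Nat.card_Ico, nsmul_eq_mul, Nat.add_sub_cancel, ← pow_succ', mul_comm (2 * A + 1),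
    show ((l : ℝ) + 1) = ((l + 1 : ℕ) : ℝ) by push_cast; ring, Real.exp_nat_mul]
  exact pow_le_pow_left₀ (Nat.cast_nonneg _) hNle _

/-- The coefficient sum is `exp` of `o(log T)`, the support has size at most `T ^ κ`, and `T ^ β /
(T / log T)` is `T ^ (β - 1)` up to a logarithm; since `β + κ < 1` this wins. The Gaussian tail is
`exp (-(log T) ^ 2 / 16)`, smaller than any power of `T`. -/
lemma exp_error_le_one_eventually (l : ℕ) {β κ : ℝ} (hκ : 0 ≤ κ) (hβκ : β + κ < 1) :
    ∀ᶠ T : ℝ in atTop, Real.exp ((2 * Real.log T ^ (3 / 4 : ℝ) + 1) * (l + 1)) *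
      Real.exp (κ * Real.log T) * (T ^ β / (T / Real.log T) +
        Real.exp (-(T / 2 / (T / Real.log T)) ^ 2 / 4)) ≤ 2 := by
  set ε := 1 - β - κ with hε
  have hε0 : 0 < ε := by linarith
  have hlim : ∀ᶠ L : ℝ in atTop, (2 * L ^ (3 / 4 : ℝ) + 1) * (l + 1) + Real.log L ≤ ε * L := by
    have h1 : (fun L : ℝ => (2 * L ^ (3 / 4 : ℝ) + 1) * (l + 1) + Real.log L) =o[atTop]
        (fun L : ℝ => L) := by
      have h2 : (fun L : ℝ => L ^ (3 / 4 : ℝ)) =o[atTop] (fun L : ℝ => L) := by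
        rw [Asymptotics.isLittleO_iff_tendsto' ((eventually_gt_atTop 0).mono fun L hL h =>
          absurd h hL.ne')]
        refine (tendsto_rpow_neg_atTop (show (0 : ℝ) < 1 / 4 by norm_num)).congr' ?_
        filter_upwards [eventually_gt_atTop 0] with L hL
        rw [← Real.rpow_sub_one hL.ne']
        norm_num
      have h3 : (fun _ : ℝ => (1 : ℝ)) =o[atTop] (fun L : ℝ => L) :=
        Asymptotics.isLittleO_const_id_atTop _
      refine (((h2.const_mul_left 2).add h3).const_mul_left ((l : ℝ) + 1)).congr_left
        (fun L => mul_comm _ _) |>.add Real.isLittleO_log_id_atTop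
    filter_upwards [h1.def hε0, eventually_ge_atTop 0] with L hL hL0
    rw [Real.norm_of_nonneg hL0] at hL
    exact (Real.le_norm_self _).trans hL
  filter_upwards [Real.tendsto_log_atTop.eventually hlim,
    Real.tendsto_log_atTop.eventually_ge_atTop 1,
    Real.tendsto_log_atTop.eventually_ge_atTop (16 * (ε + κ)), eventually_gt_atTop 0]
    with T h1 h2 h3 hT
  set L := Real.log T with hL
  have hL0 : 0 < L := by linarith
  have hTe : T = Real.exp L := (Real.exp_log hT).symm
  have hLe : L = Real.exp (Real.log L) := (Real.exp_log hL0).symm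
  have hlogL : 0 ≤ Real.log L := Real.log_nonneg h2
  have e1 : T ^ β / (T / L) = Real.exp ((β - 1) * L + Real.log L) := by
    rw [Real.exp_add, ← hLe, div_div_eq_mul_div, mul_div_right_comm, sub_mul, Real.exp_sub, one_mul,
      ← hTe, Real.rpow_def_of_pos hT, mul_comm β]
  have e2 : T / 2 / (T / L) = L / 2 := by field_simp
  rw [e1, e2, mul_add, ← Real.exp_add, ← Real.exp_add, ← Real.exp_add]
  have a1 : Real.exp ((2 * L ^ (3 / 4 : ℝ) + 1) * (l + 1) + κ * L + ((β - 1) * L + Real.log L)) ≤ 1 :=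
    Real.exp_le_one_iff.2 (by rw [hε] at h1; nlinarith)
  have a2 : Real.exp ((2 * L ^ (3 / 4 : ℝ) + 1) * (l + 1) + κ * L + -(L / 2) ^ 2 / 4) ≤ 1 :=
    Real.exp_le_one_iff.2 (by nlinarith)
  linarith

/-- If `ζ^(l)` is bounded by `V` on a long vertical segment, then the quality of every admissible
resonator is `O(V + 1)`. -/
theorem exists_exp_le_of_norm_iteratedDeriv_le (l : ℕ) {σ β₁ β₂ κ : ℝ} (hσ : 1 / 2 ≤ σ) (hσ1 : σ < 1)
    (hβ : β₁ < β₂) (hβ0 : 0 < β₂) (hκ : 0 ≤ κ) (hβκ : β₂ + κ < 1) :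
    ∃ C, 0 < C ∧ ∀ᶠ T : ℝ in atTop, ∀ V : ℝ, 0 ≤ V →
      (∀ u ∈ Icc (T ^ β₁) T, ‖iteratedDeriv l riemannZeta (σ + u * I)‖ ≤ V) →
      ∀ (P : Finset ℕ) (_ : ∀ p ∈ P, p.Prime) (θ c : ℕ → ℝ) (_ : ∀ p ∈ P, 0 ≤ θ p)
        (_ : ∀ p ∈ P, 0 ≤ c p) (B δ : ℝ) (j : ℕ) (_ : 0 ≤ δ)
        (_ : ∑ p ∈ P, (2 * θ p ^ 2 + (p : ℝ) ^ (-σ) * θ p) * (Real.exp (δ * c p) - 1) + 3 ≤ δ * B)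
        (_ : 2 * ∑ p ∈ P, 2 * ((p : ℝ) ^ (-σ) * θ p) + 3 ≤ j)
        (X : ℝ) (_ : 1 ≤ X) (_ : ∀ p ∈ P, (p : ℝ) ≤ X) (_ : j * Real.log X ≤ Real.log T ^ (3 / 4 : ℝ))
        (_ : B + 2 * ∑ p ∈ P, Real.exp (-c p) ≤ κ * Real.log T),
        Real.exp (∑ p ∈ P, 2 * ((p : ℝ) ^ (-σ) * θ p) /
          (1 + 2 * θ p ^ 2 + 2 * ((p : ℝ) ^ (-σ) * θ p))) ≤ C * (V + 1) := by
  obtain ⟨C₁, hC₁, h₁⟩ := exists_prime_resonance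
  obtain ⟨C₀, hC₀, h₀⟩ := exists_norm_smoothedSum_le_eventually l hσ hσ1 hβ hβ0
  have hlog2 : 0 < Real.log 2 := Real.log_pos (by norm_num)
  have hd1 : 0 < Real.log 2 ^ l := pow_pos hlog2 l
  refine ⟨2 * ((Real.log 2 ^ l)⁻¹ * (C₁ * (C₀ + 2)) + 1), by positivity, ?_⟩
  filter_upwards [h₀, exp_error_le_one_eventually l hκ hβκ, eventually_gt_atTop 0,
    Real.tendsto_log_atTop.eventually_ge_atTop 1] with T hT herr hT0 hlogT
  intro V hV hbd P hP θ c hθ hc B δ j hδ hB hj X hX hPX hjX hcost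
  set A := Real.log T ^ (3 / 4 : ℝ) with hA
  have hA0 : 0 < A := Real.rpow_pos_of_pos (by linarith) _
  have hT' := hT V hV hbd
  have key := h₁ P hP σ θ c hθ hc B δ j hδ hB hj X hX hPX
    (Finset.Ico 1 (⌈Real.exp (2 * A)⌉₊ + 1)) (smoothedCoeff l A σ) (Real.log 2 ^ l)
    (smoothedCoeff_nonneg l A σ) hd1.le (fun k hk2 hkX => by
      have hk0 : (0 : ℝ) < k := by positivity
      have hlogk : Real.log k ≤ A := by
        refine (Real.log_le_log hk0 hkX).trans ?_
        rwa [Real.log_pow]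
      refine ⟨Finset.mem_Ico.2 ⟨by omega, Nat.lt_succ_of_le ?_⟩, ?_⟩
      · have : (k : ℝ) ≤ ⌈Real.exp (2 * A)⌉₊ := by
          refine le_trans ?_ (Nat.le_ceil _)
          rw [← Real.exp_log hk0]
          exact Real.exp_le_exp.2 (by linarith)
        exact_mod_cast this
      · have hlk : 0 ≤ Real.log k := Real.log_natCast_nonneg k
        rw [smoothedCoeff, cutoff_eq_one, one_mul]
        · refine mul_le_mul_of_nonneg_right (pow_le_pow_left₀ hlog2.le ?_ l) (by positivity)
          exact Real.log_le_log (by norm_num) (by exact_mod_cast hk2)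
        · rw [abs_of_nonneg (by positivity), div_le_one hA0]
          exact hlogk)
    -- With `τ = T / log T`, the end `T / 2` lies `log T / 2` Gaussian units out, while the start `T
    -- ^ β₂` remains tiny on this scale.
    (T / Real.log T) (T ^ β₂) (T / 2) (C₀ * (V + 1)) (by positivity) (by positivity) (by positivity)
    (by positivity) (fun t ht => by rw [← smoothedSum_eq]; exact hT' t ht)
  have hsum := sum_smoothedCoeff_le l hA0.le (show 0 ≤ σ by linarith)
  have hE : (∑ k ∈ Finset.Ico 1 (⌈Real.exp (2 * A)⌉₊ + 1), smoothedCoeff l A σ k) *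
      Real.exp (B + 2 * ∑ p ∈ P, Real.exp (-c p)) *
        (T ^ β₂ / (T / Real.log T) + Real.exp (-(T / 2 / (T / Real.log T)) ^ 2 / 4)) ≤ 2 := by
    refine le_trans ?_ herr
    have : 0 ≤ T ^ β₂ / (T / Real.log T) := by positivity
    gcongr
  set G := ∑ p ∈ P, 2 * ((p : ℝ) ^ (-σ) * θ p) / (1 + 2 * θ p ^ 2 + 2 * ((p : ℝ) ^ (-σ) * θ p))
  have h2 : Real.log 2 ^ l * (Real.exp G / 2 - 1) ≤ C₁ * (C₀ + 2) * (V + 1) := by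
    refine key.trans ?_
    rw [mul_assoc C₁]
    refine mul_le_mul_of_nonneg_left ?_ hC₁.le
    nlinarith
  have h3 : Real.exp G / 2 - 1 ≤ (Real.log 2 ^ l)⁻¹ * (C₁ * (C₀ + 2) * (V + 1)) := by
    rwa [← div_eq_inv_mul, le_div_iff₀' hd1]
  linarith

end

/-! ### The reduction to constructing resonators, and sums over primes in intervals. -/

section

open Complex Filter Topology Set

/-- There is a resonator on the primes of abscissa `σ`, of cost at most `R`, whose edges have
`log`-length at most `Y`, and of quality at least `G`. -/
def HasResonator (σ R Y G : ℝ) : Prop :=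
  ∃ (P : Finset ℕ) (θ c : ℕ → ℝ) (B δ : ℝ) (j : ℕ) (X : ℝ),
    (∀ p ∈ P, p.Prime) ∧ (∀ p ∈ P, 0 ≤ θ p) ∧ (∀ p ∈ P, 0 ≤ c p) ∧ 0 ≤ δ ∧
    ∑ p ∈ P, (2 * θ p ^ 2 + (p : ℝ) ^ (-σ) * θ p) * (Real.exp (δ * c p) - 1) + 3 ≤ δ * B ∧
    2 * ∑ p ∈ P, 2 * ((p : ℝ) ^ (-σ) * θ p) + 3 ≤ j ∧
    1 ≤ X ∧ (∀ p ∈ P, (p : ℝ) ≤ X) ∧ j * Real.log X ≤ Y ∧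
    B + 2 * ∑ p ∈ P, Real.exp (-c p) ≤ R ∧
    G ≤ ∑ p ∈ P, 2 * ((p : ℝ) ^ (-σ) * θ p) / (1 + 2 * θ p ^ 2 + 2 * ((p : ℝ) ^ (-σ) * θ p))

lemma HasResonator.mono {σ R R' Y Y' G G' : ℝ} (h : HasResonator σ R Y G) (hR : R ≤ R')
    (hY : Y ≤ Y') (hG : G' ≤ G) : HasResonator σ R' Y' G' := by
  obtain ⟨P, θ, c, B, δ, j, X, h1, h2, h3, h4, h5, h6, h7, h8, h9, h10, h11⟩ := h
  exact ⟨P, θ, c, B, δ, j, X, h1, h2, h3, h4, h5, h6, h7, h8, h9.trans hY, h10.trans hR,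
    hG.trans h11⟩

lemma continuous_norm_iteratedDeriv_riemannZeta (l : ℕ) {σ : ℝ} (hσ : σ < 1) :
    Continuous fun t : ℝ => ‖iteratedDeriv l riemannZeta ((σ : ℂ) + t * I)‖ := by
  have hne : ∀ t : ℝ, (σ : ℂ) + t * I ≠ 1 := fun t h => by
    have := congrArg re h
    simp at this
    linarith
  have hc : Continuous (iteratedDeriv l riemannZeta₀) :=
    ((differentiable_riemannZeta₀.contDiff (n := ⊤)).differentiable_iteratedDeriv l
      (WithTop.coe_lt_top _)).continuous
  refine Continuous.norm ?_
  simp only [iteratedDeriv_riemannZeta l (hne _)]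
  refine (hc.comp (by fun_prop)).add (continuous_const.mul (continuous_const.div (by fun_prop) ?_))
  exact fun t => pow_ne_zero _ (sub_ne_zero.2 (hne t))

/-- Compactness of the segment and continuity off the pole give the maximum; taking it as `V` leaves
only the existence of resonators. The freedom in the additive `K` absorbs the multiplicative
constant of the resonance bound. -/
theorem exists_isGreatest_of_hasResonator (l : ℕ) {σ β κ : ℝ} (hσ : 1 / 2 ≤ σ) (hσ1 : σ < 1)
    (hβ : 0 ≤ β) (hκ : 0 < κ) (hβκ : β + κ < 1) {g : ℝ → ℝ} (hg : ∀ᶠ T in atTop, 0 ≤ g T)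
    (h : ∀ K, ∀ᶠ T in atTop,
      HasResonator σ (κ * Real.log T) (Real.log T ^ (3 / 4 : ℝ)) (g T + K)) :
    ∀ᶠ T : ℝ in atTop, ∃ M : ℝ,
      IsGreatest ((fun t : ℝ => ‖iteratedDeriv l riemannZeta ((σ : ℂ) + t * I)‖) '' Icc (T ^ β) T) M ∧
      Real.exp (g T) ≤ M := by
  -- `β₂` is the midpoint of `β` and `1 - κ`, hence has room on both sides.
  obtain ⟨C, hC, hT⟩ := exists_exp_le_of_norm_iteratedDeriv_le l (σ := σ) (β₁ := β)
    (β₂ := (β + 1 - κ) / 2) (κ := κ) hσ hσ1 (by linarith) (by linarith) hκ.le (by linarith)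
  filter_upwards [hT, hg, h (Real.log (2 * C)), eventually_ge_atTop 1] with T hT hg0 hres hT1
  have hne : (Icc (T ^ β) T).Nonempty := nonempty_Icc.2 (by
    simpa using Real.rpow_le_rpow_of_exponent_le hT1 (show β ≤ 1 by linarith))
  obtain ⟨M, hM⟩ := (isCompact_Icc.image (continuous_norm_iteratedDeriv_riemannZeta l hσ1)).exists_isGreatest
    (hne.image _)
  refine ⟨M, hM, ?_⟩
  have hM0 : 0 ≤ M := by
    obtain ⟨t, -, rfl⟩ := hM.1
    exact norm_nonneg _
  obtain ⟨P, θ, c, B, δ, j, X, h1, h2, h3, h4, h5, h6, h7, h8, h9, h10, h11⟩ := hres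
  have key := hT M hM0 (fun u hu => hM.2 ⟨u, hu, rfl⟩) P h1 θ c h2 h3 B δ j h4 h5 h6 X h7 h8 h9 h10
  have h12 := (Real.exp_le_exp.2 h11).trans key
  rw [Real.exp_add, Real.exp_log (by positivity)] at h12
  -- The choice `K = log (2 C)` gives the factor 2, and `exp (g T) ≥ 1` then removes the `+ 1`.
  have h13 : 2 * Real.exp (g T) ≤ M + 1 := by
    refine le_of_mul_le_mul_left ?_ hC
    linarith
  linarith [Real.one_le_exp hg0]

lemma sum_primesIoc_eq_sum_blocks (f : ℕ → ℝ) {e : ℕ → ℝ} (he : Monotone e) (he0 : ∀ n, 0 ≤ e n)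
    {m n : ℕ} (hmn : m ≤ n) :
    ∑ p ∈ primesIoc (e m) (e n), f p =
      ∑ k ∈ Finset.Ico m n, ∑ p ∈ primesIoc (e k) (e (k + 1)), f p := by
  induction n, hmn using Nat.le_induction with
  | base =>
    rw [Finset.Ico_self, Finset.sum_empty]
    refine Finset.sum_eq_zero fun p hp => ?_
    obtain ⟨-, h1, h2⟩ := (mem_primesIoc (he0 m)).1 hp
    linarith
  | succ n hmn ih =>
    rw [Finset.sum_Ico_succ_top hmn, ← ih, ← Finset.sum_union]
    · refine Finset.sum_congr ?_ fun _ _ => rfl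
      ext p
      rw [Finset.mem_union, mem_primesIoc (he0 _), mem_primesIoc (he0 _), mem_primesIoc (he0 _)]
      have h1 := he hmn
      have h2 := he n.le_succ
      constructor
      · rintro ⟨hp, h3, h4⟩
        rcases le_or_gt (p : ℝ) (e n) with h | h
        · exact Or.inl ⟨hp, h3, h⟩
        · exact Or.inr ⟨hp, h, h4⟩
      · rintro (⟨hp, h3, h4⟩ | ⟨hp, h3, h4⟩)
        · exact ⟨hp, h3, h4.trans h2⟩
        · exact ⟨hp, h1.trans_lt h3, h4⟩
    · rw [Finset.disjoint_left]
      intro p h3 h4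
      rw [mem_primesIoc (he0 _)] at h3 h4
      linarith [h3.2.2, h4.2.1]

/-- Bounds for the sum of the reciprocals of the primes in `(u, u e^H]`. -/
theorem exists_sum_inv_primesIoc_bounds : ∃ C : ℝ, 0 < C ∧ ∀ u H : ℝ, 1 < u → 0 ≤ H →
    (H - C) / (Real.log u + H) ≤ ∑ p ∈ primesIoc u (u * Real.exp H), (p : ℝ)⁻¹ ∧
    ∑ p ∈ primesIoc u (u * Real.exp H), (p : ℝ)⁻¹ ≤ (H + C) / Real.log u := by
  obtain ⟨C, hC, h⟩ := exists_abs_sum_log_div_primesIoc_sub_le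
  refine ⟨C, hC, fun u H hu hH => ?_⟩
  have hu0 : 0 < u := by linarith
  have hlu : 0 < Real.log u := Real.log_pos hu
  have hlog : Real.log (u * Real.exp H) = Real.log u + H := by
    rw [Real.log_mul hu0.ne' (Real.exp_pos H).ne', Real.log_exp]
  have h1 := abs_le.1 (h u (u * Real.exp H) hu.le (le_mul_of_one_le_right hu0.le (Real.one_le_exp hH)))
  rw [hlog] at h1
  have hmem : ∀ p ∈ primesIoc u (u * Real.exp H),
      0 < (p : ℝ) ∧ Real.log u ≤ Real.log p ∧ Real.log p ≤ Real.log u + H := by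
    intro p hp
    obtain ⟨hpp, h2, h3⟩ := (mem_primesIoc (by positivity)).1 hp
    have hp0 : 0 < (p : ℝ) := by exact_mod_cast hpp.pos
    exact ⟨hp0, Real.log_le_log hu0 h2.le, hlog ▸ Real.log_le_log hp0 h3⟩
  constructor
  · rw [div_le_iff₀ (by linarith), Finset.sum_mul]
    refine le_trans (by linarith [h1.1]) (Finset.sum_le_sum fun p hp => ?_)
    · obtain ⟨h2, h3, h4⟩ := hmem p hp
      rw [div_eq_inv_mul]
      exact mul_le_mul_of_nonneg_left h4 (by positivity)
  · rw [le_div_iff₀ hlu, Finset.sum_mul]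
    refine le_trans (Finset.sum_le_sum fun p hp => ?_) (show
      ∑ p ∈ primesIoc u (u * Real.exp H), Real.log p / p ≤ H + C by linarith [h1.2])
    · obtain ⟨h2, h3, h4⟩ := hmem p hp
      rw [div_eq_inv_mul]
      exact mul_le_mul_of_nonneg_left h3 (by positivity)

/-- The sum of `p ^ (-σ)` over the primes up to `w`, uniformly in `σ`. -/
theorem exists_le_sum_primesIoc_rpow : ∃ C : ℝ, 0 < C ∧ ∀ σ : ℝ, 0 < σ → σ < 1 →
    ∀ᶠ w : ℝ in atTop, C * (w ^ (1 - σ) / ((1 - σ) * Real.log w)) ≤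
      ∑ p ∈ primesIoc 1 w, (p : ℝ) ^ (-σ) := by
  obtain ⟨C, hC, h⟩ := exists_sum_inv_primesIoc_bounds
  -- Blocks long enough to beat the Mertens error, as `H - C = C`.
  set H := 2 * C with hH
  have hH0 : 0 < H := by positivity
  refine ⟨Real.exp (-1 - H) * C / H, by positivity, fun σ hσ hσ1 => ?_⟩
  have hσ' : 0 < 1 - σ := by linarith
  -- These `m` blocks end at `w` and have total logarithmic length about `1 / (1 - σ)`, on which `p
  -- ^ (1 - σ)` stays comparable to `w ^ (1 - σ)`. Their number is the source of the factor `1 / (1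
  -- - σ)`, with a constant independent of `σ`.
  set m := ⌈1 / ((1 - σ) * H)⌉₊ with hm
  have hm1 : 1 / ((1 - σ) * H) ≤ m := Nat.le_ceil _
  have hm2 : (1 - σ) * (m * H) ≤ 1 + H := by
    have h1 := (Nat.ceil_lt_add_one (show 0 ≤ 1 / ((1 - σ) * H) by positivity)).le
    rw [← hm] at h1
    have h2 : ((1 - σ) * H) * m ≤ ((1 - σ) * H) * (1 / ((1 - σ) * H) + 1) :=
      mul_le_mul_of_nonneg_left h1 (by positivity)
    rw [mul_add, mul_one_div_cancel (by positivity)] at h2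
    nlinarith
  filter_upwards [eventually_gt_atTop (Real.exp (m * H)), eventually_gt_atTop 1] with w hw hw1
  have hw0 : 0 < w := by linarith
  set e : ℕ → ℝ := fun k => w * Real.exp (-(m * H)) * Real.exp (k * H) with he
  have hemono : Monotone e := fun a b hab => by
    simp only [he]
    have : (a : ℝ) ≤ b := by exact_mod_cast hab
    gcongr
  have he0 : ∀ n, 0 ≤ e n := fun n => by positivity
  have hem : e m = w := by
    simp only [he]; rw [mul_assoc, ← Real.exp_add]; simp
  have he1 : 1 < e 0 := by
    simp only [he]
    rw [Real.exp_neg, Nat.cast_zero, zero_mul, Real.exp_zero, mul_one, ← div_eq_mul_inv,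
      one_lt_div (Real.exp_pos _)]
    exact hw
  have hek : ∀ k, e (k + 1) = e k * Real.exp H := fun k => by
    simp only [he]; rw [mul_assoc _ (Real.exp _) (Real.exp H), ← Real.exp_add]; push_cast; ring_nf
  have hsub : primesIoc (e 0) (e m) ⊆ primesIoc 1 w := by
    rw [hem]
    intro p hp
    rw [mem_primesIoc hw0.le] at hp ⊢
    exact ⟨hp.1, he1.trans hp.2.1, hp.2.2⟩
  have hlw : 0 < Real.log w := Real.log_pos hw1
  have hblock : ∀ k ∈ Finset.Ico 0 m, Real.exp (-1 - H) * w ^ (1 - σ) * (C / Real.log w) ≤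
      ∑ p ∈ primesIoc (e k) (e (k + 1)), (p : ℝ) ^ (-σ) := by
    intro k hk
    have hkm : k + 1 ≤ m := (Finset.mem_Ico.1 hk).2
    have hek1 : 1 < e k := he1.trans_le (hemono (Nat.zero_le k))
    have h1 := (h (e k) H hek1 hH0.le).1
    have hle : Real.log (e k) + H ≤ Real.log w := by
      have h2 : Real.log (e (k + 1)) = Real.log (e k) + H := by
        rw [hek, Real.log_mul (by linarith) (Real.exp_pos H).ne', Real.log_exp]
      rw [← h2]
      exact Real.log_le_log (by rw [hek]; positivity) (hem ▸ hemono hkm)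
    have h2 : C / Real.log w ≤ ∑ p ∈ primesIoc (e k) (e k * Real.exp H), (p : ℝ)⁻¹ := by
      refine le_trans ?_ h1
      have : H - C = C := by rw [hH]; ring
      rw [this]
      have := Real.log_pos hek1
      gcongr
    have h3 : Real.exp (-1 - H) * w ^ (1 - σ) ≤ e k ^ (1 - σ) := by
      have hk0 : w * Real.exp (-(m * H)) ≤ e k := by
        simp only [he]
        exact le_mul_of_one_le_right (by positivity) (Real.one_le_exp (by positivity))
      refine le_trans ?_ (Real.rpow_le_rpow (by positivity) hk0 hσ'.le)
      rw [Real.mul_rpow hw0.le (Real.exp_pos _).le, ← Real.exp_mul, mul_comm]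
      refine mul_le_mul_of_nonneg_left (Real.exp_le_exp.2 (by linarith)) (by positivity)
    rw [hek]
    calc _ ≤ e k ^ (1 - σ) * ∑ p ∈ primesIoc (e k) (e k * Real.exp H), (p : ℝ)⁻¹ := by
          refine mul_le_mul h3 h2 (by positivity) (by positivity)
      _ ≤ _ := by
          rw [Finset.mul_sum]
          refine Finset.sum_le_sum fun p hp => ?_
          obtain ⟨hpp, h4, -⟩ := (mem_primesIoc (by positivity)).1 hp
          have hp0 : 0 < (p : ℝ) := by exact_mod_cast hpp.pos
          rw [show -σ = (1 - σ) - 1 by ring, Real.rpow_sub_one hp0.ne', div_eq_mul_inv]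
          gcongr
  calc _ = (1 / ((1 - σ) * H)) * (Real.exp (-1 - H) * w ^ (1 - σ) * (C / Real.log w)) := by
        field_simp
    _ ≤ m * (Real.exp (-1 - H) * w ^ (1 - σ) * (C / Real.log w)) := by gcongr
    _ ≤ ∑ k ∈ Finset.Ico 0 m, ∑ p ∈ primesIoc (e k) (e (k + 1)), (p : ℝ) ^ (-σ) := by
        refine le_trans (le_of_eq ?_) (Finset.card_nsmul_le_sum _ _ _ hblock)
        rw [Nat.card_Ico, nsmul_eq_mul, Nat.sub_zero]
    _ = ∑ p ∈ primesIoc (e 0) (e m), (p : ℝ) ^ (-σ) :=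
        (sum_primesIoc_eq_sum_blocks _ hemono he0 (Nat.zero_le m)).symm
    _ ≤ _ := Finset.sum_le_sum_of_subset_of_nonneg hsub fun p _ _ => by positivity

end

/-! ### Constant weights, and the right half of the critical strip. -/

section

open Complex Filter Topology Set

lemma sum_rpow_neg_half_le (N : ℕ) :
    ∑ k ∈ Finset.Ico 1 (N + 1), (k : ℝ) ^ (-(1 / 2) : ℝ) ≤ 2 * Real.sqrt N := by
  induction N with
  | zero => simp
  | succ n ih =>
    rw [Finset.sum_Ico_succ_top (by omega)]
    refine (add_le_add_left ih _).trans ?_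
    have h1 : ((n + 1 : ℕ) : ℝ) ^ (-(1 / 2) : ℝ) = (Real.sqrt (n + 1 : ℕ))⁻¹ := by
      rw [Real.rpow_neg (by positivity), Real.sqrt_eq_rpow]
    have h2 : 0 < Real.sqrt (n + 1 : ℕ) := Real.sqrt_pos.2 (by positivity)
    have h3 : Real.sqrt n ≤ Real.sqrt (n + 1 : ℕ) := Real.sqrt_le_sqrt (by push_cast; linarith)
    have h4 := Real.sq_sqrt (show (0 : ℝ) ≤ (n + 1 : ℕ) by positivity)
    have h5 := Real.sq_sqrt (show (0 : ℝ) ≤ n by positivity)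
    push_cast at h1 h2 h3 h4 ⊢
    rw [h1, ← mul_le_mul_iff_of_pos_right h2, add_mul, inv_mul_cancel₀ h2.ne']
    nlinarith [Real.sqrt_nonneg n]

lemma sum_primesIoc_rpow_le {σ : ℝ} (hσ : 1 / 2 ≤ σ) {w : ℝ} (hw : 0 ≤ w) :
    ∑ p ∈ primesIoc 1 w, (p : ℝ) ^ (-σ) ≤ 2 * Real.sqrt w := by
  have hmem : ∀ p ∈ primesIoc 1 w, p ∈ Finset.Ico 1 (⌊w⌋₊ + 1) := fun p hp => by
    obtain ⟨hpp, -, h⟩ := (mem_primesIoc hw).1 hp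
    exact Finset.mem_Ico.2 ⟨hpp.one_le, Nat.lt_succ_of_le (Nat.le_floor h)⟩
  calc ∑ p ∈ primesIoc 1 w, (p : ℝ) ^ (-σ) ≤ ∑ p ∈ primesIoc 1 w, (p : ℝ) ^ (-(1 / 2) : ℝ) := by
        refine Finset.sum_le_sum fun p hp => ?_
        obtain ⟨-, h1, -⟩ := (mem_primesIoc hw).1 hp
        exact Real.rpow_le_rpow_of_exponent_le h1.le (by linarith)
    _ ≤ ∑ k ∈ Finset.Ico 1 (⌊w⌋₊ + 1), (k : ℝ) ^ (-(1 / 2) : ℝ) :=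
        Finset.sum_le_sum_of_subset_of_nonneg hmem fun p _ _ => by positivity
    _ ≤ 2 * Real.sqrt ⌊w⌋₊ := sum_rpow_neg_half_le _
    _ ≤ 2 * Real.sqrt w := by
        gcongr
        exact Nat.floor_le hw

lemma card_primesIoc_le_eventually :
    ∀ᶠ w : ℝ in atTop, ((primesIoc 1 w).card : ℝ) ≤ 2 * w / Real.log w := by
  filter_upwards [Chebyshev.eventually_primeCounting_le (ε := 1 / 2) (by norm_num),
    eventually_gt_atTop 1] with w h hw
  have h1 : (primesIoc 1 w).card ≤ Nat.primeCounting ⌊w⌋₊ := by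
    rw [← Nat.primesLE_card_eq_primeCounting]
    exact Finset.card_le_card (Finset.filter_subset _ _)
  have h2 : Real.log 4 + 1 / 2 ≤ 2 := by
    rw [show (4 : ℝ) = 2 ^ 2 by norm_num, Real.log_pow]
    have := Real.log_two_lt_d9
    push_cast; linarith
  have h3 := Real.log_pos hw
  calc ((primesIoc 1 w).card : ℝ) ≤ Nat.primeCounting ⌊w⌋₊ := by exact_mod_cast h1
    _ ≤ _ := h
    _ ≤ _ := by gcongr

/-- The resonator with constant weights on the primes up to `w`. -/
theorem exists_hasResonator_primesIoc : ∃ C : ℝ, 0 < C ∧ ∀ σ : ℝ, 1 / 2 ≤ σ → σ < 1 →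
    ∀ᶠ w : ℝ in atTop, HasResonator σ (16 * w / Real.log w) ((8 * Real.sqrt w + 4) * Real.log w)
      (C * (w ^ (1 - σ) / ((1 - σ) * Real.log w))) := by
  obtain ⟨C, hC, h⟩ := exists_le_sum_primesIoc_rpow
  refine ⟨2 / 5 * C, by positivity, fun σ hσ hσ1 => ?_⟩
  have hlim : ∀ᶠ w : ℝ in atTop, 3 * Real.log w ≤ w := by
    have := Real.isLittleO_log_id_atTop.def (show (0 : ℝ) < 1 / 3 by norm_num)
    filter_upwards [this, eventually_ge_atTop 0] with w h1 h2
    simp only [id, Real.norm_of_nonneg h2] at h1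
    linarith [Real.le_norm_self (Real.log w)]
  filter_upwards [h σ (by linarith) hσ1, card_primesIoc_le_eventually, eventually_gt_atTop 1, hlim]
    with w hw hcard hw1 hlogw
  have hw0 : 0 ≤ w := by linarith
  set P := primesIoc 1 w
  have hlw := Real.log_pos hw1
  have hPp : ∀ p ∈ P, p.Prime ∧ 1 < (p : ℝ) ∧ (p : ℝ) ≤ w := fun p hp => (mem_primesIoc hw0).1 hp
  have hx1 : ∀ p ∈ P, (p : ℝ) ^ (-σ) ≤ 1 := fun p hp =>
    Real.rpow_le_one_of_one_le_of_nonpos (hPp p hp).2.1.le (by linarith)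
  have hG0 := sum_primesIoc_rpow_le hσ hw0
  -- With `θ = c = δ = 1` each prime costs at most `3 * (e - 1) ≤ 6`, and the slack 3 completes `B`.
  -- The local gain `2 x / (3 + 2 x)` is at least `2 x / 5`, the origin of `2 / 5 * C`.
  refine ⟨P, fun _ => 1, fun _ => 1, 6 * P.card + 3, 1, ⌈8 * Real.sqrt w + 3⌉₊, w,
    fun p hp => (hPp p hp).1, fun _ _ => zero_le_one, fun _ _ => zero_le_one, zero_le_one, ?_, ?_,
    hw1.le, fun p hp => (hPp p hp).2.2, ?_, ?_, ?_⟩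
  · have h1 : ∀ p ∈ P, (2 * (1 : ℝ) ^ 2 + (p : ℝ) ^ (-σ) * 1) * (Real.exp (1 * 1) - 1) ≤ 6 := by
      intro p hp
      have h2 := Real.exp_one_lt_d9
      have h3 := Real.exp_one_gt_d9
      have h4 := hx1 p hp
      rw [mul_one, mul_one]
      nlinarith
    have h2 := Finset.sum_le_card_nsmul P _ _ h1
    rw [nsmul_eq_mul] at h2
    linarith
  · refine le_trans ?_ (Nat.le_ceil _)
    rw [← Finset.mul_sum]
    simp only [mul_one]
    linarith
  · refine mul_le_mul_of_nonneg_right ?_ hlw.le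
    have := (Nat.ceil_lt_add_one (show 0 ≤ 8 * Real.sqrt w + 3 by positivity)).le
    linarith
  · rw [Finset.sum_const, nsmul_eq_mul]
    have h1 : Real.exp (-1) ≤ 1 / 2 := by
      rw [Real.exp_neg, ← one_div]
      exact one_div_le_one_div_of_le (by norm_num) (by linarith [Real.exp_one_gt_d9])
    have h2 : 3 ≤ w / Real.log w := (le_div_iff₀ hlw).2 hlogw
    have h3 : 2 * w / Real.log w = 2 * (w / Real.log w) := by ring
    have h4 : 16 * w / Real.log w = 16 * (w / Real.log w) := by ring
    have h5 : (0 : ℝ) ≤ P.card := Nat.cast_nonneg _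
    nlinarith
  · have h1 : 2 / 5 * C * (w ^ (1 - σ) / ((1 - σ) * Real.log w)) ≤
        2 / 5 * ∑ p ∈ P, (p : ℝ) ^ (-σ) := by
      rw [mul_assoc]
      exact mul_le_mul_of_nonneg_left hw (by norm_num)
    refine h1.trans ?_
    rw [Finset.mul_sum]
    refine Finset.sum_le_sum fun p hp => ?_
    have h2 := hx1 p hp
    have h3 : 0 ≤ (p : ℝ) ^ (-σ) := by positivity
    rw [le_div_iff₀ (by positivity)]
    nlinarith

lemma tendsto_mul_loglog_atTop {a : ℝ} (ha : 0 < a) :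
    Tendsto (fun L : ℝ => a * L * Real.log L) atTop atTop :=
  (tendsto_id.const_mul_atTop ha).atTop_mul_atTop₀ Real.tendsto_log_atTop

/-- The length budget: for parameters up to `L ^ (5/4)`, the `j` moved primes have total logarithm
at most about `L ^ (5/8) * log L`, which fits below the cutoff at `L ^ (3/4)`. -/
lemma log_length_le_eventually :
    ∀ᶠ L : ℝ in atTop, (8 * L ^ (5 / 8 : ℝ) + 4) * (2 * Real.log L) ≤ L ^ (3 / 4 : ℝ) := by
  have h1 := (isLittleO_log_rpow_atTop (show (0 : ℝ) < 1 / 8 by norm_num)).def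
    (show (0 : ℝ) < 1 / 24 by norm_num)
  filter_upwards [h1, eventually_ge_atTop 1] with L h2 hL
  have hL0 : 0 < L := by linarith
  rw [Real.norm_of_nonneg (by positivity : (0 : ℝ) ≤ L ^ (1 / 8 : ℝ))] at h2
  have h3 := (Real.le_norm_self _).trans h2
  have h4 : L ^ (3 / 4 : ℝ) = L ^ (5 / 8 : ℝ) * L ^ (1 / 8 : ℝ) := by
    rw [← Real.rpow_add hL0]; norm_num
  have h5 : 1 ≤ L ^ (5 / 8 : ℝ) := Real.one_le_rpow hL (by norm_num)
  have h6 := Real.log_nonneg hL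
  rw [h4]
  nlinarith

/-- The extreme values of `ζ^(l)` to the right of the critical line. -/
theorem exists_extreme_values_right_half : ∃ C : ℝ, 0 < C ∧
    ∀ (l : ℕ) (β : ℝ), 0 ≤ β → β < 1 → ∀ σ : ℝ, 1 / 2 < σ → σ < 1 → ∀ κ : ℝ, 0 < κ → κ < 1 - β →
      ∀ᶠ T : ℝ in atTop, ∃ M : ℝ,
        IsGreatest ((fun t : ℝ => ‖iteratedDeriv l riemannZeta ((σ : ℂ) + (t : ℂ) * I)‖) ''
          Icc (T ^ β) T) M ∧
        Real.exp (C * κ ^ (1 - σ) / (1 - σ) *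
          (Real.log T ^ (1 - σ) / Real.log (Real.log T) ^ σ)) ≤ M := by
  obtain ⟨C, hC, h⟩ := exists_hasResonator_primesIoc
  -- `128 = 32 * 2 * 2`: from `(κ / 32) ^ (1 - σ)`, from `log w ≤ 2 log L`, and from absorbing `K`
  -- into half of the gain.
  refine ⟨C / 128, by positivity, fun l β hβ hβ1 σ hσ hσ1 κ hκ hκβ => ?_⟩
  have hσ' : 0 < 1 - σ := by linarith
  set F : ℝ → ℝ := fun L => C / 128 * κ ^ (1 - σ) / (1 - σ) * (L ^ (1 - σ) / Real.log L ^ σ) with hF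
  have hFlim : Tendsto F atTop atTop := by
    refine Tendsto.const_mul_atTop (by positivity) ?_
    have h1 := (isLittleO_log_rpow_rpow_atTop σ hσ')
    have h2 : Tendsto (fun L : ℝ => Real.log L ^ σ / L ^ (1 - σ)) atTop (𝓝[>] 0) := by
      refine tendsto_nhdsWithin_iff.2 ⟨h1.tendsto_div_nhds_zero, ?_⟩
      filter_upwards [eventually_gt_atTop 1] with L hL
      have := Real.log_pos hL
      exact mem_Ioi.2 (by positivity)
    refine h2.inv_tendsto_nhdsGT_zero.congr fun L => ?_
    simp
  refine exists_isGreatest_of_hasResonator l hσ.le hσ1 hβ hκ (by linarith)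
    (g := fun T => F (Real.log T)) ?_ fun K => ?_
  · exact Real.tendsto_log_atTop.eventually (hFlim.eventually_ge_atTop 0)
  suffices hL : ∀ᶠ L : ℝ in atTop, HasResonator σ (κ * L) (L ^ (3 / 4 : ℝ)) (F L + K) from
    Real.tendsto_log_atTop.eventually hL
  have hκ32 : 0 < κ / 32 := by positivity
  have hlog1 : ∀ᶠ L : ℝ in atTop, (κ / 32 * L * Real.log L) ≤ L ^ (5 / 4 : ℝ) := by
    have h1 := (isLittleO_log_rpow_atTop (show (0 : ℝ) < 1 / 4 by norm_num)).def
      (show (0 : ℝ) < (κ / 32)⁻¹ by positivity)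
    filter_upwards [h1, eventually_gt_atTop 0] with L h2 hL
    rw [Real.norm_of_nonneg (by positivity : (0 : ℝ) ≤ L ^ (1 / 4 : ℝ))] at h2
    have h3 := (Real.le_norm_self _).trans h2
    have h4 : L ^ (5 / 4 : ℝ) = L * L ^ (1 / 4 : ℝ) := by
      rw [show (5 / 4 : ℝ) = 1 + 1 / 4 by norm_num, Real.rpow_add hL, Real.rpow_one]
    rw [h4, mul_assoc, mul_left_comm]
    refine mul_le_mul_of_nonneg_left ?_ hL.le
    calc κ / 32 * Real.log L ≤ κ / 32 * ((κ / 32)⁻¹ * L ^ (1 / 4 : ℝ)) := by gcongr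
      _ = L ^ (1 / 4 : ℝ) := by rw [mul_inv_cancel_left₀ hκ32.ne']
  filter_upwards [(tendsto_mul_loglog_atTop hκ32).eventually (h σ hσ.le hσ1), hlog1,
    log_length_le_eventually,
    hFlim.eventually_ge_atTop K, eventually_gt_atTop 1,
    Real.tendsto_log_atTop.eventually_ge_atTop 1,
    (tendsto_rpow_atTop (show (0 : ℝ) < 1 / 2 by norm_num)).eventually_ge_atTop (32 / κ)]
    with L hres h1 h2 h3 hL hlogL h6
  have hL0 : 0 < L := by linarith
  have hl0 : 0 < Real.log L := by linarith
  -- Since `log w ≥ log L / 2`, the cost `16 w / log w` is at most `κ * L`.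
  set w := κ / 32 * L * Real.log L with hw
  have hw0 : 0 < w := by positivity
  have hlw_le : Real.log w ≤ 2 * Real.log L := by
    refine (Real.log_le_log hw0 h1).trans ?_
    rw [Real.log_rpow hL0]
    linarith
  have hlw_ge : Real.log L / 2 ≤ Real.log w := by
    have : L ^ (1 / 2 : ℝ) ≤ w := by
      have e1 : L = L ^ (1 / 2 : ℝ) * L ^ (1 / 2 : ℝ) := by
        rw [← Real.rpow_add hL0]; norm_num
      have e2 : 1 ≤ κ / 32 * L ^ (1 / 2 : ℝ) := by
        rw [div_le_iff₀ hκ] at h6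
        linarith
      calc L ^ (1 / 2 : ℝ) ≤ (κ / 32 * L ^ (1 / 2 : ℝ)) * L ^ (1 / 2 : ℝ) :=
            le_mul_of_one_le_left (by positivity) e2
        _ = κ / 32 * L := by rw [mul_assoc, ← e1]
        _ ≤ w := le_mul_of_one_le_right (by positivity) hlogL
    have h7 := Real.log_le_log (by positivity) this
    rw [Real.log_rpow hL0] at h7
    linarith
  have hlw0 : 0 < Real.log w := by linarith
  refine hres.mono ?_ ?_ ?_
  · rw [div_le_iff₀ hlw0, hw]
    calc 16 * (κ / 32 * L * Real.log L) = κ * L * (Real.log L / 2) := by ring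
      _ ≤ _ := by gcongr
  · refine le_trans ?_ h2
    have : Real.sqrt w ≤ L ^ (5 / 8 : ℝ) := by
      rw [Real.sqrt_le_left (by positivity), ← Real.rpow_natCast, ← Real.rpow_mul hL0.le]
      norm_num
      exact h1
    gcongr
  · have hκr : κ ^ (1 - σ) / 32 ≤ (κ / 32) ^ (1 - σ) := by
      rw [Real.div_rpow hκ.le (by norm_num)]
      gcongr
      calc (32 : ℝ) ^ (1 - σ) ≤ 32 ^ (1 : ℝ) :=
            Real.rpow_le_rpow_of_exponent_le (by norm_num) (by linarith)
        _ = 32 := Real.rpow_one _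
    have e1 : w ^ (1 - σ) = (κ / 32) ^ (1 - σ) * L ^ (1 - σ) * Real.log L ^ (1 - σ) := by
      rw [hw, Real.mul_rpow (by positivity) hl0.le, Real.mul_rpow (by positivity) hL0.le]
    have e2 : Real.log L ^ (1 - σ) = Real.log L / Real.log L ^ σ := by
      rw [Real.rpow_sub hl0, Real.rpow_one]
    calc F L + K ≤ 2 * F L := by linarith
      _ = C * ((κ ^ (1 - σ) / 32) * L ^ (1 - σ) * (Real.log L / Real.log L ^ σ) /
          ((1 - σ) * (2 * Real.log L))) := by
          simp only [hF]
          field_simp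
          ring
      _ ≤ C * ((κ / 32) ^ (1 - σ) * L ^ (1 - σ) * (Real.log L / Real.log L ^ σ) /
          ((1 - σ) * Real.log w)) := by gcongr
      _ = _ := by rw [e1, e2]

end

/-! ### The resonator for the critical line. -/

section

open Complex Filter Topology Set

/-- The index `n` of the block `(y e^((n-1)H), y e^(nH)]` containing `p`. -/
noncomputable def blockIndex (y H : ℝ) (p : ℕ) : ℕ := ⌈Real.log (p / y) / H⌉₊

/-- The endpoints of the blocks. -/
noncomputable def blockEnd (y H : ℝ) (k : ℕ) : ℝ := y * Real.exp (k * H)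

lemma blockEnd_nonneg {y : ℝ} (hy : 0 ≤ y) (H : ℝ) (k : ℕ) : 0 ≤ blockEnd y H k :=
  mul_nonneg hy (Real.exp_pos _).le

lemma monotone_blockEnd {y H : ℝ} (hy : 0 ≤ y) (hH : 0 ≤ H) : Monotone (blockEnd y H) := by
  intro a b hab
  have : (a : ℝ) ≤ b := by exact_mod_cast hab
  unfold blockEnd
  gcongr

lemma blockEnd_succ (y H : ℝ) (k : ℕ) : blockEnd y H (k + 1) = blockEnd y H k * Real.exp H := by
  rw [blockEnd, blockEnd, mul_assoc, ← Real.exp_add]; push_cast; ring_nf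

lemma log_blockEnd {y : ℝ} (hy : 0 < y) (H : ℝ) (k : ℕ) :
    Real.log (blockEnd y H k) = Real.log y + k * H := by
  rw [blockEnd, Real.log_mul hy.ne' (Real.exp_pos _).ne', Real.log_exp]

lemma blockIndex_eq {y H : ℝ} (hy : 0 < y) (hH : 0 < H) {k p : ℕ}
    (hp : p ∈ primesIoc (blockEnd y H k) (blockEnd y H (k + 1))) : blockIndex y H p = k + 1 := by
  obtain ⟨hpp, h1, h2⟩ := (mem_primesIoc (blockEnd_nonneg hy.le H _)).1 hp
  have hp0 : 0 < (p : ℝ) := by exact_mod_cast hpp.pos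
  have h3 := Real.log_lt_log (by unfold blockEnd; positivity) h1
  have h4 := Real.log_le_log hp0 h2
  rw [log_blockEnd hy] at h3 h4
  rw [blockIndex, Nat.ceil_eq_iff (Nat.succ_ne_zero k), Real.log_div hp0.ne' hy.ne', lt_div_iff₀ hH,
    div_le_iff₀ hH]
  push_cast at h4 ⊢
  constructor <;> linarith

lemma sum_primesIoc_mul_blockIndex {y H : ℝ} (hy : 0 < y) (hH : 0 < H) (f : ℕ → ℝ) {N : ℕ}
    (hN : 1 ≤ N) :
    ∑ p ∈ primesIoc (blockEnd y H 1) (blockEnd y H N), (p : ℝ)⁻¹ * f (blockIndex y H p) =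
      ∑ k ∈ Finset.Ico 1 N, f (k + 1) *
        ∑ p ∈ primesIoc (blockEnd y H k) (blockEnd y H (k + 1)), (p : ℝ)⁻¹ := by
  rw [sum_primesIoc_eq_sum_blocks _ (monotone_blockEnd hy.le hH.le) (blockEnd_nonneg hy.le H) hN]
  refine Finset.sum_congr rfl fun k _ => ?_
  rw [Finset.mul_sum]
  refine Finset.sum_congr rfl fun p hp => ?_
  rw [blockIndex_eq hy hH hp, mul_comm]

lemma sum_Ico_inv_bounds {N : ℕ} (hN : 1 ≤ N) :
    Real.log (N + 1 : ℕ) - 1 ≤ ∑ k ∈ Finset.Ico 1 N, ((k + 1 : ℕ) : ℝ)⁻¹ ∧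
      ∑ k ∈ Finset.Ico 1 N, ((k + 1 : ℕ) : ℝ)⁻¹ ≤ Real.log N := by
  have h1 := log_add_one_le_harmonic N
  have h2 := harmonic_le_one_add_log N
  have h3 : ((harmonic N : ℚ) : ℝ) = 1 + ∑ k ∈ Finset.Ico 1 N, ((k + 1 : ℕ) : ℝ)⁻¹ := by
    rw [harmonic, Finset.range_eq_Ico, Finset.sum_eq_sum_Ico_succ_bot (by omega)]
    push_cast
    simp
  rw [h3] at h1 h2
  constructor <;> linarith

section

variable {C η H y : ℝ}

/-- All blocks lie between `y` and `y ^ (1 + η)`, and the Mertens error is at most `η * H`; so each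
block has reciprocal sum `H / log y` up to factors close to 1, and a weight depending on the block
index alone can be summed over the indices. -/
lemma sum_blocks_bounds (hC : ∀ u H : ℝ, 1 < u → 0 ≤ H →
      (H - C) / (Real.log u + H) ≤ ∑ p ∈ primesIoc u (u * Real.exp H), (p : ℝ)⁻¹ ∧
      ∑ p ∈ primesIoc u (u * Real.exp H), (p : ℝ)⁻¹ ≤ (H + C) / Real.log u)
    (hη : 0 < η) (hη1 : η ≤ 1 / 20) (hH : 0 < H) (hCH : C ≤ η * H) (hy : 1 < y) {N : ℕ} (hN : 1 ≤ N)
    (hNH : N * H ≤ η * Real.log y) {f : ℕ → ℝ} (hf : ∀ n, 0 ≤ f n) :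
    (1 - η) * H / ((1 + η) * Real.log y) * ∑ k ∈ Finset.Ico 1 N, f (k + 1) ≤
      ∑ p ∈ primesIoc (blockEnd y H 1) (blockEnd y H N), (p : ℝ)⁻¹ * f (blockIndex y H p) ∧
    ∑ p ∈ primesIoc (blockEnd y H 1) (blockEnd y H N), (p : ℝ)⁻¹ * f (blockIndex y H p) ≤
      (1 + η) * H / Real.log y * ∑ k ∈ Finset.Ico 1 N, f (k + 1) := by
  have hy0 : 0 < y := by linarith
  have hL := Real.log_pos hy
  rw [sum_primesIoc_mul_blockIndex hy0 hH f hN, Finset.mul_sum, Finset.mul_sum]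
  have hblock : ∀ k ∈ Finset.Ico 1 N, (1 - η) * H / ((1 + η) * Real.log y) ≤
      ∑ p ∈ primesIoc (blockEnd y H k) (blockEnd y H (k + 1)), (p : ℝ)⁻¹ ∧
      ∑ p ∈ primesIoc (blockEnd y H k) (blockEnd y H (k + 1)), (p : ℝ)⁻¹ ≤
        (1 + η) * H / Real.log y := by
    intro k hk
    have hkN : ((k + 1 : ℕ) : ℝ) ≤ N := by exact_mod_cast (Finset.mem_Ico.1 hk).2
    have h1 : 1 < blockEnd y H k := hy.trans_le
      (le_mul_of_one_le_right hy0.le (Real.one_le_exp (by positivity)))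
    have h2 := hC _ H h1 hH.le
    rw [← blockEnd_succ, log_blockEnd hy0] at h2
    have h3 : Real.log y + k * H + H ≤ (1 + η) * Real.log y := by
      have := mul_le_mul_of_nonneg_right hkN hH.le
      push_cast at this
      linarith
    have h4 : 0 ≤ k * H := by positivity
    constructor
    · refine le_trans ?_ h2.1
      refine div_le_div₀ (by nlinarith) (by linarith) (by positivity) h3
    · refine h2.2.trans ?_
      refine div_le_div₀ (by positivity) (by linarith) hL (by linarith)
  constructor
  · refine Finset.sum_le_sum fun k hk => ?_
    rw [mul_comm]
    exact mul_le_mul_of_nonneg_left (hblock k hk).1 (hf _)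
  · refine Finset.sum_le_sum fun k hk => ?_
    rw [mul_comm _ (f _)]
    exact mul_le_mul_of_nonneg_left (hblock k hk).2 (hf _)

lemma mul_one_add_le_one (hη : 0 ≤ η) (hη1 : η ≤ 1 / 20) : η * (1 + η) ≤ 1 := by nlinarith

lemma half_le_coeff (hη : 0 ≤ η) (hη1 : η ≤ 1 / 20) : 1 / 2 ≤ (1 - η) ^ 2 / (1 + η) := by
  rw [le_div_iff₀ (by linarith)]; nlinarith

lemma cost_coeff_le (hη : 0 ≤ η) (hη1 : η ≤ 1 / 20) :
    2 * (1 + η) ^ 4 + 2 * η * (1 + η) ≤ 2 + 20 * η := by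
  have h2 : η ^ 2 ≤ η / 20 := by nlinarith
  have h3 : η ^ 3 ≤ η / 20 := by nlinarith
  have h4 : η ^ 4 ≤ η / 20 := by nlinarith
  linarith

lemma le_gain_coeff (hη : 0 ≤ η) :
    2 - 20 * η ≤ 2 / (1 + η) * ((1 - η) ^ 2 / (1 + η)) := by
  rw [div_mul_div_comm, le_div_iff₀ (by positivity)]
  nlinarith [pow_nonneg hη 3, pow_nonneg hη 2]

set_option maxHeartbeats 4000000 in
/-- The resonator for the critical line, with explicit conditions on the parameters. -/
lemma hasResonator_half_of_le (hC : ∀ u H : ℝ, 1 < u → 0 ≤ H →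
      (H - C) / (Real.log u + H) ≤ ∑ p ∈ primesIoc u (u * Real.exp H), (p : ℝ)⁻¹ ∧
      ∑ p ∈ primesIoc u (u * Real.exp H), (p : ℝ)⁻¹ ≤ (H + C) / Real.log u)
    (hη : 0 < η) (hη1 : η ≤ 1 / 20) (hH : 1 ≤ η * H) (hCH : C ≤ η * H)
    (hHlog : ∀ v, H ≤ v → 2 * Real.log v ≤ η * v) (hy : 1 < y)
    (hL1 : H ≤ η * Real.log y)
    (hL2 : (1 - η) * Real.log (Real.log y) ≤ Real.log (η * Real.log y / H) - 1)
    (hL3 : 9 * Real.log (Real.log y) ≤ Real.log y) (hL4 : 1 ≤ Real.log (Real.log y))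
    (hL5 : 12 * Real.log y ≤ η * Real.sqrt y) :
    HasResonator (1 / 2) ((2 + 20 * η) * (y * Real.log (Real.log y) / Real.log y))
      ((Real.sqrt y + 1) * (2 * Real.log y))
      ((2 - 20 * η) * (Real.sqrt y * Real.log (Real.log y) / Real.log y)) := by
  set L := Real.log y with hLdef
  set l := Real.log L
  -- The blocks stop near `y ^ (1 + η)`: the harmonic sum up to `η L / H` is already `log L` to
  -- leading order, so going further gains nothing, while `log p` stays close to `L`.
  set N := ⌊η * L / H⌋₊ with hN
  set P := primesIoc (blockEnd y H 1) (blockEnd y H N) with hP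
  have hy0 : 0 < y := by linarith
  have hL0 : 0 < L := Real.log_pos hy
  have hL9 : 9 ≤ L := by linarith
  have hη2 : η * (1 + η) ≤ 1 := mul_one_add_le_one hη.le hη1
  have hcoef := half_le_coeff hη.le hη1
  have hH0 : 0 < H := by
    by_contra hcon
    have := mul_nonpos_of_nonneg_of_nonpos hη.le (not_lt.1 hcon)
    linarith
  have hH20 : 20 ≤ H := by linarith [mul_le_mul_of_nonneg_right hη1 hH0.le]
  have hN1 : 1 ≤ N := Nat.le_floor (by rw [Nat.cast_one, one_le_div hH0]; exact hL1)
  have hNle : N ≤ η * L / H := Nat.floor_le (by positivity)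
  have hNH : N * H ≤ η * L := by rwa [← le_div_iff₀ hH0]
  have hs0 : 0 < Real.sqrt y := Real.sqrt_pos.2 hy0
  have hss : Real.sqrt y * Real.sqrt y = y := Real.mul_self_sqrt hy0.le
  have hs240 : 240 ≤ Real.sqrt y := by linarith [mul_le_mul_of_nonneg_right hη1 hs0.le]
  -- A discretised `log (p / y)`, rounded up to a multiple of `H`. The first block is omitted, so `v
  -- p ≥ 2 H`, which makes the weights small.
  set v : ℕ → ℝ := fun p => H * blockIndex y H p with hv
  have hmem : ∀ p ∈ P, p.Prime ∧ y ≤ p ∧ Real.log (p / y) ≤ v p ∧ 2 * H ≤ v p ∧ v p ≤ N * H ∧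
      (p : ℝ) ≤ y ^ 2 := by
    intro p hp
    obtain ⟨hpp, h1, h2⟩ := (mem_primesIoc (blockEnd_nonneg hy0.le H _)).1 hp
    have hp0 : 0 < (p : ℝ) := by exact_mod_cast hpp.pos
    have h3 := Real.log_lt_log (by unfold blockEnd; positivity) h1
    have h4 := Real.log_le_log hp0 h2
    rw [log_blockEnd hy0] at h3 h4
    have h5 : Real.log (p / y) = Real.log p - L := Real.log_div hp0.ne' hy0.ne'
    rw [Nat.cast_one, one_mul] at h3
    have h6 : (1 : ℝ) < Real.log (p / y) / H := by rw [lt_div_iff₀ hH0]; linarith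
    have h7 : 2 ≤ blockIndex y H p := by
      have : 1 < blockIndex y H p := Nat.lt_ceil.2 (by rwa [Nat.cast_one])
      omega
    have h8 : blockIndex y H p ≤ N := Nat.ceil_le.2 (by rw [div_le_iff₀ hH0]; linarith)
    have h9 : (2 : ℝ) ≤ blockIndex y H p := by exact_mod_cast h7
    have h10 : (blockIndex y H p : ℝ) ≤ N := by exact_mod_cast h8
    refine ⟨hpp, ?_, ?_, ?_, ?_, ?_⟩
    · rw [← Real.log_le_log_iff hy0 hp0]; linarith
    · have := Nat.le_ceil (Real.log (p / y) / H)
      rwa [div_le_iff₀' hH0] at this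
    · rw [mul_comm]; exact mul_le_mul_of_nonneg_left h9 hH0.le
    · rw [mul_comm (N : ℝ)]; exact mul_le_mul_of_nonneg_left h10 hH0.le
    · rw [← Real.log_le_log_iff hp0 (by positivity), Real.log_pow]
      push_cast
      linarith [mul_le_mul_of_nonneg_right hη1 hL0.le]
  -- Gain and cost are both multiples of this sum, about `2 √y * U` and `2 y * U`, and `U` is close
  -- to `log L / L`.
  set U := ∑ p ∈ P, (p : ℝ)⁻¹ * (v p)⁻¹ with hU
  set l' := ∑ k ∈ Finset.Ico 1 N, ((k + 1 : ℕ) : ℝ)⁻¹ with hl'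
  have hl'b := sum_Ico_inv_bounds hN1
  have hl'up : l' ≤ l := by
    refine hl'b.2.trans (Real.log_le_log (by positivity) ?_)
    refine hNle.trans (div_le_of_le_mul₀ hH0.le hL0.le ?_)
    linarith [mul_le_mul_of_nonneg_right hη1 hL0.le,
      le_mul_of_one_le_right hL0.le (show 1 ≤ H by linarith)]
  have hl'lo : (1 - η) * l ≤ l' := by
    refine hL2.trans (le_trans ?_ hl'b.1)
    have := Real.log_le_log (by positivity) (Nat.lt_floor_add_one (η * L / H)).le
    push_cast
    linarith
  have hUb := sum_blocks_bounds hC hη hη1 hH0 hCH hy hN1 hNH (f := fun n => (H * (n : ℝ))⁻¹)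
    (fun n => by positivity)
  have hsumf : ∑ k ∈ Finset.Ico 1 N, (H * ((k + 1 : ℕ) : ℝ))⁻¹ = H⁻¹ * l' := by
    rw [hl', Finset.mul_sum]
    exact Finset.sum_congr rfl fun k _ => mul_inv _ _
  rw [hsumf] at hUb
  have hUlo : (1 - η) ^ 2 / (1 + η) * (l / L) ≤ U := by
    refine le_trans ?_ hUb.1
    have : (1 - η) * H / ((1 + η) * L) * (H⁻¹ * l') = (1 - η) / ((1 + η) * L) * l' := by
      field_simp
    rw [this]
    calc _ = (1 - η) / ((1 + η) * L) * ((1 - η) * l) := by field_simp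
      _ ≤ _ := mul_le_mul_of_nonneg_left hl'lo (div_nonneg (by linarith) (by positivity))
  have hUup : U ≤ (1 + η) * (l / L) := by
    refine hUb.2.trans ?_
    have : (1 + η) * H / L * (H⁻¹ * l') = (1 + η) / L * l' := by field_simp
    rw [this]
    calc _ ≤ (1 + η) / L * l := by gcongr
      _ = _ := by ring
  have hS := (sum_blocks_bounds hC hη hη1 hH0 hCH hy hN1 hNH (f := fun _ => 1)
    (fun n => zero_le_one)).2
  simp only [mul_one, Finset.sum_const, Nat.card_Ico, nsmul_eq_mul] at hS
  set S := ∑ p ∈ P, (p : ℝ)⁻¹ with hSdef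
  have hS1 : S ≤ 1 := by
    refine hS.trans ?_
    have : ((N - 1 : ℕ) : ℝ) ≤ N := by exact_mod_cast Nat.sub_le N 1
    rw [div_mul_eq_mul_div, div_le_one hL0]
    calc (1 + η) * H * ((N - 1 : ℕ) : ℝ) ≤ (1 + η) * H * N := by gcongr
      _ = (1 + η) * (N * H) := by ring
      _ ≤ (1 + η) * (η * L) := by gcongr
      _ = η * (1 + η) * L := by ring
      _ ≤ L := mul_le_of_le_one_left hL0.le hη2
  have hlL : 0 < l / L := by positivity
  have hlL9 : l / L ≤ 1 / 9 := by rw [div_le_iff₀ hL0]; linarith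
  have hLl : 1 / L ≤ l / L := by gcongr
  have hU2 : 1 / (2 * L) ≤ U := by
    refine le_trans ?_ hUlo
    calc 1 / (2 * L) = 1 / 2 * (1 / L) := by field_simp
      _ ≤ _ := mul_le_mul hcoef hLl (by positivity) (by linarith)
  have hU0 : 0 < U := lt_of_lt_of_le (by positivity) hU2
  have hsmall1 : Real.sqrt y ≤ η * (2 * y * U) := by
    have h1 : 1 ≤ 2 * L * U := by
      rw [div_le_iff₀ (by positivity)] at hU2; linarith
    have h2 : L ≤ η * Real.sqrt y := by linarith
    calc Real.sqrt y ≤ Real.sqrt y * (2 * L * U) := le_mul_of_one_le_right hs0.le h1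
      _ ≤ Real.sqrt y * (2 * (η * Real.sqrt y) * U) := by gcongr
      _ = η * (2 * (Real.sqrt y * Real.sqrt y) * U) := by ring
      _ = _ := by rw [hss]
  have hsmall2 : 6 * L / η ≤ η * (y * U) := by
    rw [div_le_iff₀ hη]
    have h1 : 1 ≤ 2 * L * U := by
      rw [div_le_iff₀ (by positivity)] at hU2; linarith
    have h3 : 12 * L * (12 * L) ≤ η * Real.sqrt y * (η * Real.sqrt y) := by gcongr
    have h4 : η * Real.sqrt y * (η * Real.sqrt y) = η ^ 2 * y := by rw [mul_mul_mul_comm, hss, sq]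
    have h5 : 12 * L * L ≤ η ^ 2 * y := by linarith [mul_pos hL0 hL0]
    calc 6 * L ≤ 6 * L * (2 * L * U) := le_mul_of_one_le_right (by positivity) h1
      _ = 12 * L * L * U := by ring
      _ ≤ η ^ 2 * y * U := by gcongr
      _ = _ := by ring
  have hprops : ∀ p ∈ P, 0 < (p : ℝ) ∧ 0 < v p ∧ 1 ≤ v p := fun p hp => by
    obtain ⟨h1, h2, h3, h4, h5, h6⟩ := hmem p hp
    exact ⟨by linarith, by linarith, by linarith⟩
  set θ : ℕ → ℝ := fun p => Real.sqrt (y / p) / v p with hθ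
  -- Chosen so that `exp (-c p) = θ p ^ 2`. The term `2 log (v p)` is at most `η * v p`, so `c p` is
  -- essentially `v p`.
  set c : ℕ → ℝ := fun p => Real.log (p / y) + 2 * Real.log (v p) with hc
  have hθsq : ∀ p ∈ P, θ p ^ 2 = y * ((p : ℝ)⁻¹ * (v p)⁻¹) * (v p)⁻¹ := fun p hp => by
    obtain ⟨h1, h2, h3⟩ := hprops p hp
    simp only [hθ]
    rw [div_pow, Real.sq_sqrt (by positivity)]
    field_simp
  have hxθ : ∀ p ∈ P, (p : ℝ) ^ (-(1 / 2) : ℝ) * θ p = Real.sqrt y * ((p : ℝ)⁻¹ * (v p)⁻¹) :=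
    fun p hp => by
    obtain ⟨h1, h2, h3⟩ := hprops p hp
    have h4 : 0 < Real.sqrt p := Real.sqrt_pos.2 h1
    simp only [hθ]
    rw [Real.rpow_neg h1.le, ← Real.sqrt_eq_rpow, Real.sqrt_div hy0.le]
    have h5 : (p : ℝ)⁻¹ = (Real.sqrt p)⁻¹ * (Real.sqrt p)⁻¹ := by
      rw [← mul_inv, Real.mul_self_sqrt h1.le]
    rw [h5]
    field_simp
  have hc0 : ∀ p ∈ P, 0 ≤ c p := fun p hp => by
    obtain ⟨h1, h2, h3⟩ := hprops p hp
    exact add_nonneg (Real.log_nonneg ((one_le_div hy0).2 (hmem p hp).2.1))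
      (mul_nonneg zero_le_two (Real.log_nonneg h3))
  have hcv : ∀ p ∈ P, c p ≤ (1 + η) * v p := fun p hp => by
    obtain ⟨h1, h2, h3, h4, h5, h6⟩ := hmem p hp
    have := hHlog (v p) (by linarith)
    simp only [hc]
    linarith
  have hexpc : ∀ p ∈ P, Real.exp (-c p) = θ p ^ 2 := fun p hp => by
    obtain ⟨h1, h2, h3⟩ := hprops p hp
    rw [hθsq p hp]
    simp only [hc]
    rw [neg_add, Real.exp_add, ← Real.log_inv, Real.exp_log (by positivity), Real.exp_neg, two_mul,
      Real.exp_add, Real.exp_log h2]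
    field_simp
  -- Small enough that `δ * c p ≤ η` and `exp (δ c) - 1` is nearly linear, yet large enough that the
  -- price `3 / δ = 6 L / η` is negligible against `y * U`.
  set δ := η / (2 * L) with hδ
  have hδ0 : 0 < δ := by positivity
  have hexpδ : ∀ p ∈ P, Real.exp (δ * c p) - 1 ≤ δ * ((1 + η) ^ 2 * v p) := fun p hp => by
    obtain ⟨h1, h2, h3, h4, h5, h6⟩ := hmem p hp
    have hz0 : 0 ≤ δ * c p := mul_nonneg hδ0.le (hc0 p hp)
    have hz1 : δ * c p ≤ η := by
      calc δ * c p ≤ δ * ((1 + η) * (η * L)) := by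
            have := hcv p hp
            have : (1 + η) * v p ≤ (1 + η) * (η * L) := by gcongr; linarith
            gcongr; linarith
        _ = η * (η * (1 + η) / 2) := by rw [hδ]; field_simp
        _ ≤ η := mul_le_of_le_one_right hη.le (by linarith)
    have h7 := (abs_le.1 (Real.abs_exp_sub_one_sub_id_le (x := δ * c p)
      (by rw [abs_of_nonneg hz0]; linarith))).2
    calc Real.exp (δ * c p) - 1 ≤ (1 + η) * (δ * c p) := by
          linarith [mul_le_mul_of_nonneg_right hz1 hz0, sq (δ * c p)]
      _ ≤ (1 + η) * (δ * ((1 + η) * v p)) := by gcongr; exact hcv p hp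
      _ = _ := by ring
  refine ⟨P, θ, c, 2 * (1 + η) ^ 3 * (y * U) + 6 * L / η, δ, ⌈Real.sqrt y⌉₊, y ^ 2,
    fun p hp => (hmem p hp).1, fun p hp => div_nonneg (Real.sqrt_nonneg _) (hprops p hp).2.1.le,
    hc0, hδ0.le, ?_, ?_, one_le_pow₀ hy.le, fun p hp => (hmem p hp).2.2.2.2.2, ?_, ?_, ?_⟩
  · have h1 : ∀ p ∈ P, (2 * θ p ^ 2 + (p : ℝ) ^ (-(1 / 2) : ℝ) * θ p) * (Real.exp (δ * c p) - 1) ≤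
        δ * (1 + η) ^ 2 * (2 * y * ((p : ℝ)⁻¹ * (v p)⁻¹) + Real.sqrt y * (p : ℝ)⁻¹) := fun p hp => by
      obtain ⟨h2, h3, h4⟩ := hprops p hp
      rw [hθsq p hp, hxθ p hp]
      refine (mul_le_mul_of_nonneg_left (hexpδ p hp) (by positivity)).trans (le_of_eq ?_)
      field_simp
    have h2 := Finset.sum_le_sum h1
    rw [← Finset.mul_sum, Finset.sum_add_distrib, ← Finset.mul_sum, ← Finset.mul_sum, ← hU, ← hSdef]
      at h2
    have h3 : 2 * y * U + Real.sqrt y * S ≤ (1 + η) * (2 * y * U) := by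
      linarith [mul_le_of_le_one_right hs0.le hS1]
    have h4 : δ * (1 + η) ^ 2 * (2 * y * U + Real.sqrt y * S) ≤
        δ * (1 + η) ^ 2 * ((1 + η) * (2 * y * U)) := by gcongr
    have h5 : δ * (6 * L / η) = 3 := by rw [hδ]; field_simp; norm_num
    rw [mul_add, h5]
    have h6 : δ * (1 + η) ^ 2 * ((1 + η) * (2 * y * U)) = δ * (2 * (1 + η) ^ 3 * (y * U)) := by ring
    linarith
  · refine le_trans ?_ (Nat.le_ceil _)
    rw [Finset.sum_congr rfl fun p hp => by rw [hxθ p hp], ← Finset.mul_sum, ← Finset.mul_sum, ← hU]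
    have h1 : U ≤ 1 / 8 := by
      linarith [mul_le_mul (show 1 + η ≤ 21 / 20 by linarith) hlL9 hlL.le (by norm_num)]
    linarith [mul_le_mul_of_nonneg_left h1 hs0.le]
  · rw [Real.log_pow]
    push_cast
    gcongr
    exact (Nat.ceil_lt_add_one hs0.le).le
  · have h1 : ∑ p ∈ P, Real.exp (-c p) ≤ η / 2 * (y * U) := by
      rw [hU, Finset.mul_sum, Finset.mul_sum]
      refine Finset.sum_le_sum fun p hp => ?_
      obtain ⟨h2, h3, h4⟩ := hprops p hp
      rw [hexpc p hp, hθsq p hp, mul_comm]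
      refine mul_le_mul_of_nonneg_right ?_ (by positivity)
      rw [inv_le_iff_one_le_mul₀ h3]
      linarith [mul_le_mul_of_nonneg_left (hmem p hp).2.2.2.1 hη.le]
    have hyU : y * U ≤ y * ((1 + η) * (l / L)) := by gcongr
    calc 2 * (1 + η) ^ 3 * (y * U) + 6 * L / η + 2 * ∑ p ∈ P, Real.exp (-c p) ≤
        (2 * (1 + η) ^ 3 + 2 * η) * (y * U) := by linarith
      _ ≤ (2 * (1 + η) ^ 3 + 2 * η) * (y * ((1 + η) * (l / L))) := by gcongr
      _ = (2 * (1 + η) ^ 4 + 2 * η * (1 + η)) * (y * l / L) := by ring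
      _ ≤ _ := by
        exact mul_le_mul_of_nonneg_right (cost_coeff_le hη.le hη1) (by positivity)
  · have h1 : ∀ p ∈ P, 2 / (1 + η) * (Real.sqrt y * ((p : ℝ)⁻¹ * (v p)⁻¹)) ≤
        2 * ((p : ℝ) ^ (-(1 / 2) : ℝ) * θ p) /
          (1 + 2 * θ p ^ 2 + 2 * ((p : ℝ) ^ (-(1 / 2) : ℝ) * θ p)) := fun p hp => by
      obtain ⟨h2, h3, h4⟩ := hprops p hp
      obtain ⟨-, g1, g2, g3, g4, g5⟩ := hmem p hp
      rw [hxθ p hp]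
      have h5 : θ p ^ 2 ≤ η / 4 := by
        rw [hθsq p hp]
        have e1 : y * (p : ℝ)⁻¹ ≤ 1 := by rw [← div_eq_mul_inv]; exact (div_le_one h2).2 g1
        have e2 : (v p)⁻¹ ≤ η / 2 := by
          rw [inv_le_iff_one_le_mul₀ h3]
          linarith [mul_le_mul_of_nonneg_left g3 hη.le]
        have e3 : 0 < (v p)⁻¹ := by positivity
        calc y * ((p : ℝ)⁻¹ * (v p)⁻¹) * (v p)⁻¹ = (y * (p : ℝ)⁻¹) * ((v p)⁻¹ * (v p)⁻¹) := by ring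
          _ ≤ 1 * (η / 2 * (η / 2)) := by gcongr
          _ ≤ η / 4 := by linarith [mul_le_mul_of_nonneg_left hη1 hη.le]
      have h6 : Real.sqrt y * ((p : ℝ)⁻¹ * (v p)⁻¹) ≤ η / 4 := by
        have e2 : (v p)⁻¹ ≤ 1 := inv_le_one_of_one_le₀ h4
        have e3 : (p : ℝ)⁻¹ ≤ y⁻¹ := inv_anti₀ hy0 g1
        calc Real.sqrt y * ((p : ℝ)⁻¹ * (v p)⁻¹) ≤ Real.sqrt y * (y⁻¹ * 1) := by gcongr
          _ = (Real.sqrt y)⁻¹ := by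
            rw [mul_one]; nth_rewrite 2 [← hss]; rw [mul_inv, mul_inv_cancel_left₀ hs0.ne']
          _ ≤ η / 4 := by
            rw [inv_le_iff_one_le_mul₀ hs0]; linarith
      rw [div_mul_eq_mul_div]
      refine div_le_div_of_nonneg_left (by positivity) (by positivity) (by linarith)
    refine le_trans ?_ (Finset.sum_le_sum h1)
    rw [← Finset.mul_sum, ← Finset.mul_sum, ← hU]
    have h2 := le_gain_coeff hη.le
    calc (2 - 20 * η) * (Real.sqrt y * l / L) ≤
        2 / (1 + η) * ((1 - η) ^ 2 / (1 + η)) * (Real.sqrt y * l / L) :=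
          mul_le_mul_of_nonneg_right h2 (by positivity)
      _ = 2 / (1 + η) * (Real.sqrt y * ((1 - η) ^ 2 / (1 + η) * (l / L))) := by ring
      _ ≤ _ := by gcongr

end

/-- The resonator for the critical line. -/
theorem hasResonator_half {ε : ℝ} (hε : 0 < ε) (hε1 : ε ≤ 1) : ∀ᶠ y : ℝ in atTop,
    HasResonator (1 / 2) ((2 + ε) * (y * Real.log (Real.log y) / Real.log y))
      ((Real.sqrt y + 1) * (2 * Real.log y))
      ((2 - ε) * (Real.sqrt y * Real.log (Real.log y) / Real.log y)) := by
  obtain ⟨C, -, hC⟩ := exists_sum_inv_primesIoc_bounds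
  -- All losses are powers of `1 ± η`; `cost_coeff_le` and `le_gain_coeff` collect them into `20 η =
  -- ε`.
  obtain ⟨η, hη⟩ : ∃ η, η = ε / 20 := ⟨_, rfl⟩
  have hη0 : 0 < η := by rw [hη]; positivity
  have hη1 : η ≤ 1 / 20 := by rw [hη]; linarith
  have hε20 : ε = 20 * η := by rw [hη]; ring
  have hlog : ∀ᶠ v : ℝ in atTop, 2 * Real.log v ≤ η * v := by
    filter_upwards [Real.isLittleO_log_id_atTop.def (show (0 : ℝ) < η / 2 by positivity),
      eventually_ge_atTop 0] with v h1 h2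
    simp only [id, Real.norm_of_nonneg h2] at h1
    linarith [Real.le_norm_self (Real.log v)]
  obtain ⟨v₀, hv₀⟩ := eventually_atTop.1 hlog
  set H := max v₀ (max (1 / η) (C / η)) with hH
  have hH1 : 1 ≤ η * H := by
    rw [← div_le_iff₀' hη0]; exact (le_max_left _ _).trans (le_max_right _ _)
  have hH2 : C ≤ η * H := by
    rw [← div_le_iff₀' hη0]; exact (le_max_right _ _).trans (le_max_right _ _)
  have hH0 : 0 < H := lt_of_lt_of_le (by positivity) ((le_max_left _ _).trans (le_max_right _ _))
  have hL : Tendsto (fun y => Real.log y) atTop atTop := Real.tendsto_log_atTop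
  have hl : Tendsto (fun y => Real.log (Real.log y)) atTop atTop := hL.comp hL
  have hlog9 : ∀ᶠ v : ℝ in atTop, 9 * Real.log v ≤ v := by
    filter_upwards [Real.isLittleO_log_id_atTop.def (show (0 : ℝ) < 1 / 9 by positivity),
      eventually_ge_atTop 0] with v h1 h2
    simp only [id, Real.norm_of_nonneg h2] at h1
    linarith [Real.le_norm_self (Real.log v)]
  have hsqrt : ∀ᶠ y : ℝ in atTop, 12 * Real.log y ≤ η * Real.sqrt y := by
    filter_upwards [(isLittleO_log_rpow_atTop (show (0 : ℝ) < 1 / 2 by norm_num)).def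
      (show (0 : ℝ) < η / 12 by positivity)] with y h1
    rw [← Real.sqrt_eq_rpow, Real.norm_of_nonneg (Real.sqrt_nonneg y)] at h1
    linarith [Real.le_norm_self (Real.log y)]
  filter_upwards [eventually_gt_atTop 1, hL.eventually_ge_atTop (H / η),
    hl.eventually_ge_atTop ((1 - Real.log (η / H)) / η), hL.eventually hlog9,
    hl.eventually_ge_atTop 1, hsqrt, hL.eventually_gt_atTop 0] with y h1 h2 h3 h4 h5 h6 h7
  rw [hε20]
  refine hasResonator_half_of_le hC hη0 hη1 hH1 hH2
    (fun v hv => hv₀ v ((le_max_left _ _).trans hv)) h1 ((div_le_iff₀' hη0).1 h2) ?_ h4 h5 h6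
  rw [mul_div_right_comm, Real.log_mul (by positivity) h7.ne']
  rw [div_le_iff₀ hη0] at h3
  linarith

end

/-! ### Choice of parameters on the critical line, and the theorem. -/

section

open Complex Filter Topology Set

lemma mul_log_le_self_eventually (a : ℝ) : ∀ᶠ v : ℝ in atTop, a * Real.log v ≤ v := by
  filter_upwards [Real.isLittleO_log_id_atTop.def (show (0 : ℝ) < 1 / (|a| + 1) by positivity),
    eventually_ge_atTop 1] with v h1 h2
  simp only [id, Real.norm_of_nonneg (zero_le_one.trans h2)] at h1
  rw [one_div, inv_mul_eq_div, le_div_iff₀ (by positivity)] at h1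
  have h3 := Real.log_nonneg h2
  rw [Real.norm_of_nonneg h3] at h1
  nlinarith [le_abs_self a]

/-- The resonator for the critical line, in terms of its cost. -/
lemma hasResonator_half_of_lt {c κ : ℝ} (hκ : 0 < κ) (hκ1 : κ ≤ 1) (hcκ : c < Real.sqrt (2 * κ))
    (K : ℝ) : ∀ᶠ L : ℝ in atTop, HasResonator (1 / 2) (κ * L) (L ^ (3 / 4 : ℝ))
      (c * Real.sqrt (L * Real.log (Real.log L) / Real.log L) + K) := by
  -- At `ε = 0` the right side is `2 √(κ / 2) = √(2 κ) > c`; continuity provides a positive `ε`.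
  obtain ⟨ε, hε, hε1, hcε⟩ : ∃ ε : ℝ, 0 < ε ∧ ε ≤ 1 ∧
      c < (2 - ε) * Real.sqrt (κ / ((2 + ε) * (1 + ε))) / (1 + ε) := by
    have hcont : ContinuousAt (fun ε : ℝ =>
        (2 - ε) * Real.sqrt (κ / ((2 + ε) * (1 + ε))) / (1 + ε)) 0 := by
      refine ContinuousAt.div (ContinuousAt.mul (by fun_prop) (ContinuousAt.sqrt
        (ContinuousAt.div (by fun_prop) (by fun_prop) (by norm_num)))) (by fun_prop) (by norm_num)
    have h0 : c < (2 - (0 : ℝ)) * Real.sqrt (κ / ((2 + 0) * (1 + 0))) / (1 + 0) := by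
      refine hcκ.trans_eq ?_
      have : 2 * κ = 2 ^ 2 * (κ / 2) := by ring
      rw [this, Real.sqrt_mul (by norm_num), Real.sqrt_sq (by norm_num)]
      norm_num
    have h1 := (hcont.eventually_const_lt h0).filter_mono (nhdsWithin_le_nhds (s := Ioi 0))
    obtain ⟨ε, h2, h3⟩ := (h1.and (Ioc_mem_nhdsGT (show (0 : ℝ) < 1 by norm_num))).exists
    exact ⟨ε, h3.1, h3.2, h2⟩
  -- With `y = a * L * log L / log log L`, the cost `(2 + ε) * y * log log y / log y` is at most `κ
  -- * L`, because `log y ≥ log L` and `log log y ≤ (1 + ε) * log log L`.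
  set a := κ / ((2 + ε) * (1 + ε)) with ha
  have ha0 : 0 < a := by positivity
  have ha1 : a ≤ 1 := by
    rw [ha, div_le_one (by positivity)]
    nlinarith
  set d := (2 - ε) * Real.sqrt a / (1 + ε) - c with hd
  have hd0 : 0 < d := by linarith
  have hlog : Tendsto (fun L : ℝ => Real.log L) atTop atTop := Real.tendsto_log_atTop
  have hlog2 : Tendsto (fun L : ℝ => Real.log (Real.log L)) atTop atTop := hlog.comp hlog
  have hyge : ∀ᶠ L : ℝ in atTop, L ≤ a * (L * (Real.log L / Real.log (Real.log L))) := by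
    filter_upwards [hlog.eventually (mul_log_le_self_eventually (1 / a)), eventually_ge_atTop 0,
      hlog2.eventually_gt_atTop 0] with L h1 h2 h3
    have : 1 / a ≤ Real.log L / Real.log (Real.log L) := (le_div_iff₀ h3).2 h1
    rw [div_le_iff₀' ha0] at this
    rw [mul_left_comm]
    exact le_mul_of_one_le_right h2 this
  have hylim : Tendsto (fun L : ℝ => a * (L * (Real.log L / Real.log (Real.log L)))) atTop atTop :=
    tendsto_atTop_mono' _ hyge tendsto_id
  have hlogpow : ∀ᶠ L : ℝ in atTop, Real.log L ≤ L ^ (1 / 4 : ℝ) := by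
    filter_upwards [(isLittleO_log_rpow_atTop (show (0 : ℝ) < 1 / 4 by norm_num)).def one_pos,
      eventually_ge_atTop 0] with L h1 h2
    rw [one_mul, Real.norm_of_nonneg (by positivity : (0 : ℝ) ≤ L ^ (1 / 4 : ℝ))] at h1
    exact (Real.le_norm_self _).trans h1
  filter_upwards [hylim.eventually (hasResonator_half hε hε1), hyge, log_length_le_eventually,
    hlog2.eventually_ge_atTop 1, hlog2.eventually_ge_atTop (Real.log 2 / ε),
    hlog.eventually (mul_log_le_self_eventually (1 / ε)),
    hlogpow, mul_log_le_self_eventually ((K / d) ^ 2),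
    eventually_gt_atTop 1] with L hres hy1 hY hμ1 hμ2 hμ3 hLlog hLK hL1
  set l := Real.log L
  set μ := Real.log l
  set y := a * (L * (l / μ)) with hy
  have hL0 : 0 < L := by linarith
  have hl0 : 0 < l := Real.log_pos hL1
  have hμ0 : 0 < μ := by linarith
  have hy0 : 0 < y := by positivity
  have hyle : y ≤ L * l := by
    calc y ≤ 1 * (L * (l / 1)) := by rw [hy]; gcongr
      _ = L * l := by ring
  have hly1 : l ≤ Real.log y := Real.log_le_log hL0 hy1
  have hμε : μ ≤ ε * l := by
    rw [one_div, inv_mul_le_iff₀ hε] at hμ3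
    exact hμ3
  have hly2 : Real.log y ≤ (1 + ε) * l := by
    have := Real.log_le_log hy0 hyle
    rw [Real.log_mul hL0.ne' hl0.ne'] at this
    linarith
  have hly3 : Real.log y ≤ 2 * l := hly2.trans (by gcongr; linarith)
  have hly0 : 0 < Real.log y := by linarith
  have hlly1 : μ ≤ Real.log (Real.log y) := Real.log_le_log hl0 hly1
  have hlly2 : Real.log (Real.log y) ≤ (1 + ε) * μ := by
    have h1 := Real.log_le_log hly0 hly3
    rw [Real.log_mul two_ne_zero hl0.ne'] at h1
    rw [div_le_iff₀ hε] at hμ2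
    linarith
  refine hres.mono ?_ ?_ ?_
  · calc (2 + ε) * (y * Real.log (Real.log y) / Real.log y) ≤
        (2 + ε) * (y * ((1 + ε) * μ) / l) := by gcongr
      _ = κ * L := by
        rw [hy, ha]
        field_simp
  · refine le_trans ?_ hY
    have h1 : Real.sqrt y ≤ L ^ (5 / 8 : ℝ) := by
      rw [Real.sqrt_le_left (by positivity), ← Real.rpow_natCast, ← Real.rpow_mul hL0.le]
      refine hyle.trans ?_
      have h3 : L ^ ((5 / 8 : ℝ) * (2 : ℕ)) = L * L ^ (1 / 4 : ℝ) := by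
        rw [← Real.rpow_one_add' hL0.le (by norm_num)]; norm_num
      rw [h3]
      exact mul_le_mul_of_nonneg_left hLlog hL0.le
    calc (Real.sqrt y + 1) * (2 * Real.log y) ≤ (L ^ (5 / 8 : ℝ) + 1) * (2 * (2 * l)) := by gcongr
      _ ≤ (8 * L ^ (5 / 8 : ℝ) + 4) * (2 * l) := by
        have : 0 ≤ L ^ (5 / 8 : ℝ) * l := by positivity
        linarith
  · set R := Real.sqrt (L * μ / l) with hR
    -- The strict gap `d` left by the choice of `ε` pays for the additive constant.
    have hRK : K ≤ d * R := by
      rw [← div_le_iff₀' hd0]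
      refine Real.le_sqrt_of_sq_le ?_
      rw [le_div_iff₀ hl0]
      exact hLK.trans (le_mul_of_one_le_right hL0.le hμ1)
    have hsq : Real.sqrt y * (μ / l) = Real.sqrt a * R := by
      rw [hR, ← Real.sqrt_mul ha0.le, ← Real.sqrt_sq (show 0 ≤ μ / l by positivity),
        ← Real.sqrt_mul hy0.le, hy]
      congr 1
      field_simp
    calc c * R + K ≤ (c + d) * R := by linarith
      _ = (2 - ε) / (1 + ε) * (Real.sqrt a * R) := by rw [hd]; ring
      _ = (2 - ε) * (Real.sqrt y * μ / ((1 + ε) * l)) := by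
        rw [← hsq]; field_simp
      _ ≤ (2 - ε) * (Real.sqrt y * Real.log (Real.log y) / Real.log y) := by
        have : 0 ≤ 2 - ε := by linarith
        have : 0 ≤ Real.log (Real.log y) := by linarith
        gcongr

/-- The extreme values of `ζ^(l)` on the critical line. -/
theorem extreme_values_critical_line (l : ℕ) {β c : ℝ} (hβ : 0 ≤ β) (hc : 0 < c)
    (hcβ : c < Real.sqrt (2 * (1 - β))) : ∀ᶠ T : ℝ in atTop, ∃ M : ℝ,
      IsGreatest ((fun t : ℝ => ‖iteratedDeriv l riemannZeta ((1 / 2 : ℂ) + (t : ℂ) * I)‖) ''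
        Icc (T ^ β) T) M ∧
      Real.exp (c * Real.sqrt
        (Real.log T * Real.log (Real.log (Real.log T)) / Real.log (Real.log T))) ≤ M := by
  rw [Real.lt_sqrt hc.le] at hcβ
  -- The hypothesis on `c` reads `c ^ 2 / 2 < 1 - β`; any `κ` strictly between leaves both `c < √(2
  -- κ)` and `β + κ < 1`.
  obtain ⟨κ, hκ1, hκ2⟩ := exists_between (show c ^ 2 / 2 < 1 - β by linarith)
  have hκ : 0 < κ := lt_trans (by positivity) hκ1
  have h := exists_isGreatest_of_hasResonator l (σ := 1 / 2) le_rfl (by norm_num) hβ hκ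
    (by linarith) (g := fun T => c * Real.sqrt
        (Real.log T * Real.log (Real.log (Real.log T)) / Real.log (Real.log T)))
    (Eventually.of_forall fun T => by positivity) fun K =>
      Real.tendsto_log_atTop.eventually (hasResonator_half_of_lt hκ (by linarith)
        ((Real.lt_sqrt hc.le).2 (by linarith)) K)
  simpa using h

end

theorem theorem2 :
    -- (A): the critical line
    (∀ (l : ℕ) (β : ℝ), 0 ≤ β → β < 1 →
      ∀ c : ℝ, 0 < c → c < Real.sqrt (2 * (1 - β)) →
        ∀ᶠ T : ℝ in Filter.atTop,
          ∃ M : ℝ,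
            IsGreatest
              ((fun t : ℝ => ‖iteratedDeriv l riemannZeta ((1 / 2 : ℂ) + (t : ℂ) * Complex.I)‖) ''
                Set.Icc (T ^ β) T) M ∧
            Real.exp (c * Real.sqrt
              (Real.log T * Real.log (Real.log (Real.log T)) / Real.log (Real.log T))) ≤ M) ∧
    -- (B): the right half of the critical strip; the constant is absolute
    (∃ C : ℝ, 0 < C ∧
      ∀ (l : ℕ) (β : ℝ), 0 ≤ β → β < 1 →
        ∀ σ : ℝ, 1 / 2 < σ → σ < 1 →
          ∀ κ : ℝ, 0 < κ → κ < 1 - β →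
            ∀ᶠ T : ℝ in Filter.atTop,
              ∃ M : ℝ,
                IsGreatest
                  ((fun t : ℝ => ‖iteratedDeriv l riemannZeta ((σ : ℂ) + (t : ℂ) * Complex.I)‖) ''
                    Set.Icc (T ^ β) T) M ∧
                Real.exp (C * κ ^ (1 - σ) / (1 - σ) *
                  (Real.log T ^ (1 - σ) / Real.log (Real.log T) ^ σ)) ≤ M) :=
  ⟨fun l _ hβ _ _ hc hcβ => extreme_values_critical_line l hβ hc hcβ,
    exists_extreme_values_right_half⟩
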